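/- Let $M$ be a smooth manifold of dimension $n\ge 3$, let $\alpha=\sqrt{a_{ij}(x)y^iy^j}$ and $\bar\alpha=\sqrt{\bar a_{ij}(x)y^iy^j}$ be (the norms of) two smooth Riemannian metrics on $M$, and let $\beta=b_i(x)y^i$ and $\bar\beta=\bar b_i(x)y^i$ be two nowhere vanishing smooth $1$-forms on $M$ that are collinear, i.e. $\beta=\mu\bar\beta$ for some function $\mu=\mu(x)$. Let $q\in\mathbb R$, $q\ne 1,-1$, and put $$F=\frac{\beta^q}{(\beta-\alpha)^{q-1}},\qquad \bar F=\frac{\bar\alpha^2}{\bar\beta}.$$ Let $D\subset TM\setminus 0$ be an open set, invariant under $y\mapsto cy$ $(c>0)$ and meeting every tangent space, on which $F$ is a Finsler metric, in the sense that at every point of $D$ either $\alpha<\beta$, or $q$ is an integer, $\beta\ne0$ and $\beta\neq\alpha$ (so that $F$ is defined, smooth, nonzero and positively homogeneous of degree one), and that the matrix $g_{ij}=\frac12\partial^2F^2/\partial y^i\partial y^j$ is invertible on $D$ (it need not be positive definite). The Kropina metric $\bar F$ is considered on $\{\bar\beta\ne0\}\supset D$. For a Finsler metric $L$, its spray coefficients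 are $G^i=\frac14g^{il}\big\{\frac{\partial^2L^2}{\partial x^k\partial y^l}y^k-\frac{\partial L^2}{\partial x^l}\big\}$; let $G^i$, $\bar G^i$, $G^i_\alpha$, $\bar G^i_{\bar\alpha}$ be those of $F$, $\bar F$, $\alpha$, $\bar\alpha$. The metrics $F$ and $\bar F$ are projectively related if there is a scalar function $P=P(x,y)$ with $G^i=\bar G^i+Py^i$ on $D$, in all local coordinates. Let $b_{i|j}$ be the covariant derivative of $\beta$ with respect to the Levi-Civita connection of $\alpha$, and put $r_{ij}=\frac12(b_{i|j}+b_{j|i})$, $s_{ij}=\frac12(b_{i|j}-b_{j|i})$, $r_{00}=r_{ij}y^iy^j$, $b^i=a^{ij}b_j$, $b^2=a^{ij}b_ib_j$, $s_j=b^is_{ij}$, $s^i=a^{ij}s_j$; the same symbols with a bar denote the corresponding objects of $\bar\alpha,\bar\beta$. Then $F$ is projectively related to $\bar F$ if and only if the following three conditions hold in all local coordinates: 1. there is a smooth $1$-form $\theta=\theta_i(x)y^i$ on $M$ such that, on $D$, $$G^i_{\alpha}-\bar G^i_{\bar\alpha}=\frac{1}{2\bar b^2}\big(\bar\alpha^2\bar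 s^i+\bar r_{00}\bar b^i\big)+\theta y^i-\frac12\,\frac{q\alpha^3r_{00}}{\beta^2(\beta-\alpha)+q(b^2\alpha^2-\beta^2)\alpha}\,b^i;$$ 2. $s_{ij}=0$ on $M$; 3. $\bar s_{ij}=\dfrac1{\bar b^2}\big(\bar b_i\bar s_j-\bar b_j\bar s_i\big)$ on $M$. -/

import Mathlib

open scoped Manifold ContDiff Bundle

noncomputable section

/-! ### Calculus in coordinates: sprays and covariant derivatives -/

section Coordinates

variable {n : ℕ}

/-- The partial derivative `∂f/∂x^i` at `x`. -/
def pd (i : Fin n) (f : EuclideanSpace ℝ (Fin n) → ℝ) (x : EuclideanSpace ℝ (Fin n)) : ℝ :=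
  fderiv ℝ f x (EuclideanSpace.single i 1)

/-- The fundamental tensor `g_ij = (1/2) ∂²L²/∂y^i∂y^j` of a Finsler function `L(x, y)`. -/
def fundamentalTensor (L : EuclideanSpace ℝ (Fin n) → EuclideanSpace ℝ (Fin n) → ℝ)
    (x y : EuclideanSpace ℝ (Fin n)) : Matrix (Fin n) (Fin n) ℝ :=
  Matrix.of fun i j => (1 / 2) * pd i (fun y' => pd j (fun y'' => L x y'' ^ 2) y') y

/-- The spray coefficients
`G^i = (1/4) g^{il} (∂²L²/∂x^k∂y^l y^k - ∂L²/∂x^l)` of a Finsler function `L(x, y)`. -/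
def sprayCoeff (L : EuclideanSpace ℝ (Fin n) → EuclideanSpace ℝ (Fin n) → ℝ)
    (x y : EuclideanSpace ℝ (Fin n)) (i : Fin n) : ℝ :=
  (1 / 4) * ∑ l, (fundamentalTensor L x y)⁻¹ i l *
    ((∑ k, pd k (fun x' => pd l (fun y' => L x' y' ^ 2) y) x * y k)
      - pd l (fun x' => L x' y ^ 2) x)

/-- The Christoffel symbols `Γ^k_ij` of the Levi-Civita connection of `a_ij(x)`. -/
def christoffel (a : EuclideanSpace ℝ (Fin n) → Matrix (Fin n) (Fin n) ℝ)
    (x : EuclideanSpace ℝ (Fin n)) (k i j : Fin n) : ℝ :=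
  (1 / 2) * ∑ l, (a x)⁻¹ k l *
    (pd i (fun x' => a x' l j) x + pd j (fun x' => a x' l i) x - pd l (fun x' => a x' i j) x)

variable (a : EuclideanSpace ℝ (Fin n) → Matrix (Fin n) (Fin n) ℝ)
  (b : EuclideanSpace ℝ (Fin n) → Fin n → ℝ) (x : EuclideanSpace ℝ (Fin n))

/-- The covariant derivative `b_{i|j} = ∂b_i/∂x^j - Γ^k_ij b_k`. -/
def covDeriv (i j : Fin n) : ℝ :=
  pd j (fun x' => b x' i) x - ∑ k, christoffel a x k i j * b x k

/-- `r_ij = (1/2) (b_{i|j} + b_{j|i})`. -/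
def rLow (i j : Fin n) : ℝ := (1 / 2) * (covDeriv a b x i j + covDeriv a b x j i)

/-- `s_ij = (1/2) (b_{i|j} - b_{j|i})`. -/
def sLow (i j : Fin n) : ℝ := (1 / 2) * (covDeriv a b x i j - covDeriv a b x j i)

/-- `b^i = a^{ij} b_j`. -/
def bUp (i : Fin n) : ℝ := ∑ j, (a x)⁻¹ i j * b x j

/-- `b² = a^{ij} b_i b_j`, the squared norm of the `1`-form. -/
def bSq : ℝ := ∑ i, bUp a b x i * b x i

/-- `s_j = b^i s_ij`. -/
def sCovec (j : Fin n) : ℝ := ∑ i, bUp a b x i * sLow a b x i j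

/-- `s^i = a^{ij} s_j`. -/
def sVec (i : Fin n) : ℝ := ∑ j, (a x)⁻¹ i j * sCovec a b x j

/-- `r_00 = r_ij y^i y^j`. -/
def rZeroZero (y : EuclideanSpace ℝ (Fin n)) : ℝ := ∑ i, ∑ j, rLow a b x i j * y i * y j

end Coordinates

/-! ### Metrics and forms on a manifold, and their expressions in charts -/

section Manifold

variable {n : ℕ} {M : Type*} [TopologicalSpace M] [ChartedSpace (EuclideanSpace ℝ (Fin n)) M]

variable (n M) in
/-- Smooth Riemannian metrics on `M`. -/
abbrev RiemMetric [IsManifold (𝓡 n) ∞ M] :=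
  Bundle.ContMDiffRiemannianMetric (𝓡 n) ∞ (EuclideanSpace ℝ (Fin n))
    (fun x : M => TangentSpace (𝓡 n) x)

variable (n M) in
/-- Smooth `1`-forms on `M`: smooth sections of the cotangent bundle. -/
abbrev OneForm [IsManifold (𝓡 n) ∞ M] :=
  Cₛ^∞⟮𝓡 n; EuclideanSpace ℝ (Fin n) →L[ℝ] ℝ,
    fun x : M => TangentSpace (𝓡 n) x →L[ℝ] Bundle.Trivial M ℝ x⟯

/-- The smooth charts of `M`. -/
abbrev IsSmoothChart (e : OpenPartialHomeomorph M (EuclideanSpace ℝ (Fin n))) : Prop :=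
  e ∈ IsManifold.maximalAtlas (𝓡 n) ∞ M

/-- The tangent vector `y^i ∂/∂x^i` at the point with coordinates `u` in the chart `e`. -/
def tangentVec (e : OpenPartialHomeomorph M (EuclideanSpace ℝ (Fin n)))
    (u y : EuclideanSpace ℝ (Fin n)) : TangentSpace (𝓡 n) (e.symm u) :=
  mfderiv (𝓡 n) (𝓡 n) e.symm u y

/-- The point of `TM` with coordinates `(u, y)` in the chart of `TM` induced by `e`. -/
def tangentPoint (e : OpenPartialHomeomorph M (EuclideanSpace ℝ (Fin n)))
    (u y : EuclideanSpace ℝ (Fin n)) : TangentBundle (𝓡 n) M :=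
  ⟨e.symm u, tangentVec e u y⟩

/-- A function `F(x, y)` on the tangent bundle, expressed in the chart `e`. -/
def localExpr (F : TangentBundle (𝓡 n) M → ℝ)
    (e : OpenPartialHomeomorph M (EuclideanSpace ℝ (Fin n)))
    (u y : EuclideanSpace ℝ (Fin n)) : ℝ :=
  F (tangentPoint e u y)

/-- The spray coefficients `G^i(x, y)` of `F` in the chart `e`. -/
def localSpray (F : TangentBundle (𝓡 n) M → ℝ)
    (e : OpenPartialHomeomorph M (EuclideanSpace ℝ (Fin n)))
    (u y : EuclideanSpace ℝ (Fin n)) (i : Fin n) : ℝ :=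
  sprayCoeff (localExpr F e) u y i

/-- `F` is a smooth, positively homogeneous Finsler function with nondegenerate fundamental tensor
on the open conic domain `D` of the slit tangent bundle, and `D` meets every tangent space. -/
structure IsConicFinsler [IsManifold (𝓡 n) ∞ M] (F : TangentBundle (𝓡 n) M → ℝ)
    (D : Set (TangentBundle (𝓡 n) M)) : Prop where
  isOpen : IsOpen D
  fiber_nonempty : ∀ x : M, ∃ v : TangentSpace (𝓡 n) x, (⟨x, v⟩ : TangentBundle (𝓡 n) M) ∈ D
  ne_zero : ∀ p ∈ D, p.2 ≠ 0
  smul_mem : ∀ p ∈ D, ∀ c : ℝ, 0 < c → (⟨p.1, c • p.2⟩ : TangentBundle (𝓡 n) M) ∈ D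
  smooth : ContMDiffOn (𝓡 n).tangent 𝓘(ℝ, ℝ) ∞ F D
  homogeneous : ∀ p ∈ D, ∀ c : ℝ, 0 < c → F ⟨p.1, c • p.2⟩ = c * F p
  nondegenerate : ∀ e : OpenPartialHomeomorph M (EuclideanSpace ℝ (Fin n)), IsSmoothChart e →
    ∀ u ∈ e.target, ∀ y, tangentPoint e u y ∈ D →
      (fundamentalTensor (localExpr F e) u y).det ≠ 0

/-- `F` and `F'` are projectively related on `D`: `G^i = G'^i + P y^i` in every chart, for a scalar
function `P` on the tangent bundle. -/
def ProjectivelyRelatedOn (D : Set (TangentBundle (𝓡 n) M))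
    (F F' : TangentBundle (𝓡 n) M → ℝ) : Prop :=
  ∃ P : TangentBundle (𝓡 n) M → ℝ,
    ∀ e : OpenPartialHomeomorph M (EuclideanSpace ℝ (Fin n)), IsSmoothChart e →
      ∀ u ∈ e.target, ∀ y, tangentPoint e u y ∈ D → ∀ i : Fin n,
        localSpray F e u y i = localSpray F' e u y i + P (tangentPoint e u y) * y i

variable [IsManifold (𝓡 n) ∞ M]

/-- The norm `α(x, y) = √(a_ij(x) y^i y^j)` of a Riemannian metric. -/
def RiemMetric.alpha (g : RiemMetric n M) (p : TangentBundle (𝓡 n) M) : ℝ :=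
  Real.sqrt (g.inner p.1 p.2 p.2)

/-- The function `β(x, y) = b_i(x) y^i` of a `1`-form. -/
def OneForm.eval (β : OneForm n M) (p : TangentBundle (𝓡 n) M) : ℝ :=
  β p.1 p.2

/-- The components `a_ij` of a Riemannian metric in the chart `e`. -/
def RiemMetric.coeff (g : RiemMetric n M)
    (e : OpenPartialHomeomorph M (EuclideanSpace ℝ (Fin n)))
    (u : EuclideanSpace ℝ (Fin n)) : Matrix (Fin n) (Fin n) ℝ :=
  Matrix.of fun i j => g.inner (e.symm u)
    (tangentVec e u (EuclideanSpace.single i 1)) (tangentVec e u (EuclideanSpace.single j 1))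

/-- The components `b_i` of a `1`-form in the chart `e`. -/
def OneForm.coeff (β : OneForm n M)
    (e : OpenPartialHomeomorph M (EuclideanSpace ℝ (Fin n)))
    (u : EuclideanSpace ℝ (Fin n)) (i : Fin n) : ℝ :=
  OneForm.eval β (tangentPoint e u (EuclideanSpace.single i 1))

/-- The function `F = β^q / (β - α)^(q - 1)`. -/
def qMetric (g : RiemMetric n M) (β : OneForm n M) (q : ℝ) (p : TangentBundle (𝓡 n) M) : ℝ :=
  (OneForm.eval β p) ^ q / (OneForm.eval β p - RiemMetric.alpha g p) ^ (q - 1)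

/-- The vectors at which both powers in `β^q / (β - α)^(q - 1)` are meaningful and nonzero:
those with `α < β` (then also `0 < β`) and, for an integer `q`, all those with `β ≠ 0` and
`β ≠ α`. -/
def qDomain (g : RiemMetric n M) (β : OneForm n M) (q : ℝ) : Set (TangentBundle (𝓡 n) M) :=
  {p | RiemMetric.alpha g p < OneForm.eval β p ∨
    ((∃ m : ℤ, (m : ℝ) = q) ∧ OneForm.eval β p ≠ 0 ∧
      OneForm.eval β p ≠ RiemMetric.alpha g p)}

/-- The Kropina metric `α² / β`. -/
def kropina (g : RiemMetric n M) (β : OneForm n M) (p : TangentBundle (𝓡 n) M) : ℝ :=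
  RiemMetric.alpha g p ^ 2 / OneForm.eval β p

/-- The domain `β ≠ 0` of the Kropina metric. -/
def kropinaDomain (β : OneForm n M) : Set (TangentBundle (𝓡 n) M) :=
  {p | OneForm.eval β p ≠ 0}

end Manifold

end

open scoped Manifold ContDiff Bundle

open Filter Topology

/-! Rapcsák's criterion turns projective relatedness into an Euler-Lagrange equation: G_F = G + P y
holds at a point exactly when the Euler-Lagrange covector of F vanishes for the acceleration -2G
(`eulerLagrange_eq_zero_iff`). For both metrics this covector is computed in terms of w = z + Γ(y,
y), where Γ belongs to the respective Riemannian metric (`eulerLagrange_kropina`,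
`eulerLagrange_q`). The Kropina equation is solved for w explicitly (`kropinaForm_eq_zero_iff`).
Inserting its solution into the equation of F gives the algebraic condition of
`exists_spray_eq_iff`, on one tangent space at a time.

Necessity. After multiplication by β̄ the condition reads E + αO = 0, with E and O polynomial in y.
It holds on an open set of directions, hence for all y ≠ 0 by analyticity. Since α and E are even
and O is odd, replacing y by -y separates E = 0 and O = 0 (`parts_eq_zero`). The combination E + βO
makes s(v, y) proportional to α²b(v) - β(y·v), which in dimension at least three forces s = 0
(`s_eq_zero`). Then E = 0 says that the cleared Kropina direction is parallel to y, and O = 0 gives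
q r₀₀ = 0, so the fraction in condition 1 actually vanishes. Parallelism on the hyperplane β̄ = 0
makes s̄ decomposable; the field is then 2β̄ times a quadratic map whose values are multiples of y,
so the multiplier is a linear form θ (`kropina_necessity`).

Sufficiency. Adding b^i to w changes the covector of F by a multiple of the denominator in condition
1 (`qForm_add_bv`), so the given correction is the one that solves the equation (`qForm_eq_zero`).
The denominator may vanish only where b^i is parallel to y, by nondegeneracy of F, and there the
equation holds anyway.

Globalization. Condition 1 describes a tensor field, so the local forms θ glue to a smooth 1-form.
In the converse direction the two sprays share the inhomogeneous term of their transformation law,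
so the local factors give one function P on the tangent bundle. -/

noncomputable section

/-! ### Euler-Lagrange covectors and homogeneous Lagrangians. -/

section EulerLagrange

variable {E : Type*} [NormedAddCommGroup E] [NormedSpace ℝ E]

/-- The Euler-Lagrange covector `(∂²L/∂x^k∂v) y^k + (∂²L/∂y^k∂v) z^k - ∂L/∂x^v` of `L(x, y)` at a
`1`-jet `p = (x, y)`, with acceleration `z`. -/
def eulerLagrange (L : E × E → ℝ) (p : E × E) (z v : E) : ℝ :=
  fderiv ℝ (fderiv ℝ L) p (p.2, z) (0, v) - fderiv ℝ L p (v, 0)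

/-- The covector is affine in the acceleration, with the vertical Hessian as slope; uniqueness of
sprays and the analysis of degenerate directions rest on this. -/
theorem eulerLagrange_add (L : E × E → ℝ) (p : E × E) (z z' v : E) :
    eulerLagrange L p (z + z') v
      = eulerLagrange L p z v + fderiv ℝ (fderiv ℝ L) p (0, z') (0, v) := by
  have h : ((p.2, z + z') : E × E) = (p.2, z) + (0, z') := by simp
  simp only [eulerLagrange, h, map_add, add_apply]
  ring

theorem Filter.EventuallyEq.eulerLagrange_eq {L L' : E × E → ℝ} {p : E × E} (h : L =ᶠ[𝓝 p] L')
    (z v : E) : eulerLagrange L p z v = eulerLagrange L' p z v := by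
  simp only [eulerLagrange, h.fderiv.fderiv_eq, h.fderiv_eq]

/-- Chain rule for the Euler-Lagrange covector of a function of two functions. -/
theorem eulerLagrange_comp {F A B P Q : E × E → ℝ} {p : E × E} {P' Q' : E × E →L[ℝ] ℝ}
    (hF : fderiv ℝ F =ᶠ[𝓝 p] fun p' => P p' • fderiv ℝ A p' + Q p' • fderiv ℝ B p')
    (hP : HasFDerivAt P P' p) (hQ : HasFDerivAt Q Q' p)
    (hA : DifferentiableAt ℝ (fderiv ℝ A) p) (hB : DifferentiableAt ℝ (fderiv ℝ B) p) (z v : E) :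
    eulerLagrange F p z v = P p * eulerLagrange A p z v + Q p * eulerLagrange B p z v
      + P' (p.2, z) * fderiv ℝ A p (0, v) + Q' (p.2, z) * fderiv ℝ B p (0, v) := by
  have h2 := ((hP.smul hA.hasFDerivAt).add (hQ.smul hB.hasFDerivAt)).congr_of_eventuallyEq hF
  simp only [eulerLagrange, h2.fderiv, hF.self_of_nhds]
  simp
  ring

theorem ContDiffAt.differentiableAt_fderiv {L : E × E → ℝ} {p : E × E} (h : ContDiffAt ℝ 2 L p) :
    DifferentiableAt ℝ (fderiv ℝ L) p :=
  (h.fderiv_right (m := 1) (by norm_num)).differentiableAt (by norm_num)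

theorem ContDiffAt.eventually_differentiableAt {L : E × E → ℝ} {p : E × E}
    (h : ContDiffAt ℝ 2 L p) : ∀ᶠ p' in 𝓝 p, DifferentiableAt ℝ L p' := by
  filter_upwards [h.eventually (by norm_num)] with p' hp'
  exact hp'.differentiableAt (by norm_num)

theorem ContDiffAt.symm_fderiv_fderiv {L : E × E → ℝ} {p : E × E} (h : ContDiffAt ℝ 2 L p)
    (v w : E × E) : fderiv ℝ (fderiv ℝ L) p v w = fderiv ℝ (fderiv ℝ L) p w v :=
  h.isSymmSndFDerivAt (by simp) v w

theorem eulerLagrange_sq {L : E × E → ℝ} {p : E × E} (h : ContDiffAt ℝ 2 L p) (z v : E) :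
    eulerLagrange (fun p' => L p' ^ 2) p z v = 2 * L p * eulerLagrange L p z v
      + 2 * fderiv ℝ L p (p.2, z) * fderiv ℝ L p (0, v) := by
  have hd : HasFDerivAt L (fderiv ℝ L p) p := (h.differentiableAt (by norm_num)).hasFDerivAt
  have hF : fderiv ℝ (fun p' => L p' ^ 2) =ᶠ[𝓝 p]
      fun p' => (2 * L p') • fderiv ℝ L p' + (0 : ℝ) • fderiv ℝ L p' := by
    filter_upwards [h.eventually_differentiableAt] with p' hp'
    rw [(hp'.hasFDerivAt.pow 2).fderiv]
    simp
  rw [eulerLagrange_comp hF (hd.const_mul 2) (hasFDerivAt_const (0 : ℝ) p)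
    h.differentiableAt_fderiv h.differentiableAt_fderiv]
  simp

theorem fderiv_fderiv_sq {L : E × E → ℝ} {p : E × E} (h : ContDiffAt ℝ 2 L p) (v w : E × E) :
    fderiv ℝ (fderiv ℝ (fun p' => L p' ^ 2)) p v w = 2 * L p * fderiv ℝ (fderiv ℝ L) p v w
      + 2 * fderiv ℝ L p v * fderiv ℝ L p w := by
  have hd : HasFDerivAt L (fderiv ℝ L p) p := (h.differentiableAt (by norm_num)).hasFDerivAt
  have hF : fderiv ℝ (fun p' => L p' ^ 2) =ᶠ[𝓝 p] fun p' => (2 * L p') • fderiv ℝ L p' := by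
    filter_upwards [h.eventually_differentiableAt] with p' hp'
    rw [(hp'.hasFDerivAt.pow 2).fderiv]
    simp
  rw [(((hd.const_mul 2).smul h.differentiableAt_fderiv.hasFDerivAt).congr_of_eventuallyEq
    hF).fderiv]
  simp

/-- `L` is positively homogeneous of degree one in `y` around `p`. -/
def HomogeneousAt (L : E × E → ℝ) (p : E × E) : Prop :=
  ∀ᶠ p' in 𝓝 p, ∀ᶠ c in 𝓝 (1 : ℝ), L (p'.1, c • p'.2) = c * L p'

section Homogeneous

variable {L : E × E → ℝ} {p : E × E}

/-- Euler's identity: differentiate c ↦ L(x, c y) at c = 1. -/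
theorem HomogeneousAt.euler (hL : HomogeneousAt L p) (h : ContDiffAt ℝ 2 L p) :
    ∀ᶠ p' in 𝓝 p, fderiv ℝ L p' (0, p'.2) = L p' := by
  filter_upwards [hL, h.eventually_differentiableAt] with p' hp' hd
  have h1 : HasDerivAt (fun c : ℝ => c * L p') (L p') 1 := by
    simpa using (hasDerivAt_id (1 : ℝ)).mul_const (L p')
  have h2 : HasDerivAt (fun c : ℝ => ((p'.1, c • p'.2) : E × E)) (0, p'.2) 1 := by
    have := (hasDerivAt_const (1 : ℝ) p'.1).prodMk ((hasDerivAt_id (1 : ℝ)).smul_const p'.2)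
    simpa using this
  have hd' : HasFDerivAt L (fderiv ℝ L p') (p'.1, (1 : ℝ) • p'.2) := by
    simpa using hd.hasFDerivAt
  exact (hd'.comp_hasDerivAt (1 : ℝ) h2).unique (h1.congr_of_eventuallyEq hp')

/-- Differentiate Euler's identity in the direction (v, w); the vertical term DL(0, w) cancels on
both sides. -/
theorem HomogeneousAt.fderiv_fderiv (hL : HomogeneousAt L p) (h : ContDiffAt ℝ 2 L p)
    (v w : E) : fderiv ℝ (fderiv ℝ L) p (v, w) (0, p.2) = fderiv ℝ L p (v, 0) := by
  have h1 : HasFDerivAt (fun p' : E × E => ((0, p'.2) : E × E))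
      ((0 : E × E →L[ℝ] E).prod (ContinuousLinearMap.snd ℝ E E)) p :=
    (hasFDerivAt_const (0 : E) p).prodMk hasFDerivAt_snd
  have h2 := h.differentiableAt_fderiv.hasFDerivAt.clm_apply h1
  have h3 := h2.unique
    ((h.differentiableAt (by norm_num)).hasFDerivAt.congr_of_eventuallyEq (hL.euler h))
  have h4 := DFunLike.congr_fun h3 (v, w)
  have h5 : ((v, w) : E × E) = (v, 0) + (0, w) := by simp
  simp at h4
  rw [h5, map_add (fderiv ℝ L p), ← h5] at h4
  linarith

theorem HomogeneousAt.fderiv_fderiv_vertical (hL : HomogeneousAt L p) (h : ContDiffAt ℝ 2 L p)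
    (v : E) : fderiv ℝ (fderiv ℝ L) p (0, p.2) (0, v) = 0 := by
  rw [h.symm_fderiv_fderiv, hL.fderiv_fderiv h]
  exact map_zero _

theorem HomogeneousAt.eulerLagrange_self (hL : HomogeneousAt L p) (h : ContDiffAt ℝ 2 L p)
    (z : E) : eulerLagrange L p z p.2 = 0 := by
  rw [eulerLagrange, hL.fderiv_fderiv h, sub_self]

theorem HomogeneousAt.eulerLagrange_add_smul (hL : HomogeneousAt L p) (h : ContDiffAt ℝ 2 L p)
    (z v : E) (c : ℝ) : eulerLagrange L p (z + c • p.2) v = eulerLagrange L p z v := by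
  have h1 : ((0, c • p.2) : E × E) = c • (0, p.2) := by simp
  rw [eulerLagrange_add, h1, map_smul, smul_apply,
    hL.fderiv_fderiv_vertical h]
  simp

/-- Along a geodesic of `L²`, the Euler-Lagrange covector of `L` vanishes. -/
theorem HomogeneousAt.eulerLagrange_eq_zero (hL : HomogeneousAt L p) (h : ContDiffAt ℝ 2 L p)
    (h0 : L p ≠ 0) {z : E} (hz : ∀ v, eulerLagrange (fun p' => L p' ^ 2) p z v = 0) (v : E) :
    eulerLagrange L p z v = 0 := by
  -- Testing with v = y shows that L is constant to first order along (y, z); the remaining term is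
  -- 2L times the covector of L.
  have h1 := hz p.2
  have h2 : fderiv ℝ L p (0, p.2) = L p := (hL.euler h).self_of_nhds
  rw [eulerLagrange_sq h, hL.eulerLagrange_self h, h2] at h1
  have h3 : fderiv ℝ L p (p.2, z) = 0 := by
    have : fderiv ℝ L p (p.2, z) * L p = 0 := by linarith
    exact (mul_eq_zero.1 this).resolve_right h0
  have h4 := hz v
  rw [eulerLagrange_sq h, h3] at h4
  have : L p * eulerLagrange L p z v = 0 := by linarith
  exact (mul_eq_zero.1 this).resolve_left h0

/-- The vertical Hessian of L² is 2L Hess L + 2 dL ⊗ dL. Subtracting from d the multiple of y with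
the same value under dL gives a vector in the kernel of both terms, hence zero. -/
theorem HomogeneousAt.exists_smul_of_fderiv_fderiv (hL : HomogeneousAt L p)
    (h : ContDiffAt ℝ 2 L p) (h0 : L p ≠ 0)
    (hnd : ∀ d : E, (∀ v, fderiv ℝ (fderiv ℝ (fun p' => L p' ^ 2)) p (0, d) (0, v) = 0) → d = 0)
    {d : E} (hd : ∀ v, fderiv ℝ (fderiv ℝ L) p (0, d) (0, v) = 0) : ∃ c : ℝ, d = c • p.2 := by
  have h2 : fderiv ℝ L p (0, p.2) = L p := (hL.euler h).self_of_nhds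
  refine ⟨fderiv ℝ L p (0, d) / L p, ?_⟩
  rw [← sub_eq_zero]
  set c := fderiv ℝ L p (0, d) / L p
  have h3 : ((0, d - c • p.2) : E × E) = (0, d) - c • (0, p.2) := by simp
  refine hnd _ fun v => ?_
  rw [fderiv_fderiv_sq h, h3]
  simp only [map_sub, map_smul, sub_apply, smul_apply, hd,
    hL.fderiv_fderiv_vertical h, h2, smul_eq_mul]
  rw [div_mul_cancel₀ _ h0]
  simp

end Homogeneous

end EulerLagrange

/-- The model space `ℝⁿ`. -/
abbrev Euc (n : ℕ) : Type := EuclideanSpace ℝ (Fin n)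

/-! ### Spray coefficients as solutions of the geodesic equation, and Rapcsák's criterion. -/

section Spray

variable {n : ℕ}

theorem sum_smul_single (y : Euc n) : ∑ k, y k • EuclideanSpace.single k (1 : ℝ) = y := by
  simpa using (EuclideanSpace.basisFun (Fin n) ℝ).sum_repr y

variable {f : Euc n → Euc n → ℝ} {x y : Euc n}

theorem pd_snd (h : DifferentiableAt ℝ (Function.uncurry f) (x, y)) (i : Fin n) :
    pd i (f x) y = fderiv ℝ (Function.uncurry f) (x, y) (0, EuclideanSpace.single i 1) := by
  have h1 : HasFDerivAt (fun y' : Euc n => (x, y')) (ContinuousLinearMap.inr ℝ (Euc n) (Euc n)) y :=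
    hasFDerivAt_prodMk_right x y
  have h2 := HasFDerivAt.comp y h.hasFDerivAt h1
  have h3 : Function.uncurry f ∘ (fun y' : Euc n => (x, y')) = f x := rfl
  rw [h3] at h2
  simp [pd, h2.fderiv]

theorem pd_fst (h : DifferentiableAt ℝ (Function.uncurry f) (x, y)) (i : Fin n) :
    pd i (fun x' => f x' y) x
      = fderiv ℝ (Function.uncurry f) (x, y) (EuclideanSpace.single i 1, 0) := by
  have h1 : HasFDerivAt (fun x' : Euc n => (x', y)) (ContinuousLinearMap.inl ℝ (Euc n) (Euc n)) x :=
    hasFDerivAt_prodMk_left x y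
  have h2 := HasFDerivAt.comp x h.hasFDerivAt h1
  have h3 : Function.uncurry f ∘ (fun x' : Euc n => (x', y)) = fun x' => f x' y := rfl
  rw [h3] at h2
  simp [pd, h2.fderiv]

theorem hasFDerivAt_fderiv_apply (h : ContDiffAt ℝ 2 (Function.uncurry f) (x, y)) (w : Euc n × Euc n) :
    HasFDerivAt (fun p => fderiv ℝ (Function.uncurry f) p w)
      ((fderiv ℝ (fderiv ℝ (Function.uncurry f)) (x, y)).flip w) (x, y) := by
  have := h.differentiableAt_fderiv.hasFDerivAt.clm_apply (hasFDerivAt_const w (x, y))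
  simpa using this

theorem pd_pd_snd (h : ContDiffAt ℝ 2 (Function.uncurry f) (x, y)) (i j : Fin n) :
    pd i (fun y' => pd j (fun y'' => f x y'') y') y
      = fderiv ℝ (fderiv ℝ (Function.uncurry f)) (x, y) (0, EuclideanSpace.single i 1)
        (0, EuclideanSpace.single j 1) := by
  have h1 : Tendsto (fun y' : Euc n => (x, y')) (𝓝 y) (𝓝 (x, y)) :=
    (Continuous.prodMk_right x).tendsto y
  have h2 : (fun y' => pd j (fun y'' => f x y'') y') =ᶠ[𝓝 y]
      fun y' => fderiv ℝ (Function.uncurry f) (x, y') (0, EuclideanSpace.single j 1) := by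
    filter_upwards [h1.eventually h.eventually_differentiableAt] with y' hy'
    exact pd_snd hy' j
  have h3 := HasFDerivAt.comp y (hasFDerivAt_fderiv_apply h (0, EuclideanSpace.single j 1))
    (hasFDerivAt_prodMk_right x y)
  have h4 := h3.congr_of_eventuallyEq h2
  simp [pd] at h4 ⊢
  rw [h4.fderiv]
  simp

theorem pd_pd_fst_snd (h : ContDiffAt ℝ 2 (Function.uncurry f) (x, y)) (i j : Fin n) :
    pd i (fun x' => pd j (fun y'' => f x' y'') y) x
      = fderiv ℝ (fderiv ℝ (Function.uncurry f)) (x, y) (EuclideanSpace.single i 1, 0)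
        (0, EuclideanSpace.single j 1) := by
  have h1 : Tendsto (fun x' : Euc n => (x', y)) (𝓝 x) (𝓝 (x, y)) :=
    (Continuous.prodMk_left y).tendsto x
  have h2 : (fun x' => pd j (fun y'' => f x' y'') y) =ᶠ[𝓝 x]
      fun x' => fderiv ℝ (Function.uncurry f) (x', y) (0, EuclideanSpace.single j 1) := by
    filter_upwards [h1.eventually h.eventually_differentiableAt] with y' hy'
    exact pd_snd hy' j
  have h3 := HasFDerivAt.comp (f := fun x' : Euc n => (x', y)) x
    (hasFDerivAt_fderiv_apply h (0, EuclideanSpace.single j 1)) (hasFDerivAt_prodMk_left x y)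
  have h4 := h3.congr_of_eventuallyEq h2
  simp [pd] at h4 ⊢
  rw [h4.fderiv]
  simp

variable {L : Euc n → Euc n → ℝ}

/-- The spray coefficients as a vector. -/
def sprayVec (L : Euc n → Euc n → ℝ) (x y : Euc n) : Euc n := WithLp.toLp 2 (sprayCoeff L x y)

theorem sprayVec_apply (L : Euc n → Euc n → ℝ) (x y : Euc n) (i : Fin n) :
    sprayVec L x y i = sprayCoeff L x y i := rfl

variable (h : ContDiffAt ℝ 2 (fun p : Euc n × Euc n => L p.1 p.2 ^ 2) (x, y))
include h

theorem fundamentalTensor_apply (i j : Fin n) : fundamentalTensor L x y i j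
    = 1 / 2 * fderiv ℝ (fderiv ℝ (fun p : Euc n × Euc n => L p.1 p.2 ^ 2)) (x, y)
      (0, EuclideanSpace.single i 1) (0, EuclideanSpace.single j 1) := by
  have := pd_pd_snd (f := fun x y => L x y ^ 2) h i j
  simp only [fundamentalTensor, Matrix.of_apply]
  rw [this]
  rfl

theorem fundamentalTensor_mulVec (d : Euc n) (i : Fin n) :
    (fundamentalTensor L x y).mulVec d i
      = 1 / 2 * fderiv ℝ (fderiv ℝ (fun p : Euc n × Euc n => L p.1 p.2 ^ 2)) (x, y)
        (0, d) (0, EuclideanSpace.single i 1) := by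
  have h1 : ((0, d) : Euc n × Euc n)
      = ∑ k, d k • ((0, EuclideanSpace.single k (1 : ℝ)) : Euc n × Euc n) := by
    ext1
    · simp [Prod.fst_sum]
    · simp [Prod.snd_sum, sum_smul_single]
  rw [h1, map_sum, sum_apply, Finset.mul_sum, Matrix.mulVec, dotProduct]
  refine Finset.sum_congr rfl fun k _ => ?_
  rw [map_smul, smul_apply, fundamentalTensor_apply h, h.symm_fderiv_fderiv]
  simp
  ring

theorem fundamentalTensor_det_ne_zero_iff : (fundamentalTensor L x y).det ≠ 0 ↔
    ∀ d : Euc n, (∀ v, fderiv ℝ (fderiv ℝ (fun p : Euc n × Euc n => L p.1 p.2 ^ 2)) (x, y)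
      (0, d) (0, v) = 0) → d = 0 := by
  constructor
  · intro hdet d hd
    have : (fundamentalTensor L x y).mulVec d = 0 := by
      ext i
      rw [fundamentalTensor_mulVec h, hd]
      simp
    have h2 := Matrix.eq_zero_of_mulVec_eq_zero hdet this
    ext i
    exact congrFun h2 i
  · intro H hdet
    obtain ⟨v, hv, hv'⟩ := Matrix.exists_mulVec_eq_zero_iff.2 hdet
    refine hv ?_
    have h3 := H (WithLp.toLp 2 v) fun w => ?_
    · simpa using h3
    · have h4 : ((0, w) : Euc n × Euc n)
          = ∑ k, w k • ((0, EuclideanSpace.single k (1 : ℝ)) : Euc n × Euc n) := by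
        ext1
        · simp [Prod.fst_sum]
        · simp [Prod.snd_sum, sum_smul_single]
      rw [h4, map_sum]
      refine Finset.sum_eq_zero fun k _ => ?_
      have h5 := fundamentalTensor_mulVec h (WithLp.toLp 2 v) k
      rw [map_smul]
      have h6 : (fundamentalTensor L x y).mulVec (WithLp.toLp 2 v).ofLp k = 0 := by
        rw [show (WithLp.toLp 2 v).ofLp = v from rfl, hv']
        rfl
      rw [h6] at h5
      have h7 : fderiv ℝ (fderiv ℝ (fun p : Euc n × Euc n => L p.1 p.2 ^ 2)) (x, y)
        (0, WithLp.toLp 2 v) (0, EuclideanSpace.single k 1) = 0 := by linarith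
      rw [h7, smul_zero]

/-- The spray coefficients solve the geodesic equation. -/
theorem eulerLagrange_sprayVec (hdet : (fundamentalTensor L x y).det ≠ 0) (v : Euc n) :
    eulerLagrange (fun p : Euc n × Euc n => L p.1 p.2 ^ 2) (x, y) (-(2 : ℝ) • sprayVec L x y) v = 0 := by
  have key : ∀ l : Fin n, eulerLagrange (fun p : Euc n × Euc n => L p.1 p.2 ^ 2) (x, y)
      (-(2 : ℝ) • sprayVec L x y) (EuclideanSpace.single l 1) = 0 := by
    intro l
    -- Lowering the index of the spray gives R/4, while the fundamental tensor is half the Hessian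
    -- of L²; this is why the acceleration of a geodesic is -2G.
    set R : Fin n → ℝ := fun l => (∑ k, pd k (fun x' => pd l (fun y' => L x' y' ^ 2) y) x * y k)
      - pd l (fun x' => L x' y ^ 2) x with hR
    have h1 : (sprayVec L x y).ofLp = (1 / 4 : ℝ) • (fundamentalTensor L x y)⁻¹.mulVec R := by
      ext i
      simp [sprayVec_apply, sprayCoeff, Matrix.mulVec, dotProduct, hR]
    have h2 : (fundamentalTensor L x y).mulVec (sprayVec L x y).ofLp = (1 / 4 : ℝ) • R := by
      rw [h1, Matrix.mulVec_smul, Matrix.mulVec_mulVec,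
        Matrix.mul_nonsing_inv _ (isUnit_iff_ne_zero.2 hdet), Matrix.one_mulVec]
    have h3 := congrFun h2 l
    rw [fundamentalTensor_mulVec h] at h3
    have h4 : R l = fderiv ℝ (fderiv ℝ (fun p : Euc n × Euc n => L p.1 p.2 ^ 2)) (x, y) (y, 0)
        (0, EuclideanSpace.single l 1)
        - fderiv ℝ (fun p : Euc n × Euc n => L p.1 p.2 ^ 2) (x, y) (EuclideanSpace.single l 1, 0) := by
      have h5 : ((y, 0) : Euc n × Euc n)
          = ∑ k, y k • ((EuclideanSpace.single k (1 : ℝ), 0) : Euc n × Euc n) := by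
        ext1
        · simp [Prod.fst_sum, sum_smul_single]
        · simp [Prod.snd_sum]
      simp only [hR]
      congr 1
      · rw [h5, map_sum, sum_apply]
        refine Finset.sum_congr rfl fun k _ => ?_
        rw [pd_pd_fst_snd (f := fun x y => L x y ^ 2) h, map_smul, smul_apply,
          mul_comm]
        rfl
      · exact pd_fst (f := fun x y => L x y ^ 2) (h.differentiableAt (by norm_num)) l
    have h6 : ((y, -(2 : ℝ) • sprayVec L x y) : Euc n × Euc n)
        = (y, 0) + -(2 : ℝ) • (0, sprayVec L x y) := by simp
    rw [eulerLagrange, h6, map_add, add_apply, map_smul,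
      smul_apply]
    simp only [Pi.smul_apply, smul_eq_mul, h4] at h3
    simp only [smul_eq_mul]
    linarith
  have h4 : ∀ a : Euc n × Euc n →L[ℝ] ℝ, a (0, v) = ∑ k, v k * a (0, EuclideanSpace.single k 1) := by
    intro a
    have : ((0, v) : Euc n × Euc n)
        = ∑ k, v k • ((0, EuclideanSpace.single k (1 : ℝ)) : Euc n × Euc n) := by
      ext1
      · simp [Prod.fst_sum]
      · simp [Prod.snd_sum, sum_smul_single]
    rw [this, map_sum]
    simp_rw [map_smul, smul_eq_mul]
  have h5 : ∀ a : Euc n × Euc n →L[ℝ] ℝ, a (v, 0) = ∑ k, v k * a (EuclideanSpace.single k 1, 0) := by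
    intro a
    have : ((v, 0) : Euc n × Euc n)
        = ∑ k, v k • ((EuclideanSpace.single k (1 : ℝ), 0) : Euc n × Euc n) := by
      ext1
      · simp [Prod.fst_sum, sum_smul_single]
      · simp [Prod.snd_sum]
    rw [this, map_sum]
    simp_rw [map_smul, smul_eq_mul]
  rw [eulerLagrange, h4, h5, ← Finset.sum_sub_distrib]
  refine Finset.sum_eq_zero fun k _ => ?_
  rw [← mul_sub]
  exact mul_eq_zero_of_right _ (key k)

/-- Two solutions differ by a vector in the kernel of the fundamental tensor. -/
theorem eq_sprayVec (hdet : (fundamentalTensor L x y).det ≠ 0) {G : Euc n}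
    (hG : ∀ v, eulerLagrange (fun p : Euc n × Euc n => L p.1 p.2 ^ 2) (x, y) (-(2 : ℝ) • G) v = 0) :
    G = sprayVec L x y := by
  have h1 := (fundamentalTensor_det_ne_zero_iff h).1 hdet (-(2 : ℝ) • (G - sprayVec L x y)) ?_
  · simpa [sub_eq_zero] using h1
  · intro v
    have h2 := eulerLagrange_add (fun p : Euc n × Euc n => L p.1 p.2 ^ 2) (x, y)
      (-(2 : ℝ) • sprayVec L x y) (-(2 : ℝ) • (G - sprayVec L x y)) v
    rw [← smul_add, add_sub_cancel, hG, eulerLagrange_sprayVec h hdet] at h2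
    linarith

omit h

/-- Rapcsák's criterion: a spray is projectively related to the one of `L` if and only if its
geodesics satisfy the Euler-Lagrange equation of `L`. -/
theorem eulerLagrange_eq_zero_iff (h : ContDiffAt ℝ 2 (fun p : Euc n × Euc n => L p.1 p.2) (x, y))
    (hL : HomogeneousAt (fun p : Euc n × Euc n => L p.1 p.2) (x, y)) (h0 : L x y ≠ 0)
    (hdet : (fundamentalTensor L x y).det ≠ 0) (G : Euc n) :
    (∀ v, eulerLagrange (fun p : Euc n × Euc n => L p.1 p.2) (x, y) (-(2 : ℝ) • G) v = 0)
      ↔ ∃ c : ℝ, sprayVec L x y = G + c • y := by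
  have h1 : ContDiffAt ℝ 2 (fun p : Euc n × Euc n => L p.1 p.2 ^ 2) (x, y) := h.pow 2
  have h2 := hL.eulerLagrange_eq_zero h h0 (eulerLagrange_sprayVec h1 hdet)
  constructor
  · intro hG
    have h3 : ∀ v, fderiv ℝ (fderiv ℝ (fun p : Euc n × Euc n => L p.1 p.2)) (x, y)
        (0, -(2 : ℝ) • (sprayVec L x y - G)) (0, v) = 0 := by
      intro v
      have h4 := eulerLagrange_add (fun p : Euc n × Euc n => L p.1 p.2) (x, y)
        (-(2 : ℝ) • G) (-(2 : ℝ) • (sprayVec L x y - G)) v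
      rw [← smul_add, add_sub_cancel, hG, h2] at h4
      linarith
    obtain ⟨c, hc⟩ := hL.exists_smul_of_fderiv_fderiv h h0
      ((fundamentalTensor_det_ne_zero_iff h1).1 hdet) h3
    -- The vertical Hessian gave -2(G_L - G) = c y.
    refine ⟨-c / 2, ?_⟩
    have h5 : (-(2 : ℝ)) • (sprayVec L x y - G) = (-(2 : ℝ)) • ((-c / 2) • y) := by
      rw [hc, smul_smul]
      congr 1
      ring
    have h6 := smul_right_injective (Euc n) (show (-(2 : ℝ)) ≠ 0 by norm_num) h5
    rw [← h6]
    abel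
  · rintro ⟨c, hc⟩ v
    have h3 : -(2 : ℝ) • G = -(2 : ℝ) • sprayVec L x y + (2 * c) • y := by
      rw [hc]
      module
    rw [h3]
    have := hL.eulerLagrange_add_smul h (-(2 : ℝ) • sprayVec L x y) v (2 * c)
    rw [this]
    exact h2 v

end Spray

/-! ### Derivatives of the energy of a metric and of a 1-form. -/

section QuadraticLagrangian

variable {E : Type*} [NormedAddCommGroup E] [NormedSpace ℝ E]

/-- Shortcut instance. -/
local instance bilinNormedAddCommGroup : NormedAddCommGroup (E →L[ℝ] E →L[ℝ] ℝ) :=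
  ContinuousLinearMap.toNormedAddCommGroup

/-- Shortcut instance. -/
local instance bilinNormedSpace : NormedSpace ℝ (E →L[ℝ] E →L[ℝ] ℝ) :=
  ContinuousLinearMap.toNormedSpace

/-- Reduces a second derivative to the derivative of p ↦ DL(p)u for a fixed u, for which an explicit
formula is at hand. -/
theorem fderiv_fderiv_apply_eq {L : E × E → ℝ} {p : E × E}
    (h : DifferentiableAt ℝ (fderiv ℝ L) p) {u : E × E} {f' : E × E →L[ℝ] ℝ}
    (hf : HasFDerivAt (fun p' => fderiv ℝ L p' u) f' p) (w : E × E) :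
    fderiv ℝ (fderiv ℝ L) p w u = f' w := by
  have h1 := h.hasFDerivAt.clm_apply (hasFDerivAt_const u p)
  have h2 := DFunLike.congr_fun (h1.unique hf) w
  simpa using h2

/-- The energy `m_x(y, y)` of a metric `m`. -/
def metricEnergy (m : E → E →L[ℝ] E →L[ℝ] ℝ) (p : E × E) : ℝ := m p.1 p.2 p.2

/-- The function `η_x(y)` of a `1`-form `η`. -/
def formEval (η : E → E →L[ℝ] ℝ) (p : E × E) : ℝ := η p.1 p.2

variable {m : E → E →L[ℝ] E →L[ℝ] ℝ} {η : E → E →L[ℝ] ℝ} {p : E × E}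

theorem contDiffAt_metricEnergy {k : WithTop ℕ∞} (hm : ContDiffAt ℝ k m p.1) :
    ContDiffAt ℝ k (metricEnergy m) p :=
  ((ContDiffAt.comp p hm contDiffAt_fst).clm_apply contDiffAt_snd).clm_apply contDiffAt_snd

theorem contDiffAt_formEval {k : WithTop ℕ∞} (hη : ContDiffAt ℝ k η p.1) :
    ContDiffAt ℝ k (formEval η) p :=
  (ContDiffAt.comp p hη contDiffAt_fst).clm_apply contDiffAt_snd

theorem fderiv_metricEnergy (hm : DifferentiableAt ℝ m p.1) (h k : E) :
    fderiv ℝ (metricEnergy m) p (h, k)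
      = fderiv ℝ m p.1 h p.2 p.2 + m p.1 k p.2 + m p.1 p.2 k := by
  have h1 : HasFDerivAt (fun p' : E × E => m p'.1) _ p := HasFDerivAt.comp (g := m) (f := Prod.fst) p hm.hasFDerivAt hasFDerivAt_fst
  have h2 : HasFDerivAt (metricEnergy m) _ p :=
    (h1.clm_apply hasFDerivAt_snd).clm_apply hasFDerivAt_snd
  rw [h2.fderiv]
  simp
  ring

theorem fderiv_formEval (hη : DifferentiableAt ℝ η p.1) (h k : E) :
    fderiv ℝ (formEval η) p (h, k) = fderiv ℝ η p.1 h p.2 + η p.1 k := by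
  have h1 : HasFDerivAt (fun p' : E × E => η p'.1) _ p := hη.hasFDerivAt.comp p hasFDerivAt_fst
  have h2 : HasFDerivAt (formEval η) _ p := h1.clm_apply hasFDerivAt_snd
  rw [h2.fderiv]
  simp
  ring

theorem fderiv_fderiv_metricEnergy (hm : ContDiffAt ℝ 2 m p.1) (h k v : E) :
    fderiv ℝ (fderiv ℝ (metricEnergy m)) p (h, k) (0, v)
      = fderiv ℝ m p.1 h v p.2 + fderiv ℝ m p.1 h p.2 v + m p.1 k v + m p.1 v k := by
  have hd := hm.differentiableAt (by norm_num)
  have h1 : HasFDerivAt (fun p' : E × E => m p'.1) _ p := HasFDerivAt.comp (g := m) (f := Prod.fst) p hd.hasFDerivAt hasFDerivAt_fst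
  have h2 := ((h1.clm_apply (hasFDerivAt_const v p)).clm_apply hasFDerivAt_snd).add
    ((h1.clm_apply hasFDerivAt_snd).clm_apply (hasFDerivAt_const v p))
  have h3 : (fun p' => fderiv ℝ (metricEnergy m) p' (0, v)) =ᶠ[𝓝 p]
      fun p' => m p'.1 v p'.2 + m p'.1 p'.2 v := by
    have : ∀ᶠ p' in 𝓝 p, DifferentiableAt ℝ m p'.1 := by
      have h4 : ∀ᶠ x' in 𝓝 p.1, DifferentiableAt ℝ m x' := by
        filter_upwards [hm.eventually (by norm_num)] with x' hx'
        exact hx'.differentiableAt (by norm_num)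
      exact continuous_fst.continuousAt.eventually h4
    filter_upwards [this] with p' hp'
    rw [fderiv_metricEnergy hp']
    simp
  rw [fderiv_fderiv_apply_eq (contDiffAt_metricEnergy hm).differentiableAt_fderiv
    (h2.congr_of_eventuallyEq h3)]
  simp
  ring

theorem fderiv_fderiv_formEval (hη : ContDiffAt ℝ 2 η p.1) (h k v : E) :
    fderiv ℝ (fderiv ℝ (formEval η)) p (h, k) (0, v) = fderiv ℝ η p.1 h v := by
  have hd := hη.differentiableAt (by norm_num)
  have h1 : HasFDerivAt (fun p' : E × E => η p'.1) _ p := HasFDerivAt.comp (g := η) (f := Prod.fst) p hd.hasFDerivAt hasFDerivAt_fst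
  have h2 := h1.clm_apply (hasFDerivAt_const v p)
  have h3 : (fun p' => fderiv ℝ (formEval η) p' (0, v)) =ᶠ[𝓝 p] fun p' => η p'.1 v := by
    have : ∀ᶠ p' in 𝓝 p, DifferentiableAt ℝ η p'.1 := by
      have h4 : ∀ᶠ x' in 𝓝 p.1, DifferentiableAt ℝ η x' := by
        filter_upwards [hη.eventually (by norm_num)] with x' hx'
        exact hx'.differentiableAt (by norm_num)
      exact continuous_fst.continuousAt.eventually h4
    filter_upwards [this] with p' hp'
    rw [fderiv_formEval hp']
    simp
  rw [fderiv_fderiv_apply_eq (contDiffAt_formEval hη).differentiableAt_fderiv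
    (h2.congr_of_eventuallyEq h3)]
  simp

theorem eulerLagrange_formEval (hη : ContDiffAt ℝ 2 η p.1) (z v : E) :
    eulerLagrange (formEval η) p z v = fderiv ℝ η p.1 p.2 v - fderiv ℝ η p.1 v p.2 := by
  rw [eulerLagrange, fderiv_fderiv_formEval hη, fderiv_formEval (hη.differentiableAt (by norm_num))]
  simp

theorem eulerLagrange_metricEnergy (hm : ContDiffAt ℝ 2 m p.1) (z v : E) :
    eulerLagrange (metricEnergy m) p z v
      = fderiv ℝ m p.1 p.2 v p.2 + fderiv ℝ m p.1 p.2 p.2 v - fderiv ℝ m p.1 v p.2 p.2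
        + m p.1 z v + m p.1 v z := by
  rw [eulerLagrange, fderiv_fderiv_metricEnergy hm,
    fderiv_metricEnergy (hm.differentiableAt (by norm_num))]
  simp
  ring

end QuadraticLagrangian

/-! ### Translation between index notation and bilinear forms. -/

section IndexNotation

attribute [local instance] bilinNormedAddCommGroup bilinNormedSpace

variable {n : ℕ}

/-- The bilinear form `N_ij v^i w^j`. -/
def matForm (N : Matrix (Fin n) (Fin n) ℝ) : Euc n →L[ℝ] Euc n →L[ℝ] ℝ :=
  ∑ i, ∑ j, N i j • (EuclideanSpace.proj i : Euc n →L[ℝ] ℝ).smulRight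
    (EuclideanSpace.proj j : Euc n →L[ℝ] ℝ)

theorem matForm_apply (N : Matrix (Fin n) (Fin n) ℝ) (v w : Euc n) :
    matForm N v w = ∑ i, ∑ j, N i j * v i * w j := by
  simp [matForm, sum_apply, mul_assoc]

/-- The linear form `c_i v^i`. -/
def covForm (c : Fin n → ℝ) : Euc n →L[ℝ] ℝ :=
  ∑ i, c i • (EuclideanSpace.proj i : Euc n →L[ℝ] ℝ)

theorem covForm_apply (c : Fin n → ℝ) (v : Euc n) : covForm c v = ∑ i, c i * v i := by
  simp [covForm, sum_apply]

theorem covForm_single (c : Fin n → ℝ) (i : Fin n) :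
    covForm c (EuclideanSpace.single i 1) = c i := by
  simp [covForm_apply]

theorem matForm_single (N : Matrix (Fin n) (Fin n) ℝ) (i j : Fin n) :
    matForm N (EuclideanSpace.single i 1) (EuclideanSpace.single j 1) = N i j := by
  simp [matForm_apply]

theorem matForm_eq_covForm (N : Matrix (Fin n) (Fin n) ℝ) (v w : Euc n) :
    matForm N v w = covForm (N.mulVec w) v := by
  simp only [matForm_apply, covForm_apply, Matrix.mulVec, dotProduct, Finset.sum_mul]
  exact Finset.sum_congr rfl fun i _ => Finset.sum_congr rfl fun j _ => by ring

theorem matForm_comm {N : Matrix (Fin n) (Fin n) ℝ} (hN : N.IsSymm) (v w : Euc n) :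
    matForm N v w = matForm N w v := by
  rw [matForm_apply, matForm_apply, Finset.sum_comm]
  refine Finset.sum_congr rfl fun i _ => Finset.sum_congr rfl fun j _ => ?_
  rw [hN.apply]
  ring

/-- The vector `N^{ij} c_j`. -/
def raise (N : Matrix (Fin n) (Fin n) ℝ) (c : Fin n → ℝ) : Euc n := WithLp.toLp 2 (N⁻¹.mulVec c)

theorem matForm_raise {N : Matrix (Fin n) (Fin n) ℝ} (hN : N.IsSymm) (hdet : N.det ≠ 0)
    (c : Fin n → ℝ) (v : Euc n) : matForm N (raise N c) v = covForm c v := by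
  rw [matForm_comm hN, matForm_eq_covForm, raise]
  simp [Matrix.mulVec_mulVec, Matrix.mul_nonsing_inv _ (isUnit_iff_ne_zero.2 hdet)]

theorem det_ne_zero_of_matForm_pos {N : Matrix (Fin n) (Fin n) ℝ}
    (hN : ∀ v : Euc n, v ≠ 0 → 0 < matForm N v v) : N.det ≠ 0 := by
  intro hdet
  obtain ⟨v, hv, hv'⟩ := Matrix.exists_mulVec_eq_zero_iff.2 hdet
  have h1 := hN (WithLp.toLp 2 v) (by simpa using hv)
  rw [matForm_eq_covForm] at h1
  simp [hv', covForm_apply] at h1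

variable {a : Euc n → Matrix (Fin n) (Fin n) ℝ} {b : Euc n → Fin n → ℝ} {x : Euc n}

theorem contDiffAt_matForm {k : WithTop ℕ∞}
    (ha : ∀ i j, ContDiffAt ℝ k (fun x' => a x' i j) x) :
    ContDiffAt ℝ k (fun x' => matForm (a x')) x := by
  unfold matForm
  exact ContDiffAt.sum fun i _ => ContDiffAt.sum fun j _ => (ha i j).smul contDiffAt_const

theorem contDiffAt_covForm {k : WithTop ℕ∞} (hb : ∀ i, ContDiffAt ℝ k (fun x' => b x' i) x) :
    ContDiffAt ℝ k (fun x' => covForm (b x')) x := by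
  unfold covForm
  exact ContDiffAt.sum fun i _ => (hb i).smul contDiffAt_const

theorem fderiv_matForm (ha : ∀ i j, DifferentiableAt ℝ (fun x' => a x' i j) x) (h v w : Euc n) :
    fderiv ℝ (fun x' => matForm (a x')) x h v w
      = ∑ i, ∑ j, fderiv ℝ (fun x' => a x' i j) x h * v i * w j := by
  have h1 : HasFDerivAt (fun x' => matForm (a x'))
      (∑ i, ∑ j, (fderiv ℝ (fun x' => a x' i j) x).smulRight
        ((EuclideanSpace.proj i : Euc n →L[ℝ] ℝ).smulRight
          (EuclideanSpace.proj j : Euc n →L[ℝ] ℝ))) x :=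
    HasFDerivAt.fun_sum fun i _ => HasFDerivAt.fun_sum fun j _ =>
      (ha i j).hasFDerivAt.smul_const ((EuclideanSpace.proj i : Euc n →L[ℝ] ℝ).smulRight
          (EuclideanSpace.proj j : Euc n →L[ℝ] ℝ))
  rw [h1.fderiv]
  simp [sum_apply, mul_assoc]

theorem fderiv_covForm (hb : ∀ i, DifferentiableAt ℝ (fun x' => b x' i) x) (h v : Euc n) :
    fderiv ℝ (fun x' => covForm (b x')) x h v = ∑ i, fderiv ℝ (fun x' => b x' i) x h * v i := by
  have h1 : HasFDerivAt (fun x' => covForm (b x'))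
      (∑ i, (fderiv ℝ (fun x' => b x' i) x).smulRight (EuclideanSpace.proj i : Euc n →L[ℝ] ℝ)) x :=
    HasFDerivAt.fun_sum fun i _ => (hb i).hasFDerivAt.smul_const (EuclideanSpace.proj i : Euc n →L[ℝ] ℝ)
  rw [h1.fderiv]
  simp [sum_apply]

theorem fderiv_apply_eq_sum_pd (f : Euc n → ℝ) (x h : Euc n) :
    fderiv ℝ f x h = ∑ k, pd k f x * h k := by
  conv_lhs => rw [← sum_smul_single h]
  simp [pd, map_sum, mul_comm]

/-- The vector-valued quadratic form `Γ^k_ij v^i w^j`. -/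
def christoffelForm (a : Euc n → Matrix (Fin n) (Fin n) ℝ) (x : Euc n) :
    Euc n →L[ℝ] Euc n →L[ℝ] Euc n :=
  ∑ k, ∑ i, ∑ j, christoffel a x k i j • (EuclideanSpace.proj i : Euc n →L[ℝ] ℝ).smulRight
    ((EuclideanSpace.proj j : Euc n →L[ℝ] ℝ).smulRight (EuclideanSpace.single k (1 : ℝ)))

theorem christoffelForm_apply (v w : Euc n) (k : Fin n) :
    christoffelForm a x v w k = ∑ i, ∑ j, christoffel a x k i j * v i * w j := by
  simp only [christoffelForm, sum_apply, smul_apply, ContinuousLinearMap.smulRight_apply,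
    WithLp.ofLp_sum, WithLp.ofLp_smul, Finset.sum_apply, Pi.smul_apply, smul_eq_mul,
    PiLp.proj_apply, EuclideanSpace.single_apply]
  rw [Finset.sum_eq_single k]
  · simp [mul_assoc]
  · intro k' _ hk'
    simp [hk'.symm]
  · simp

/-- On the diagonal the first two of the three derivative terms in the lowered Christoffel symbol
coincide by symmetry of a_ij (`e1`, `e2`), so their halves add up to the first term on the right. -/
theorem matForm_christoffelForm (ha : ∀ i j, DifferentiableAt ℝ (fun x' => a x' i j) x)
    (hs : ∀ᶠ x' in 𝓝 x, (a x').IsSymm) (hdet : (a x).det ≠ 0) (y v : Euc n) :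
    matForm (a x) (christoffelForm a x y y) v
      = fderiv ℝ (fun x' => matForm (a x')) x y y v
        - 1 / 2 * fderiv ℝ (fun x' => matForm (a x')) x v y y := by
  set T : Fin n → ℝ := fun l => ∑ i, ∑ j,
    (pd i (fun x' => a x' l j) x + pd j (fun x' => a x' l i) x - pd l (fun x' => a x' i j) x)
      * y i * y j with hT
  have h1 : christoffelForm a x y y = raise (a x) ((1 / 2 : ℝ) • T) := by
    ext k
    rw [christoffelForm_apply, raise, Matrix.mulVec_smul]
    simp only [Pi.smul_apply, Matrix.mulVec, dotProduct, hT, smul_eq_mul, christoffel,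
      Finset.mul_sum, Finset.sum_mul]
    rw [Finset.sum_comm_cycle]
    refine Finset.sum_congr rfl fun l _ => ?_
    refine Finset.sum_congr rfl fun i _ => Finset.sum_congr rfl fun j _ => by ring
  rw [h1, matForm_raise hs.self_of_nhds hdet, covForm_apply, fderiv_matForm ha, fderiv_matForm ha]
  simp only [fderiv_apply_eq_sum_pd, hT, Pi.smul_apply, smul_eq_mul]
  have e1 : ∑ l, (∑ i, ∑ j, pd i (fun x' => a x' l j) x * y i * y j) * v l
      = ∑ i, ∑ j, (∑ k, pd k (fun x' => a x' i j) x * y k) * y i * v j := by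
    rw [Finset.sum_comm]
    refine Finset.sum_congr rfl fun l _ => ?_
    rw [Finset.sum_comm, Finset.sum_mul]
    refine Finset.sum_congr rfl fun j _ => ?_
    have : (fun x' => a x' j l) =ᶠ[𝓝 x] fun x' => a x' l j := by
      filter_upwards [hs] with x' hx'
      exact hx'.apply _ _
    simp only [pd, this.fderiv_eq, Finset.sum_mul]
  have e2 : ∑ l, (∑ i, ∑ j, pd j (fun x' => a x' l i) x * y i * y j) * v l
      = ∑ i, ∑ j, (∑ k, pd k (fun x' => a x' i j) x * y k) * y i * v j := by
    rw [← e1]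
    refine Finset.sum_congr rfl fun l _ => ?_
    congr 1
    rw [Finset.sum_comm]
    exact Finset.sum_congr rfl fun i _ => Finset.sum_congr rfl fun j _ => by ring
  have e3 : ∑ l, (∑ i, ∑ j, pd l (fun x' => a x' i j) x * y i * y j) * v l
      = ∑ i, ∑ j, (∑ k, pd k (fun x' => a x' i j) x * v k) * y i * y j := by
    simp only [Finset.sum_mul]
    symm
    rw [Finset.sum_comm_cycle]
    refine Finset.sum_congr rfl fun i _ => Finset.sum_congr rfl fun j _ =>
      Finset.sum_congr rfl fun k _ => by ring
  rw [← e3]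
  nth_rw 1 [← e1]
  have e4 := e1.trans e2.symm
  simp only [sub_mul, add_mul, Finset.sum_sub_distrib, Finset.sum_add_distrib, mul_assoc, mul_sub,
    mul_add, ← Finset.mul_sum] at e4 ⊢
  linarith

theorem christoffel_comm (hs : ∀ᶠ x' in 𝓝 x, (a x').IsSymm) (k i j : Fin n) :
    christoffel a x k i j = christoffel a x k j i := by
  unfold christoffel
  congr 1
  refine Finset.sum_congr rfl fun l _ => ?_
  have : (fun x' => a x' i j) =ᶠ[𝓝 x] fun x' => a x' j i := by
    filter_upwards [hs] with x' hx'
    exact hx'.apply _ _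
  simp only [pd, this.fderiv_eq]
  ring

/-- The connection terms cancel because the Levi-Civita connection is torsion-free. -/
theorem sLow_eq (hs : ∀ᶠ x' in 𝓝 x, (a x').IsSymm) (i j : Fin n) :
    sLow a b x i j = 1 / 2 * (pd j (fun x' => b x' i) x - pd i (fun x' => b x' j) x) := by
  simp only [sLow, covDeriv]
  rw [Finset.sum_congr rfl fun k _ => by rw [christoffel_comm hs k i j]]
  ring

/-- `s_ij` is half of the exterior derivative. -/
theorem matForm_sLow (hs : ∀ᶠ x' in 𝓝 x, (a x').IsSymm)
    (hb : ∀ i, DifferentiableAt ℝ (fun x' => b x' i) x) (v w : Euc n) :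
    matForm (Matrix.of (sLow a b x)) v w = 1 / 2 * (fderiv ℝ (fun x' => covForm (b x')) x w v
      - fderiv ℝ (fun x' => covForm (b x')) x v w) := by
  rw [matForm_apply, fderiv_covForm hb, fderiv_covForm hb]
  simp only [Matrix.of_apply, sLow_eq hs, fderiv_apply_eq_sum_pd, Finset.sum_mul]
  rw [Finset.sum_comm (f := fun i j => pd j (fun x' => b x' i) x * v j * w i),
    ← Finset.sum_sub_distrib, Finset.mul_sum]
  refine Finset.sum_congr rfl fun i _ => ?_
  rw [← Finset.sum_sub_distrib, Finset.mul_sum]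
  exact Finset.sum_congr rfl fun j _ => by ring

theorem rZeroZero_eq (hb : ∀ i, DifferentiableAt ℝ (fun x' => b x' i) x) (y : Euc n) :
    rZeroZero a b x y = fderiv ℝ (fun x' => covForm (b x')) x y y
      - covForm (b x) (christoffelForm a x y y) := by
  have h1 : rZeroZero a b x y = ∑ i, ∑ j, covDeriv a b x i j * y i * y j := by
    simp only [rZeroZero, rLow]
    have : ∑ i, ∑ j, covDeriv a b x j i * y i * y j
        = ∑ i, ∑ j, covDeriv a b x i j * y i * y j := by
      rw [Finset.sum_comm]
      exact Finset.sum_congr rfl fun i _ => Finset.sum_congr rfl fun j _ => by ring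
    simp only [mul_add, add_mul, Finset.sum_add_distrib, mul_assoc, ← Finset.mul_sum] at this ⊢
    linarith
  rw [h1, fderiv_covForm hb, covForm_apply]
  simp only [fderiv_apply_eq_sum_pd, christoffelForm_apply, covDeriv, sub_mul,
    Finset.sum_sub_distrib, Finset.sum_mul, Finset.mul_sum]
  congr 1
  · exact Finset.sum_congr rfl fun i _ => Finset.sum_congr rfl fun j _ => by ring
  · rw [Finset.sum_comm_cycle]
    exact Finset.sum_congr rfl fun i _ => Finset.sum_congr rfl fun j _ =>
      Finset.sum_congr rfl fun j _ => by ring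

/-- `b^i` as a vector. -/
def bUpVec (a : Euc n → Matrix (Fin n) (Fin n) ℝ) (b : Euc n → Fin n → ℝ) (x : Euc n) : Euc n :=
  WithLp.toLp 2 (bUp a b x)

/-- `s^i` as a vector. -/
def sVecVec (a : Euc n → Matrix (Fin n) (Fin n) ℝ) (b : Euc n → Fin n → ℝ) (x : Euc n) : Euc n :=
  WithLp.toLp 2 (sVec a b x)

/-- The endomorphism `s^i_j`. -/
def sEndo (a : Euc n → Matrix (Fin n) (Fin n) ℝ) (b : Euc n → Fin n → ℝ) (x : Euc n) :
    Euc n →L[ℝ] Euc n :=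
  Matrix.toEuclideanCLM (𝕜 := ℝ) ((a x)⁻¹ * Matrix.of (Matrix.of (sLow a b x)))

theorem matForm_bUpVec (hs : (a x).IsSymm) (hdet : (a x).det ≠ 0) (v : Euc n) :
    matForm (a x) (bUpVec a b x) v = covForm (b x) v :=
  matForm_raise hs hdet (b x) v

theorem covForm_bUpVec : covForm (b x) (bUpVec a b x) = bSq a b x := by
  simp [covForm_apply, bSq, bUpVec, mul_comm]

theorem matForm_sLow_bUpVec (v : Euc n) :
    matForm (Matrix.of (sLow a b x)) (bUpVec a b x) v = covForm (sCovec a b x) v := by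
  simp only [matForm_apply, covForm_apply, sCovec, bUpVec, Finset.sum_mul, Matrix.of_apply]
  rw [Finset.sum_comm]
  exact Finset.sum_congr rfl fun i _ => Finset.sum_congr rfl fun j _ => by ring

theorem matForm_sVecVec (hs : (a x).IsSymm) (hdet : (a x).det ≠ 0) (v : Euc n) :
    matForm (a x) (sVecVec a b x) v = matForm (Matrix.of (sLow a b x)) (bUpVec a b x) v := by
  rw [matForm_sLow_bUpVec]
  exact matForm_raise hs hdet (sCovec a b x) v

theorem matForm_sEndo (hs : (a x).IsSymm) (hdet : (a x).det ≠ 0) (y v : Euc n) :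
    matForm (a x) (sEndo a b x y) v = matForm (Matrix.of (sLow a b x)) v y := by
  rw [matForm_eq_covForm (Matrix.of (sLow a b x)), ← matForm_raise hs hdet]
  congr 2
  ext i
  rw [sEndo, Matrix.ofLp_toEuclideanCLM, ← Matrix.mulVec_mulVec]
  rfl

theorem sLow_antisymm (v w : Euc n) :
    matForm (Matrix.of (sLow a b x)) v w = - matForm (Matrix.of (sLow a b x)) w v := by
  rw [matForm_apply, matForm_apply, Finset.sum_comm]
  simp only [← Finset.sum_neg_distrib]
  refine Finset.sum_congr rfl fun i _ => Finset.sum_congr rfl fun j _ => ?_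
  simp only [Matrix.of_apply, sLow]
  ring

/-- The spray of a Riemannian metric is given by the Christoffel symbols. -/
theorem sprayVec_riemannian {L : Euc n → Euc n → ℝ}
    (ha : ∀ i j, ContDiffAt ℝ 2 (fun x' => a x' i j) x)
    (hs : ∀ᶠ x' in 𝓝 x, (a x').IsSymm) (hpos : ∀ v : Euc n, v ≠ 0 → 0 < matForm (a x) v v)
    (hL : ∀ᶠ x' in 𝓝 x, ∀ y, L x' y ^ 2 = matForm (a x') y y) (y : Euc n) :
    sprayVec L x y = (1 / 2 : ℝ) • christoffelForm a x y y := by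
  have had : ∀ i j, DifferentiableAt ℝ (fun x' => a x' i j) x :=
    fun i j => (ha i j).differentiableAt (by norm_num)
  have hm : ContDiffAt ℝ 2 (fun x' => matForm (a x')) (x, y).1 := contDiffAt_matForm ha
  have hLA : (fun p : Euc n × Euc n => L p.1 p.2 ^ 2) =ᶠ[𝓝 (x, y)]
      metricEnergy fun x' => matForm (a x') := by
    filter_upwards [continuous_fst.continuousAt.eventually hL] with p hp
    exact hp p.2
  have h1 : ContDiffAt ℝ 2 (fun p : Euc n × Euc n => L p.1 p.2 ^ 2) (x, y) :=
    (contDiffAt_metricEnergy hm).congr_of_eventuallyEq hLA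
  have hsx := hs.self_of_nhds
  refine (eq_sprayVec h1 ?_ fun v => ?_).symm
  · rw [fundamentalTensor_det_ne_zero_iff h1]
    intro d hd
    by_contra hd0
    have h2 := hd d
    rw [hLA.fderiv.fderiv_eq, fderiv_fderiv_metricEnergy hm] at h2
    have h3 := hpos d hd0
    simp at h2
    linarith
  · rw [hLA.eulerLagrange_eq, eulerLagrange_metricEnergy hm]
    have h2 := matForm_christoffelForm had hs (det_ne_zero_of_matForm_pos hpos) y v
    have h3 : fderiv ℝ (fun x' => matForm (a x')) x y v y
        = fderiv ℝ (fun x' => matForm (a x')) x y y v := by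
      rw [fderiv_matForm had, fderiv_matForm had, Finset.sum_comm]
      refine Finset.sum_congr rfl fun i _ => Finset.sum_congr rfl fun j _ => ?_
      have : (fun x' => a x' j i) =ᶠ[𝓝 x] fun x' => a x' i j := by
        filter_upwards [hs] with x' hx'
        exact hx'.apply _ _
      rw [this.fderiv_eq]
      ring
    rw [matForm_comm hsx v]
    simp only [map_smul, smul_apply, smul_eq_mul, h2, h3]
    ring

end IndexNotation

/-! ### The Euler-Lagrange covectors of the Kropina metric and of the metric F. -/

section AlphaBeta

variable {E : Type*} [NormedAddCommGroup E] [NormedSpace ℝ E]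

/-- The first-order data of the square norm `A = α²` and the `1`-form `B = β` at `p = (x, y)` in the
direction of the acceleration `z`: here `m` is the metric at `x`, `b` the `1`-form, `S v = s(v, y)`,
`r = r(y, y)` and `w = z + Γ(y, y)`. -/
structure AlphaBetaJet (A B : E × E → ℝ) (p : E × E) (z : E) (m : E →L[ℝ] E →L[ℝ] ℝ)
    (b S : E →L[ℝ] ℝ) (r : ℝ) (w : E) : Prop where
  contDiffAt_A : ContDiffAt ℝ 2 A p
  contDiffAt_B : ContDiffAt ℝ 2 B p
  symm : ∀ v v', m v v' = m v' v
  A_eq : A p = m p.2 p.2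
  B_eq : B p = b p.2
  eulerLagrange_A : ∀ v, eulerLagrange A p z v = 2 * m w v
  fderiv_A : fderiv ℝ A p (p.2, z) = 2 * m p.2 w
  fderiv_A_vertical : ∀ v, fderiv ℝ A p (0, v) = 2 * m p.2 v
  eulerLagrange_B : ∀ v, eulerLagrange B p z v = 2 * S v
  fderiv_B : fderiv ℝ B p (p.2, z) = r + b w
  fderiv_B_vertical : ∀ v, fderiv ℝ B p (0, v) = b v

variable (m : E →L[ℝ] E →L[ℝ] ℝ) (b S : E →L[ℝ] ℝ) (r : ℝ) (y w v : E)

/-- `α² w_l - (w·y) y_l`. -/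
def angularForm : ℝ := m y y * m w v - m y w * m y v

/-- `α² b_l - β y_l`. -/
def angularCovector : ℝ := m y y * b v - b y * m y v

/-- The Euler-Lagrange covector of the Kropina metric, up to a factor. -/
def kropinaForm : ℝ :=
  b y ^ 2 * angularForm m y w v - b y * m y y ^ 2 * S v
    + (m y y * (r + b w) - b y * m y w) * angularCovector m b y v

/-- The Euler-Lagrange covector of `β^q / (β - α)^(q - 1)`, up to a factor. -/
def qForm (q : ℝ) : ℝ :=
  (q - 1) * b y ^ 2 * (b y - √(m y y)) * angularForm m y w v
    + 2 * √(m y y) ^ 3 * b y * (b y - √(m y y)) * (b y - q * √(m y y)) * S v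
    + q * (q - 1) * √(m y y) * (m y y * (r + b w) - b y * m y w) * angularCovector m b y v

variable {m b S r w} {A B : E × E → ℝ} {p : E × E} {z : E}

/-- Chain rule for A/B. The factor α²β³ clears denominators and is chosen so that the result splits
into the angular form of w, the term in s and a multiple of `angularCovector`. -/
theorem AlphaBetaJet.eulerLagrange_kropina (h : AlphaBetaJet A B p z m b S r w)
    (hB : b p.2 ≠ 0) (v : E) :
    eulerLagrange (fun p' => A p' / B p') p z v * (m p.2 p.2 * b p.2 ^ 3)
      = 2 * kropinaForm m b S r p.2 w v := by
  have hB0 : B p ≠ 0 := by rwa [h.B_eq]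
  have dA := (h.contDiffAt_A.differentiableAt (by norm_num)).hasFDerivAt
  have dB := (h.contDiffAt_B.differentiableAt (by norm_num)).hasFDerivAt
  have hBn : ∀ᶠ p' in 𝓝 p, B p' ≠ 0 := h.contDiffAt_B.continuousAt.eventually_ne hB0
  have hF : fderiv ℝ (fun p' => A p' / B p') =ᶠ[𝓝 p]
      fun p' => (B p')⁻¹ • fderiv ℝ A p' + (-(A p' * ((B p')⁻¹ * (B p')⁻¹))) • fderiv ℝ B p' := by
    filter_upwards [hBn, h.contDiffAt_A.eventually_differentiableAt,
      h.contDiffAt_B.eventually_differentiableAt] with p' h1 h2 h3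
    have h4 := h2.hasFDerivAt.mul ((hasDerivAt_inv h1).comp_hasFDerivAt p' h3.hasFDerivAt)
    simp only [div_eq_mul_inv]
    refine h4.fderiv.trans ?_
    refine ContinuousLinearMap.ext fun u => ?_
    simp
    field_simp
    ring
  have dP : HasFDerivAt (fun p' => (B p')⁻¹) (-((B p) ^ 2)⁻¹ • fderiv ℝ B p) p :=
    (hasDerivAt_inv hB0).comp_hasFDerivAt p dB
  have dQ := (dA.mul (dP.mul dP)).neg
  rw [eulerLagrange_comp hF dP dQ h.contDiffAt_A.differentiableAt_fderiv
    h.contDiffAt_B.differentiableAt_fderiv]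
  simp only [h.eulerLagrange_A, h.eulerLagrange_B, neg_smul, neg_apply, smul_apply, add_apply,
    Pi.mul_apply, h.fderiv_A, h.fderiv_B, h.fderiv_A_vertical, h.fderiv_B_vertical,
    smul_eq_mul, h.A_eq, h.B_eq, kropinaForm, angularForm, angularCovector]
  rw [h.symm w v, h.symm p.2 v, h.symm p.2 w]
  field_simp
  ring

/-- Logarithmic differentiation: the coefficients of dA and dB are F times rational functions of α
and β, so no real power other than F itself survives. The hypothesis `hq` is needed because a real
power of a negative base can vanish, its convention containing a cosine factor. -/
theorem AlphaBetaJet.eulerLagrange_q (h : AlphaBetaJet A B p z m b S r w) (q : ℝ)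
    (hA : 0 < m p.2 p.2) (hB : b p.2 ≠ 0) (hBA : b p.2 - √(m p.2 p.2) ≠ 0)
    (hq : ∀ᶠ p' in 𝓝 p, (B p' - √(A p')) ^ (q - 1) ≠ 0) (v : E) :
    eulerLagrange (fun p' => B p' ^ q / (B p' - √(A p')) ^ (q - 1)) p z v
        * (√(m p.2 p.2) ^ 3 * b p.2 ^ 2 * (b p.2 - √(m p.2 p.2)) ^ 2)
      = b p.2 ^ q / (b p.2 - √(m p.2 p.2)) ^ (q - 1) * qForm m b S r p.2 w v q := by
  have hA0 : 0 < A p := by rwa [h.A_eq]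
  have hB0 : B p ≠ 0 := by rwa [h.B_eq]
  have hBA0 : B p - √(A p) ≠ 0 := by rwa [h.B_eq, h.A_eq]
  have hcA := h.contDiffAt_A.continuousAt
  have hcB := h.contDiffAt_B.continuousAt
  have hAn : ∀ᶠ p' in 𝓝 p, 0 < A p' := hcA.eventually (lt_mem_nhds hA0)
  have hBn : ∀ᶠ p' in 𝓝 p, B p' ≠ 0 := hcB.eventually_ne hB0
  have hBAn : ∀ᶠ p' in 𝓝 p, B p' - √(A p') ≠ 0 := (hcB.sub hcA.sqrt).eventually_ne hBA0
  set F : E × E → ℝ := fun p' => B p' ^ q / (B p' - √(A p')) ^ (q - 1) with hFdef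
  have hdF : ∀ᶠ p' in 𝓝 p, HasFDerivAt F
      ((F p' * (q - 1) * (2 * √(A p') * (B p' - √(A p')))⁻¹) • fderiv ℝ A p'
        + (F p' * (q * (B p')⁻¹ - (q - 1) * (B p' - √(A p'))⁻¹)) • fderiv ℝ B p') p' := by
    filter_upwards [hAn, hBn, hBAn, hq, h.contDiffAt_A.eventually_differentiableAt,
      h.contDiffAt_B.eventually_differentiableAt] with p' h1 h2 h3 h4 h5 h6
    have e1 : HasFDerivAt (fun p' => B p' ^ q) _ p' := h6.hasFDerivAt.rpow_const (Or.inl h2)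
    have e2 := h6.hasFDerivAt.sub (h5.hasFDerivAt.sqrt h1.ne')
    have e3 : HasFDerivAt (fun p' => (B p' - √(A p')) ^ (q - 1)) _ p' :=
      e2.rpow_const (p := q - 1) (Or.inl h3)
    have e4 := e1.mul ((hasDerivAt_inv h4).comp_hasFDerivAt p' e3)
    refine (e4.congr_fderiv ?_).congr_of_eventuallyEq (Eventually.of_forall fun _ => rfl)
    refine ContinuousLinearMap.ext fun u => ?_
    have h7 : √(A p') ≠ 0 := (Real.sqrt_pos.2 h1).ne'
    simp only [Pi.sub_apply, Real.rpow_sub_one h2, Real.rpow_sub_one h3, add_apply, sub_apply,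
      smul_apply, smul_eq_mul, hFdef] at h4 ⊢
    have h8 : (B p' - √(A p')) ^ q ≠ 0 := fun h0 => h4 (by simp [h0])
    simp only [Function.comp_apply, Pi.sub_apply, Real.rpow_sub_one h3]
    field_simp
    ring
  have hF := hdF.mono fun p' hp' => hp'.fderiv
  have dF := hdF.self_of_nhds
  have dA := (h.contDiffAt_A.differentiableAt (by norm_num)).hasFDerivAt
  have dB := (h.contDiffAt_B.differentiableAt (by norm_num)).hasFDerivAt
  have dα := dA.sqrt hA0.ne'
  have hα0 : √(A p) ≠ 0 := (Real.sqrt_pos.2 hA0).ne'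
  have dBα := dB.sub dα
  have dden := (dα.const_mul 2).mul dBα
  have dP := (dF.mul_const (q - 1)).mul
    ((hasDerivAt_inv (mul_ne_zero (mul_ne_zero two_ne_zero hα0) hBA0)).comp_hasFDerivAt p dden)
  have dQ := dF.mul ((((hasDerivAt_inv hB0).comp_hasFDerivAt p dB).const_mul q).sub
    (((hasDerivAt_inv hBA0).comp_hasFDerivAt p dBα).const_mul (q - 1)))
  rw [eulerLagrange_comp hF dP dQ h.contDiffAt_A.differentiableAt_fderiv
    h.contDiffAt_B.differentiableAt_fderiv]
  have hFp : F p = b p.2 ^ q / (b p.2 - √(m p.2 p.2)) ^ (q - 1) := by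
    rw [hFdef, h.A_eq.symm, h.B_eq.symm]
  rw [← hFp]
  simp only [Function.comp_apply, Pi.sub_apply, h.eulerLagrange_A, h.eulerLagrange_B, neg_smul,
    neg_apply, smul_apply, add_apply, sub_apply,
    Pi.mul_apply, h.fderiv_A, h.fderiv_B, h.fderiv_A_vertical, h.fderiv_B_vertical,
    smul_eq_mul, qForm, angularForm, angularCovector]
  rw [h.symm w v, h.symm p.2 v, h.symm p.2 w]
  rw [h.A_eq] at hα0
  rw [h.A_eq, h.B_eq]
  have hsq : m p.2 p.2 = √(m p.2 p.2) ^ 2 := (Real.sq_sqrt hA.le).symm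
  set α := √(m p.2 p.2)
  rw [hsq]
  field_simp
  ring

end AlphaBeta

/-! ### Linear algebra on one tangent space: solving both equations for the acceleration. -/

section PointwiseAlgebra

variable {E : Type*} [NormedAddCommGroup E] [NormedSpace ℝ E]

/-- The values at a point of a metric `m`, a nonzero `1`-form `b`, its dual vector `bv`, a two-form
`s`, the endomorphism `S` dual to `s`, and the vector `sv` dual to `s(bv, ·)`. -/
structure MetricFormData (m : E →L[ℝ] E →L[ℝ] ℝ) (b : E →L[ℝ] ℝ) (s : E →L[ℝ] E →L[ℝ] ℝ)
    (bv : E) (S : E →L[ℝ] E) (sv : E) : Prop where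
  symm : ∀ v w, m v w = m w v
  pos : ∀ v, v ≠ 0 → 0 < m v v
  bv_eq : ∀ v, m bv v = b v
  antisymm : ∀ v w, s v w = -s w v
  S_eq : ∀ y v, m (S y) v = s v y
  sv_eq : ∀ v, m sv v = s bv v
  ne_zero : b ≠ 0

variable {m : E →L[ℝ] E →L[ℝ] ℝ} {b : E →L[ℝ] ℝ} {s : E →L[ℝ] E →L[ℝ] ℝ} {bv : E} {S : E →L[ℝ] E}
  {sv : E}

namespace MetricFormData

variable (d : MetricFormData m b s bv S sv)
include d

theorem eq_zero {v : E} (h : ∀ w, m v w = 0) : v = 0 := by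
  by_contra hv
  exact (d.pos v hv).ne' (h v)

theorem bSq_pos : 0 < b bv := by
  rw [← d.bv_eq]
  refine d.pos bv fun h => d.ne_zero ?_
  ext v
  rw [← d.bv_eq, h]
  simp

/-- The angular form of w is the pairing of α²w - (w·y)y with v, so its vanishing means that w is
tangent to the ray through y. -/
theorem exists_smul_of_angularForm {y w : E} (hy : y ≠ 0) (h : ∀ v, angularForm m y w v = 0) :
    w = (m y w / m y y) • y := by
  have h1 : m y y • w - m y w • y = 0 := d.eq_zero fun v => by simpa [angularForm] using h v
  have h2 := (d.pos y hy).ne'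
  rw [sub_eq_zero] at h1
  rw [div_eq_inv_mul, mul_smul, ← h1, smul_smul, inv_mul_cancel₀ h2, one_smul]

theorem angularForm_bv (y v : E) : angularForm m y bv v = angularCovector m b y v := by
  rw [angularForm, angularCovector, d.bv_eq, d.symm y bv, d.bv_eq]

theorem angularForm_apply_bv (y w : E) :
    angularForm m y w bv = m y y * b w - b y * m y w := by
  rw [angularForm, d.symm w, d.bv_eq, d.symm y bv, d.bv_eq]
  ring

theorem angularCovector_bv (y : E) :
    angularCovector m b y bv = m y y * b bv - b y ^ 2 := by
  rw [angularCovector, d.symm y bv, d.bv_eq]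
  ring

end MetricFormData

theorem angularForm_add (y w w' v : E) :
    angularForm m y (w + w') v = angularForm m y w v + angularForm m y w' v := by
  simp only [angularForm, map_add, add_apply]
  ring

theorem angularForm_smul (y w v : E) (c : ℝ) :
    angularForm m y (c • w) v = c * angularForm m y w v := by
  simp only [angularForm, map_smul, smul_apply, smul_eq_mul]
  ring

theorem angularForm_self (y v : E) (c : ℝ) : angularForm m y (c • y) v = 0 := by
  simp only [angularForm, map_smul, smul_apply, smul_eq_mul]
  ring

/-- The direction `2(G_α - G)` of the Kropina spray `G`, up to a multiple of `y`. -/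
def kropinaField (m : E →L[ℝ] E →L[ℝ] ℝ) (b : E →L[ℝ] ℝ) (s : E →L[ℝ] E →L[ℝ] ℝ) (bv : E)
    (S : E →L[ℝ] E) (r : E →L[ℝ] E →L[ℝ] ℝ) (y : E) : E :=
  (m y y / b y) • S y - ((b bv)⁻¹ * (m y y * s bv y / b y + r y y)) • bv

/-- `β²(β - α) + q (b²α² - β²) α`. -/
def qDenominator (m : E →L[ℝ] E →L[ℝ] ℝ) (b : E →L[ℝ] ℝ) (bv : E) (q : ℝ) (y : E) : ℝ :=
  b y ^ 2 * (b y - √(m y y)) + q * (b bv * √(m y y) ^ 2 - b y ^ 2) * √(m y y)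

namespace MetricFormData

variable (d : MetricFormData m b s bv S sv)
include d

/-- Testing with v = b^i, the two terms add up to α²b²(α²b(w) - β(w·y)). Hence the last factor
vanishes and only the angular form of w remains. This gives both uniqueness of the Kropina field
modulo y and nondegeneracy of the Kropina metric. -/
theorem kropinaForm_kernel {y w : E} (hb : b y ≠ 0)
    (h : ∀ v, b y ^ 2 * angularForm m y w v + (m y y * b w - b y * m y w) * angularCovector m b y v
      = 0) : ∃ c : ℝ, w = c • y := by
  have hy : y ≠ 0 := fun h0 => hb (by simp [h0])
  have h1 := h bv
  rw [d.angularForm_apply_bv, d.angularCovector_bv] at h1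
  have h2 : (m y y * b w - b y * m y w) * (m y y * b bv) = 0 := by linear_combination h1
  have h3 : m y y * b w - b y * m y w = 0 :=
    (mul_eq_zero.1 h2).resolve_right (mul_ne_zero (d.pos y hy).ne' d.bSq_pos.ne')
  refine ⟨_, d.exists_smul_of_angularForm hy fun v => ?_⟩
  have h4 := h v
  rw [h3, zero_mul, add_zero] at h4
  exact (mul_eq_zero.1 h4).resolve_left (pow_ne_zero 2 hb)

theorem kropinaForm_kropinaField (r : E →L[ℝ] E →L[ℝ] ℝ) {y : E} (hb : b y ≠ 0) (v : E) :
    kropinaForm m b (s.flip y) (r y y) y (kropinaField m b s bv S r y) v = 0 := by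
  have hB := d.bSq_pos.ne'
  have e1 : m y (S y) = 0 := by
    rw [d.symm, d.S_eq]
    linarith [d.antisymm y y]
  have e2 : b (S y) = s bv y := by rw [← d.bv_eq, d.symm, d.S_eq]
  have e3 : m y bv = b y := by rw [d.symm, d.bv_eq]
  simp only [kropinaForm, angularForm, angularCovector, kropinaField, map_sub, map_smul, sub_apply,
    smul_apply, smul_eq_mul, ContinuousLinearMap.flip_apply, d.S_eq, d.bv_eq, e1, e2, e3]
  field_simp
  ring

/-- The equation is affine in w; `kropinaField` is a particular solution and the kernel of the
linear part is the line through y. -/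
theorem kropinaForm_eq_zero_iff (r : E →L[ℝ] E →L[ℝ] ℝ) {y : E} (hb : b y ≠ 0) (w : E) :
    (∀ v, kropinaForm m b (s.flip y) (r y y) y w v = 0) ↔
      ∃ c : ℝ, w = kropinaField m b s bv S r y + c • y := by
  constructor
  · intro h
    obtain ⟨c, hc⟩ := d.kropinaForm_kernel (w := w - kropinaField m b s bv S r y) hb fun v => by
      have h1 := h v
      have h2 := d.kropinaForm_kropinaField r hb v
      simp only [kropinaForm, angularForm, map_sub, sub_apply] at h1 h2 ⊢
      linear_combination h1 - h2
    exact ⟨c, by rw [← hc]; abel⟩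
  · rintro ⟨c, rfl⟩ v
    have h2 := d.kropinaForm_kropinaField r hb v
    simp only [kropinaForm, angularForm, map_add, add_apply, map_smul, smul_apply,
      smul_eq_mul] at h2 ⊢
    linear_combination h2

/-- The angular form of b^i is `angularCovector` itself, so both w-dependent terms contribute
multiples of the same covector. Their sum is the origin of the denominator in condition 1. -/
theorem qForm_add_bv (y w v : E) (q ρ : ℝ) (σ : E →L[ℝ] ℝ) (hy : y ≠ 0) :
    qForm m b σ ρ y (w + bv) v q
      = qForm m b σ ρ y w v q + (q - 1) * qDenominator m b bv q y * angularCovector m b y v := by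
  have hsq : √(m y y) ^ 2 = m y y := Real.sq_sqrt (d.pos y hy).le
  rw [qForm, angularForm_add, d.angularForm_bv, qForm, qDenominator, map_add, map_add,
    d.symm y bv, d.bv_eq, hsq]
  ring

theorem qForm_eq_zero (hs : s = 0) {y : E} (hy : y ≠ 0) (q ρ c : ℝ)
    (hN : qDenominator m b bv q y = 0 → ∃ c : ℝ, bv = c • y) (v : E) :
    qForm m b (s.flip y) ρ y (c • y - (q * √(m y y) ^ 3 * ρ / qDenominator m b bv q y) • bv) v q
      = 0 := by
  have hsq : √(m y y) ^ 2 = m y y := Real.sq_sqrt (d.pos y hy).le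
  have e3 : m y bv = b y := by rw [d.symm, d.bv_eq]
  subst hs
  -- Where the denominator vanishes, the quotient is zero by convention and b^i is parallel to y;
  -- then `angularCovector` is zero and every term of the form vanishes.
  by_cases h0 : qDenominator m b bv q y = 0
  · obtain ⟨k, hk⟩ := hN h0
    have h1 : angularCovector m b y v = 0 := by
      rw [← d.angularForm_bv, hk, angularForm_self]
    rw [h0, div_zero, zero_smul, sub_zero, qForm, h1, angularForm_self]
    simp
  · have e4 : m y y * b bv - b y ^ 2 = √(m y y) ^ 2 * b bv - b y ^ 2 := by rw [hsq]
    rw [sub_eq_add_neg, ← neg_smul, qForm, angularForm_add, angularForm_self, angularForm_smul,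
      d.angularForm_bv]
    simp only [map_add, map_smul, smul_eq_mul, e3, ContinuousLinearMap.flip_apply, zero_apply]
    generalize hV : angularCovector m b y v = V
    rw [neg_mul, ← sub_eq_zero]
    field_simp
    rw [qDenominator]
    generalize √(m y y) = α at hsq
    rw [← hsq]
    ring

end MetricFormData

/-- A vector-valued quadratic form all of whose values are multiples of the argument is a multiple
of the identity by a linear form. -/
theorem exists_linear_of_forall_smul (z : E →L[ℝ] E →L[ℝ] E) (h : ∀ y, ∃ c : ℝ, z y y = c • y) :
    ∃ θ : E →ₗ[ℝ] ℝ, ∀ y, z y y = θ y • y := by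
  classical
  choose c' hc' using h
  -- At y = 0 the factor is arbitrary; linearity requires the value zero.
  set c : E → ℝ := fun y => if y = 0 then 0 else c' y with hcdef
  have hc : ∀ y, z y y = c y • y := by
    intro y
    by_cases hy : y = 0
    · simp [hy]
    · simp only [hcdef, hy, if_false]
      exact hc' y
  have c0 : c 0 = 0 := by simp [hcdef]
  have uniq : ∀ (y : E) (k l : ℝ), y ≠ 0 → k • y = l • y → k = l := by
    intro y k l hy hkl
    exact smul_left_injective ℝ hy hkl
  have hsmul : ∀ (t : ℝ) (y : E), c (t • y) = t * c y := by
    intro t y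
    by_cases hty : t • y = 0
    · rcases smul_eq_zero.1 hty with rfl | rfl
      · simp [c0]
      · simp [c0]
    · refine uniq (t • y) _ _ hty ?_
      rw [← hc]
      simp only [map_smul, smul_apply, hc y]
      module
  have hadd : ∀ u v : E, c (u + v) = c u + c v := by
    intro u v
    by_cases huv : ∃ t : ℝ, v = t • u
    · obtain ⟨t, rfl⟩ := huv
      rw [show u + t • u = (1 + t) • u by module, hsmul, hsmul]
      ring
    by_cases hu : u = 0
    · simp [hu, c0]
    -- The parallelogram law for the quadratic map. For independent u and v both coefficients
    -- vanish, and their sum is additivity of c.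
    have h1 : (c (u + v) + c (u - v) - 2 * c u) • u + (c (u + v) - c (u - v) - 2 * c v) • v = 0 := by
      have e1 := hc (u + v)
      have e2 := hc (u - v)
      simp only [map_add, map_sub, add_apply, sub_apply] at e1 e2
      have e3 : z u u + z u u + (z v v + z v v) = c (u + v) • (u + v) + c (u - v) • (u - v) := by
        rw [← e1, ← e2]
        abel
      rw [hc u, hc v] at e3
      rw [← neg_eq_zero.2 (sub_eq_zero.2 e3)]
      module
    have h2 : c (u + v) - c (u - v) - 2 * c v = 0 := by
      by_contra h0
      refine huv ⟨-(c (u + v) - c (u - v) - 2 * c v)⁻¹ * (c (u + v) + c (u - v) - 2 * c u), ?_⟩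
      have h3 := congrArg (fun x => (c (u + v) - c (u - v) - 2 * c v)⁻¹ • x) h1
      simp only [smul_add, smul_smul, inv_mul_cancel₀ h0, one_smul, smul_zero] at h3
      rw [neg_mul, neg_smul]
      exact (neg_eq_of_add_eq_zero_right h3).symm
    have h3 : c (u + v) + c (u - v) - 2 * c u = 0 := by
      rw [h2, zero_smul, add_zero] at h1
      exact (smul_eq_zero.1 h1).resolve_right hu
    linarith
  exact ⟨{ toFun := c, map_add' := hadd, map_smul' := fun t y => by simp [hsmul] }, hc⟩

end PointwiseAlgebra

/-! ### Necessity on one tangent space. -/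

section Necessity

variable {E : Type*} [NormedAddCommGroup E] [NormedSpace ℝ E]
  {m : E →L[ℝ] E →L[ℝ] ℝ} {b : E →L[ℝ] ℝ} {s : E →L[ℝ] E →L[ℝ] ℝ} {bv : E} {S : E →L[ℝ] E}
  {sv : E} {m' : E →L[ℝ] E →L[ℝ] ℝ} {b' : E →L[ℝ] ℝ} {s' : E →L[ℝ] E →L[ℝ] ℝ} {bv' : E}
  {S' : E →L[ℝ] E} {sv' : E}

/-- `β` times the direction `2 H + 2(G_α - G)`, for a quadratic form `H` and the Kropina spray
`G`. -/
def clearedField (m : E →L[ℝ] E →L[ℝ] ℝ) (b : E →L[ℝ] ℝ) (s : E →L[ℝ] E →L[ℝ] ℝ) (bv : E)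
    (S : E →L[ℝ] E) (r : E →L[ℝ] E →L[ℝ] ℝ) (h : E →L[ℝ] E →L[ℝ] E) (y : E) : E :=
  (2 * b y) • h y y + m y y • S y - ((b bv)⁻¹ * (m y y * s bv y + b y * r y y)) • bv

theorem clearedField_eq (r : E →L[ℝ] E →L[ℝ] ℝ) (h : E →L[ℝ] E →L[ℝ] E) {y : E} (hb : b y ≠ 0) :
    clearedField m b s bv S r h y
      = b y • ((2 : ℝ) • h y y + kropinaField m b s bv S r y) := by
  have e1 : b y * (m y y / b y) = m y y := by field_simp
  have e2 : b y * ((b bv)⁻¹ * (m y y * s bv y / b y + r y y))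
      = (b bv)⁻¹ * (m y y * s bv y + b y * r y y) := by field_simp
  rw [clearedField, kropinaField, smul_add, smul_sub, smul_smul, smul_smul, smul_smul, e1, e2,
    mul_comm]
  abel

theorem clearedField_neg (r : E →L[ℝ] E →L[ℝ] ℝ) (h : E →L[ℝ] E →L[ℝ] E) (y : E) :
    clearedField m b s bv S r h (-y) = -clearedField m b s bv S r h y := by
  simp only [clearedField, map_neg, neg_apply, neg_neg]
  module

theorem contDiff_clearedField (r : E →L[ℝ] E →L[ℝ] ℝ) (h : E →L[ℝ] E →L[ℝ] E)
    (k : WithTop ℕ∞) : ContDiff ℝ k (clearedField m b s bv S r h) := by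
  unfold clearedField
  fun_prop

/-- The part of the cleared Euler-Lagrange covector which is even in `α`. -/
def evenPart (m : E →L[ℝ] E →L[ℝ] ℝ) (b : E →L[ℝ] ℝ) (s : E →L[ℝ] E →L[ℝ] ℝ) (b' : E →L[ℝ] ℝ)
    (q : ℝ) (y u v : E) : ℝ :=
  (q - 1) * b y ^ 3 * angularForm m y u v - 2 * (1 + q) * m y y ^ 2 * b y ^ 2 * b' y * s v y

/-- The part of the cleared Euler-Lagrange covector which is odd in `α`, divided by `α`. -/
def oddPart (m : E →L[ℝ] E →L[ℝ] ℝ) (b : E →L[ℝ] ℝ) (s r : E →L[ℝ] E →L[ℝ] ℝ) (b' : E →L[ℝ] ℝ)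
    (q : ℝ) (y u v : E) : ℝ :=
  -(q - 1) * b y ^ 2 * angularForm m y u v
    + 2 * m y y * b y * (b y ^ 2 + q * m y y) * b' y * s v y
    + q * (q - 1) * (m y y * (b' y * r y y + b u) - b y * m y u) * angularCovector m b y v

/-- Multiplication by β̄ removes the only denominator depending on y; sorting by parity in α = √(m y
y) and using α² = m y y makes both parts polynomial in y. -/
theorem mul_qForm_eq (r : E →L[ℝ] E →L[ℝ] ℝ) {y : E} (hy : 0 ≤ m y y) (w v : E) (q : ℝ) :
    b' y * qForm m b (s.flip y) (r y y) y w v q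
      = evenPart m b s b' q y (b' y • w) v + √(m y y) * oddPart m b s r b' q y (b' y • w) v := by
  have hsq : √(m y y) ^ 2 = m y y := Real.sq_sqrt hy
  simp only [qForm, evenPart, oddPart, angularForm_smul, map_smul, smul_eq_mul,
    ContinuousLinearMap.flip_apply]
  generalize angularForm m y w v = X
  generalize angularCovector m b y v = V
  generalize √(m y y) = α at hsq
  rw [← hsq]
  ring

theorem eq_zero_of_eventually_affine {c₀ c₁ : ℝ} (h : ∀ᶠ t in 𝓝[≠] (0 : ℝ), c₀ + t * c₁ = 0) :
    c₀ = 0 ∧ c₁ = 0 := by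
  have h1 : Tendsto (fun t : ℝ => c₀ + t * c₁) (𝓝[≠] 0) (𝓝 c₀) := by
    have : Continuous fun t : ℝ => c₀ + t * c₁ := by fun_prop
    have h2 := this.tendsto 0
    simp only [zero_mul, add_zero] at h2
    exact h2.mono_left nhdsWithin_le_nhds
  have h2 : c₀ = 0 := tendsto_nhds_unique (h1.congr' h) tendsto_const_nhds
  refine ⟨h2, ?_⟩
  obtain ⟨t, ht, ht0⟩ := (h.and self_mem_nhdsWithin).exists
  rw [h2, zero_add] at ht
  exact (mul_eq_zero.1 ht).resolve_left ht0

/-- Carries identities proved off the hyperplane of vanishing β across it, by continuity along a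
transversal line. -/
theorem eq_zero_of_eventually_line {f : E → ℝ} (hf : Continuous f) {y e : E}
    (h : ∀ᶠ t in 𝓝[≠] (0 : ℝ), f (y + t • e) = 0) : f y = 0 := by
  have h1 : Continuous fun t : ℝ => f (y + t • e) := by fun_prop
  have h2 := h1.tendsto 0
  simp only [zero_smul, add_zero] at h2
  exact tendsto_nhds_unique ((h2.mono_left nhdsWithin_le_nhds).congr' h) tendsto_const_nhds

namespace MetricFormData

/-- In the even part plus β times the odd part the angular forms cancel, and the terms in q
multiplying s(v, y) cancel as well, leaving 2α²β²β̄(β² - α²)s(v, y) plus a multiple of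
`angularCovector`. So s(·, y) is proportional to that covector; comparison with its value at b^i
eliminates the factor. -/
theorem mul_mul_eq_of_parts (d : MetricFormData m b s bv S sv) {r : E →L[ℝ] E →L[ℝ] ℝ} {q : ℝ}
    {y u : E} (hb : b y ≠ 0) (hb' : b' y ≠ 0) (hne : b y ^ 2 - m y y ≠ 0)
    (hev : ∀ v, evenPart m b s b' q y u v = 0)
    (hod : ∀ v, oddPart m b s r b' q y u v = 0) (v : E) :
    s v y * angularCovector m b y bv = s bv y * angularCovector m b y v := by
  have hy : y ≠ 0 := fun h0 => hb (by simp [h0])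
  have hm := (d.pos y hy).ne'
  set C := m y y * (b' y * r y y + b u) - b y * m y u with hC
  have key : ∀ v, 2 * m y y * b y ^ 2 * b' y * (b y ^ 2 - m y y) * s v y
      + q * (q - 1) * C * b y * angularCovector m b y v = 0 := by
    intro v
    have h1 := hev v
    have h2 := hod v
    rw [evenPart] at h1
    rw [oddPart, ← hC] at h2
    linear_combination h1 + b y * h2
  have hk : 2 * m y y * b y ^ 2 * b' y * (b y ^ 2 - m y y) ≠ 0 := by positivity
  refine mul_left_cancel₀ hk ?_
  linear_combination angularCovector m b y bv * key v - angularCovector m b y v * key bv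

/-- Put y = v₀ + t b^i with v₀ in the kernel of b. The relation becomes affine in t, so both
coefficients vanish. In dimension at least three v₀ ≠ 0 can also be taken in the kernel of s(b^i,
·); the linear coefficient then gives s(·, b^i) = 0, and the constant one gives s(·, w) = 0 for all
w in the kernel of b. -/
theorem s_eq_zero [FiniteDimensional ℝ E] (d : MetricFormData m b s bv S sv)
    (hdim : 3 ≤ Module.finrank ℝ E)
    (h : ∀ y, b y ≠ 0 → b y ^ 2 - m y y ≠ 0 →
      ∀ v, s v y * angularCovector m b y bv = s bv y * angularCovector m b y v) : s = 0 := by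
  have hB := d.bSq_pos
  have key : ∀ v₀, v₀ ≠ 0 → b v₀ = 0 → ∀ v,
      s v v₀ * b bv = b v * s bv v₀ ∧ m v₀ v₀ * s v bv = -(m v₀ v * s bv v₀) := by
    intro v₀ hv₀ hbv₀ v
    have hm := d.pos v₀ hv₀
    have h1 : ∀ᶠ t in 𝓝[≠] (0 : ℝ),
        m v₀ v₀ * (s v v₀ * b bv - b v * s bv v₀)
          + t * (b bv * (m v₀ v₀ * s v bv + m v₀ v * s bv v₀)) = 0 := by
      -- At t = 0 the quantity β² - α² is -m(v₀, v₀) ≠ 0, so it stays nonzero for small t, while t ≠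
      -- 0 ensures β ≠ 0.
      have h2 : ∀ᶠ t in 𝓝 (0 : ℝ), (t * b bv) ^ 2 - (m v₀ v₀ + t ^ 2 * b bv) ≠ 0 := by
        have hc : Continuous fun t : ℝ => (t * b bv) ^ 2 - (m v₀ v₀ + t ^ 2 * b bv) := by fun_prop
        refine hc.continuousAt.eventually_ne ?_
        simp [hm.ne']
      filter_upwards [h2.filter_mono nhdsWithin_le_nhds, self_mem_nhdsWithin] with t ht ht0
      have e1 : b (v₀ + t • bv) = t * b bv := by simp [hbv₀]
      have e2 : m (v₀ + t • bv) (v₀ + t • bv) = m v₀ v₀ + t ^ 2 * b bv := by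
        simp only [map_add, map_smul, add_apply, smul_apply, smul_eq_mul, d.bv_eq, d.symm v₀ bv,
          hbv₀]
        ring
      have e3 : m (v₀ + t • bv) v = m v₀ v + t * b v := by simp [d.bv_eq]
      have e4 : s bv bv = 0 := by linarith [d.antisymm bv bv]
      have h3 := h (v₀ + t • bv) (by rw [e1]; exact mul_ne_zero ht0 hB.ne')
        (by rw [e1, e2]; exact ht) v
      rw [d.angularCovector_bv, angularCovector, e1, e2, e3] at h3
      simp only [map_add, map_smul, smul_eq_mul, e4] at h3
      have h4 : (s v v₀ + t * s v bv) * (m v₀ v₀ * b bv)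
          = s bv v₀ * (m v₀ v₀ * b v - t * b bv * m v₀ v) := by linear_combination h3
      linear_combination h4
    obtain ⟨h5, h6⟩ := eq_zero_of_eventually_affine h1
    constructor
    · linarith [(mul_eq_zero.1 h5).resolve_left hm.ne']
    · linarith [(mul_eq_zero.1 h6).resolve_left hB.ne']
  have h1 : ∃ v₀, v₀ ≠ 0 ∧ b v₀ = 0 ∧ s bv v₀ = 0 := by
    let f : E →ₗ[ℝ] ℝ × ℝ := (b : E →ₗ[ℝ] ℝ).prod (s bv : E →ₗ[ℝ] ℝ)
    have hf : LinearMap.ker f ≠ ⊥ := by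
      refine LinearMap.ker_ne_bot_of_finrank_lt ?_
      simp only [Module.finrank_prod, Module.finrank_self]
      omega
    obtain ⟨v₀, hv₀, hne⟩ := (Submodule.ne_bot_iff _).1 hf
    have h2 : f v₀ = 0 := hv₀
    exact ⟨v₀, hne, congrArg Prod.fst h2, congrArg Prod.snd h2⟩
  obtain ⟨v₀, hv₀, hbv₀, hsv₀⟩ := h1
  have h2 : ∀ v, s v bv = 0 := by
    intro v
    have h3 := (key v₀ hv₀ hbv₀ v).2
    rw [hsv₀, mul_zero, neg_zero] at h3
    exact (mul_eq_zero.1 h3).resolve_left (d.pos v₀ hv₀).ne'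
  have h4 : ∀ v w, b w = 0 → s v w = 0 := by
    intro v w hw
    by_cases hw0 : w = 0
    · simp [hw0]
    have h5 := (key w hw0 hw v).1
    rw [d.antisymm bv w, h2, neg_zero, mul_zero] at h5
    exact (mul_eq_zero.1 h5).resolve_right hB.ne'
  ext v w
  have h5 := h4 v (w - (b w / b bv) • bv) (by simp [hB.ne'])
  simpa [h2] using h5

/-- Along v₀ + t b^i, with v₀ ≠ 0 in the kernel of b, the form r is a quadratic polynomial in t
vanishing for all t ≠ 0, and these lines together with the line of b^i exhaust the space. -/
theorem r_eq_zero [FiniteDimensional ℝ E] (d : MetricFormData m b s bv S sv)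
    (hdim : 3 ≤ Module.finrank ℝ E) {r : E →L[ℝ] E →L[ℝ] ℝ}
    (h : ∀ y, b y ≠ 0 → m y y * b bv - b y ^ 2 ≠ 0 → r y y = 0) (y : E) : r y y = 0 := by
  have hB := d.bSq_pos
  have key : ∀ v₀, v₀ ≠ 0 → b v₀ = 0 → ∀ t : ℝ, t ≠ 0 →
      r v₀ v₀ + t * (r v₀ bv + r bv v₀) + t ^ 2 * r bv bv = 0 := by
    intro v₀ hv₀ hbv₀ t ht
    have e1 : b (v₀ + t • bv) = t * b bv := by simp [hbv₀]
    have e2 : m (v₀ + t • bv) (v₀ + t • bv) = m v₀ v₀ + t ^ 2 * b bv := by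
      simp only [map_add, map_smul, add_apply, smul_apply, smul_eq_mul, d.bv_eq, d.symm v₀ bv,
        hbv₀]
      ring
    have h1 := h (v₀ + t • bv) (by rw [e1]; exact mul_ne_zero ht hB.ne') (by
      rw [e1, e2]
      have : (m v₀ v₀ + t ^ 2 * b bv) * b bv - (t * b bv) ^ 2 = m v₀ v₀ * b bv := by ring
      rw [this]
      exact mul_ne_zero (d.pos v₀ hv₀).ne' hB.ne')
    simp only [map_add, map_smul, add_apply, smul_apply, smul_eq_mul] at h1
    linear_combination h1
  have key2 : ∀ v₀, v₀ ≠ 0 → b v₀ = 0 →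
      r v₀ v₀ = 0 ∧ r v₀ bv + r bv v₀ = 0 ∧ r bv bv = 0 := by
    intro v₀ hv₀ hbv₀
    -- Three roots annihilate a quadratic polynomial; t = 0 is excluded because β vanishes there.
    have h1 := key v₀ hv₀ hbv₀ 1 one_ne_zero
    have h2 := key v₀ hv₀ hbv₀ (-1) (by norm_num)
    have h3 := key v₀ hv₀ hbv₀ 2 two_ne_zero
    refine ⟨?_, ?_, ?_⟩ <;> linarith
  have h1 : ∃ v₀, v₀ ≠ 0 ∧ b v₀ = 0 := by
    have hf : LinearMap.ker (b : E →ₗ[ℝ] ℝ) ≠ ⊥ := by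
      refine LinearMap.ker_ne_bot_of_finrank_lt ?_
      simp only [Module.finrank_self]
      omega
    obtain ⟨v₀, hv₀, hne⟩ := (Submodule.ne_bot_iff _).1 hf
    exact ⟨v₀, hne, hv₀⟩
  obtain ⟨v₀, hv₀, hbv₀⟩ := h1
  have hbb := (key2 v₀ hv₀ hbv₀).2.2
  obtain ⟨u, t, hu, rfl⟩ : ∃ (u : E) (t : ℝ), b u = 0 ∧ y = u + t • bv :=
    ⟨y - (b y / b bv) • bv, b y / b bv, by simp [hB.ne'], by abel⟩
  by_cases hu0 : u = 0
  · simp [hu0, hbb]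
  · obtain ⟨h2, h3, -⟩ := key2 u hu0 hu
    simp only [map_add, map_smul, add_apply, smul_apply, smul_eq_mul]
    linear_combination h2 + t * h3 + t ^ 2 * hbb

/-- The Kropina part of the argument: if `β` times the direction is always tangent to `y`, then
`s` is decomposable and the remaining quadratic form is a multiple of the identity. -/
theorem kropina_necessity (d : MetricFormData m b s bv S sv) (r : E →L[ℝ] E →L[ℝ] ℝ)
    (h : E →L[ℝ] E →L[ℝ] E)
    (hU : ∀ y, b y ≠ 0 → ∀ v, angularForm m y (clearedField m b s bv S r h y) v = 0) :
    (∀ v w, s v w = (b bv)⁻¹ * (b v * s bv w - b w * s bv v)) ∧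
      ∃ θ : E →ₗ[ℝ] ℝ, ∀ y,
        h y y - (2 * b bv)⁻¹ • (m y y • sv + r y y • bv) = θ y • y := by
  have hB := d.bSq_pos
  have hline : ∀ y, ∀ᶠ t in 𝓝[≠] (0 : ℝ), b (y + t • bv) ≠ 0 := by
    intro y
    by_cases hy : b y = 0
    · filter_upwards [self_mem_nhdsWithin] with t ht
      simpa [hy, hB.ne'] using ht
    · have hc : Continuous fun t : ℝ => b (y + t • bv) := by fun_prop
      exact (hc.continuousAt.eventually_ne (by simpa using hy)).filter_mono nhdsWithin_le_nhds
  have hU' : ∀ y v, angularForm m y (clearedField m b s bv S r h y) v = 0 := by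
    intro y v
    have hc : Continuous fun y => angularForm m y (clearedField m b s bv S r h y) v := by
      have := (contDiff_clearedField (m := m) (b := b) (s := s) (bv := bv) (S := S) r h 0).continuous
      unfold angularForm
      fun_prop
    exact eq_zero_of_eventually_line hc ((hline y).mono fun t ht => hU _ ht v)
  -- For β = 0 the cleared field reduces to α²(Sy - (s(b, y)/b²)b), which is orthogonal to y. Being
  -- also parallel to y, it is zero.
  have hker : ∀ y, b y = 0 → ∀ v, s v y = (b bv)⁻¹ * (b v * s bv y) := by
    intro y hy v
    by_cases hy0 : y = 0
    · simp [hy0]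
    have hm := (d.pos y hy0).ne'
    have h1 := d.exists_smul_of_angularForm hy0 (hU' y)
    have h2 : clearedField m b s bv S r h y
        = m y y • (S y - ((b bv)⁻¹ * s bv y) • bv) := by
      simp only [clearedField, hy, mul_zero, zero_smul, zero_add, zero_mul, add_zero]
      module
    have h3 : m y (clearedField m b s bv S r h y) = 0 := by
      rw [h2]
      simp only [map_smul, map_sub, smul_eq_mul]
      rw [d.symm y (S y), d.S_eq, d.symm y bv, d.bv_eq, hy]
      have : s y y = 0 := by linarith [d.antisymm y y]
      rw [this]
      ring
    rw [h3, zero_div, zero_smul, h2, smul_eq_zero] at h1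
    have h4 := h1.resolve_left hm
    rw [← d.S_eq, sub_eq_zero.1 h4]
    simp only [map_smul, smul_apply, smul_eq_mul, d.bv_eq]
    ring
  -- Decompose w into its component in the kernel of b and a multiple of b^i.
  have hs : ∀ v w, s v w = (b bv)⁻¹ * (b v * s bv w - b w * s bv v) := by
    intro v w
    have h1 := hker (w - (b w / b bv) • bv) (by simp [hB.ne']) v
    have h2 : s bv bv = 0 := by linarith [d.antisymm bv bv]
    simp only [map_sub, map_smul, smul_eq_mul, h2, d.antisymm v bv] at h1
    field_simp at h1 ⊢
    exact mul_left_cancel₀ hB.ne' (by linear_combination h1)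
  refine ⟨hs, ?_⟩
  have hS : ∀ y, S y = (b bv)⁻¹ • (s bv y • bv - b y • sv) := by
    intro y
    rw [← sub_eq_zero]
    refine d.eq_zero fun v => ?_
    simp only [map_sub, map_smul, sub_apply, smul_apply, smul_eq_mul, d.S_eq, d.bv_eq, d.sv_eq]
    rw [hs v y]
    ring
  let z : E →L[ℝ] E →L[ℝ] E := h - (2 * b bv)⁻¹ •
    ((ContinuousLinearMap.compL ℝ E ℝ E (ContinuousLinearMap.toSpanSingleton ℝ sv)).comp m
      + (ContinuousLinearMap.compL ℝ E ℝ E (ContinuousLinearMap.toSpanSingleton ℝ bv)).comp r)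
  have hz : ∀ y, z y y = h y y - (2 * b bv)⁻¹ • (m y y • sv + r y y • bv) := by
    intro y
    simp [z]
  -- With s decomposable the whole field acquires the factor β, so the denominator that was cleared
  -- divides out and a quadratic map is left.
  have hUz : ∀ y, clearedField m b s bv S r h y = (2 * b y) • z y y := by
    intro y
    rw [clearedField, hS, hz]
    have e : (2 * b y) * (2 * b bv)⁻¹ = b y * (b bv)⁻¹ := by
      field_simp
    rw [smul_sub (2 * b y), smul_smul (2 * b y), e]
    module
  have hzy : ∀ y, ∃ c : ℝ, z y y = c • y := by
    intro y
    by_cases hy0 : y = 0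
    · exact ⟨0, by simp [hy0]⟩
    refine ⟨_, d.exists_smul_of_angularForm hy0 fun v => ?_⟩
    have hc : Continuous fun y => angularForm m y (z y y) v := by
      unfold angularForm
      fun_prop
    refine eq_zero_of_eventually_line (e := bv) hc ((hline y).mono fun t ht => ?_)
    have h1 := hU' (y + t • bv) v
    rw [hUz, angularForm_smul] at h1
    exact (mul_eq_zero.1 h1).resolve_left (mul_ne_zero two_ne_zero ht)
  obtain ⟨θ, hθ⟩ := exists_linear_of_forall_smul z hzy
  exact ⟨θ, fun y => by rw [← hz, hθ]⟩

end MetricFormData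

theorem analyticOnNhd_parts (d : MetricFormData m b s bv S sv) (r r' : E →L[ℝ] E →L[ℝ] ℝ)
    (h : E →L[ℝ] E →L[ℝ] E) (q : ℝ) (v : E) :
    AnalyticOnNhd ℝ (fun y => evenPart m b s b' q y (clearedField m' b' s' bv' S' r' h y) v
      + √(m y y) * oddPart m b s r b' q y (clearedField m' b' s' bv' S' r' h y) v) {0}ᶜ := by
  intro y hy
  have hm : m y y ≠ 0 := (d.pos y hy).ne'
  have hU := (contDiff_clearedField (m := m') (b := b') (s := s') (bv := bv') (S := S') r' h
    ω).contDiffAt (x := y)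
  have hmm : ContDiffAt ℝ ω (fun y => m y y) y := by fun_prop
  have hα := hmm.sqrt hm
  refine ContDiffAt.analyticAt ?_
  unfold evenPart oddPart angularForm angularCovector
  fun_prop

/-- The complement of the origin is connected in dimension at least two and α is analytic on it, so
the identity on `O` extends to all y ≠ 0. The cleared field is odd in y; hence y ↦ -y preserves the
even part and α, and reverses the odd part. This replaces the usual argument that α is irrational in
y. -/
theorem parts_eq_zero [FiniteDimensional ℝ E] (d : MetricFormData m b s bv S sv)
    (hdim : 3 ≤ Module.finrank ℝ E) (r r' : E →L[ℝ] E →L[ℝ] ℝ) (h : E →L[ℝ] E →L[ℝ] E) (q : ℝ)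
    {O : Set E} (hO : IsOpen O) (hne : O.Nonempty) (hb' : ∀ y ∈ O, b' y ≠ 0)
    (hR : ∀ y ∈ O, ∀ v, qForm m b (s.flip y) (r y y) y
      ((2 : ℝ) • h y y + kropinaField m' b' s' bv' S' r' y) v q = 0) {y : E} (hy : y ≠ 0) (v : E) :
    evenPart m b s b' q y (clearedField m' b' s' bv' S' r' h y) v = 0 ∧
      oddPart m b s r b' q y (clearedField m' b' s' bv' S' r' h y) v = 0 := by
  have hnn : ∀ y, 0 ≤ m y y := by
    intro y
    by_cases hy : y = 0
    · simp [hy]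
    · exact (d.pos y hy).le
  have hconn : IsPreconnected ({0}ᶜ : Set E) :=
    (isConnected_compl_singleton_of_one_lt_rank
      (by rw [← Module.finrank_eq_rank]; exact_mod_cast (by omega : 1 < Module.finrank ℝ E))
      0).isPreconnected
  have hzero : ∀ y : E, y ≠ 0 → evenPart m b s b' q y (clearedField m' b' s' bv' S' r' h y) v
      + √(m y y) * oddPart m b s r b' q y (clearedField m' b' s' bv' S' r' h y) v = 0 := by
    obtain ⟨y₀, hy₀⟩ := hne
    have hy₀0 : y₀ ≠ 0 := fun h0 => hb' y₀ hy₀ (by simp [h0])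
    have h1 := (analyticOnNhd_parts (b' := b') (m' := m') (s' := s') (bv' := bv') (S' := S')
      d r r' h q v).eqOn_of_preconnected_of_eventuallyEq (g := fun _ => 0)
      (fun _ _ => analyticAt_const) hconn (z₀ := y₀) hy₀0 ?_
    · exact fun y hy => h1 hy
    · filter_upwards [hO.mem_nhds hy₀] with y hy
      rw [clearedField_eq r' h (hb' y hy), ← mul_qForm_eq r (hnn y), hR y hy, mul_zero]
  have h1 := hzero y hy
  have h2 := hzero (-y) (neg_ne_zero.2 hy)
  rw [clearedField_neg] at h2
  set U := clearedField m' b' s' bv' S' r' h y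
  have e1 : evenPart m b s b' q (-y) (-U) v = evenPart m b s b' q y U v := by
    simp only [evenPart, angularForm, map_neg, neg_apply]
    ring
  have e2 : oddPart m b s r b' q (-y) (-U) v = -oddPart m b s r b' q y U v := by
    simp only [oddPart, angularForm, angularCovector, map_neg, neg_apply]
    ring
  have e3 : m (-y) (-y) = m y y := by simp
  rw [e1, e2, e3] at h2
  have h3 : √(m y y) ≠ 0 := (Real.sqrt_pos.2 (d.pos y hy)).ne'
  constructor
  · linarith
  · have : √(m y y) * oddPart m b s r b' q y U v = 0 := by linarith
    exact (mul_eq_zero.1 this).resolve_left h3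

/-- The pointwise consequences of projective relatedness on an open set of directions. -/
theorem pointwise_necessity [FiniteDimensional ℝ E] (hdim : 3 ≤ Module.finrank ℝ E)
    (d : MetricFormData m b s bv S sv) (d' : MetricFormData m' b' s' bv' S' sv')
    (hbb : ∀ y, b y ≠ 0 ↔ b' y ≠ 0) (r r' : E →L[ℝ] E →L[ℝ] ℝ) (h : E →L[ℝ] E →L[ℝ] E) {q : ℝ}
    (hq : q ≠ 1) {O : Set E} (hO : IsOpen O) (hne : O.Nonempty) (hb' : ∀ y ∈ O, b' y ≠ 0)
    (hR : ∀ y ∈ O, ∀ v, qForm m b (s.flip y) (r y y) y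
      ((2 : ℝ) • h y y + kropinaField m' b' s' bv' S' r' y) v q = 0) :
    s = 0 ∧ (∀ y, q * r y y = 0) ∧
      (∀ v w, s' v w = (b' bv')⁻¹ * (b' v * s' bv' w - b' w * s' bv' v)) ∧
      ∃ θ : E →ₗ[ℝ] ℝ, ∀ y,
        h y y - (2 * b' bv')⁻¹ • (m' y y • sv' + r' y y • bv') = θ y • y := by
  have hparts := fun (y : E) (hy : y ≠ 0) (v : E) =>
    parts_eq_zero d hdim r r' h q hO hne hb' hR hy v
  have hne0 : ∀ y, b y ≠ 0 → y ≠ 0 := fun y hb h0 => hb (by simp [h0])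
  have hq1 : q - 1 ≠ 0 := sub_ne_zero.2 hq
  have hs : s = 0 := by
    refine d.s_eq_zero hdim fun y hb hbm v => ?_
    exact d.mul_mul_eq_of_parts hb ((hbb y).1 hb) hbm (fun v => (hparts y (hne0 y hb) v).1)
      (fun v => (hparts y (hne0 y hb) v).2) v
  -- Once s = 0, the even part is (q - 1)β³ times an angular form.
  have hX : ∀ y, b y ≠ 0 → ∀ v, angularForm m y (clearedField m' b' s' bv' S' r' h y) v = 0 := by
    intro y hb v
    have h1 := (hparts y (hne0 y hb) v).1
    rw [evenPart, hs] at h1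
    simp only [zero_apply, mul_zero, sub_zero] at h1
    exact (mul_eq_zero.1 h1).resolve_left (mul_ne_zero hq1 (pow_ne_zero 3 hb))
  refine ⟨hs, ?_, ?_⟩
  · intro y
    by_cases hq0 : q = 0
    · simp [hq0]
    rw [d.r_eq_zero hdim (r := r) ?_ y, mul_zero]
    intro y hb hV
    -- On b^i the angular form equals α²b(u) - β(y·u), which vanishes; the bracket in the odd part
    -- is thereby reduced to α²β̄r₀₀.
    have h1 := (hparts y (hne0 y hb) bv).2
    have h2 := hX y hb bv
    rw [oddPart, h2, hs, d.angularCovector_bv] at h1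
    rw [d.angularForm_apply_bv] at h2
    simp only [zero_apply, mul_zero, zero_add] at h1
    have h3 := (mul_eq_zero.1 h1).resolve_right hV
    have h4 := (mul_eq_zero.1 h3).resolve_left (mul_ne_zero hq0 hq1)
    have h5 : m y y * (b' y * r y y) = 0 := by linear_combination h4 - h2
    exact (mul_eq_zero.1 ((mul_eq_zero.1 h5).resolve_left (d.pos y (hne0 y hb)).ne')).resolve_left
      ((hbb y).1 hb)
  · refine d'.kropina_necessity r' h fun y hb v => ?_
    have hb0 := (hbb y).2 hb
    -- Being parallel to y does not depend on the metric, so the conclusion for the first metric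
    -- passes to the second.
    have h1 := d.exists_smul_of_angularForm (hne0 y hb0) (hX y hb0)
    rw [h1, angularForm_self]

end Necessity

/-! ### The two metrics in coordinates, and the algebraic form of projective relatedness. -/

section LocalTheory

attribute [local instance] bilinNormedAddCommGroup bilinNormedSpace

variable {n : ℕ}

/-- Components of a Riemannian metric and of a nonvanishing `1`-form around a point `x`. -/
structure IsLocalPair (a : Euc n → Matrix (Fin n) (Fin n) ℝ) (b : Euc n → Fin n → ℝ)
    (x : Euc n) : Prop where
  contDiffAt_metric : ∀ i j, ContDiffAt ℝ 2 (fun x' => a x' i j) x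
  contDiffAt_form : ∀ i, ContDiffAt ℝ 2 (fun x' => b x' i) x
  symm : ∀ᶠ x' in 𝓝 x, (a x').IsSymm
  pos : ∀ v : Euc n, v ≠ 0 → 0 < matForm (a x) v v
  ne_zero : covForm (b x) ≠ 0

/-- The two-form `s_ij`. -/
def sForm (a : Euc n → Matrix (Fin n) (Fin n) ℝ) (b : Euc n → Fin n → ℝ) (x : Euc n) :
    Euc n →L[ℝ] Euc n →L[ℝ] ℝ :=
  matForm (Matrix.of (sLow a b x))

/-- The symmetric form `r_ij`. -/
def rForm (a : Euc n → Matrix (Fin n) (Fin n) ℝ) (b : Euc n → Fin n → ℝ) (x : Euc n) :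
    Euc n →L[ℝ] Euc n →L[ℝ] ℝ :=
  matForm (Matrix.of (rLow a b x))

theorem rForm_self (a : Euc n → Matrix (Fin n) (Fin n) ℝ) (b : Euc n → Fin n → ℝ) (x y : Euc n) :
    rForm a b x y y = rZeroZero a b x y := by
  rw [rForm, matForm_apply]
  rfl

variable {a a' : Euc n → Matrix (Fin n) (Fin n) ℝ} {b b' : Euc n → Fin n → ℝ} {x : Euc n}

namespace IsLocalPair

theorem det_ne_zero (h : IsLocalPair a b x) : (a x).det ≠ 0 := det_ne_zero_of_matForm_pos h.pos

theorem metricFormData (h : IsLocalPair a b x) : MetricFormData (matForm (a x)) (covForm (b x))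
    (sForm a b x) (bUpVec a b x) (sEndo a b x) (sVecVec a b x) where
  symm := matForm_comm h.symm.self_of_nhds
  pos := h.pos
  bv_eq := matForm_bUpVec h.symm.self_of_nhds h.det_ne_zero
  antisymm := sLow_antisymm
  S_eq := matForm_sEndo h.symm.self_of_nhds h.det_ne_zero
  sv_eq := matForm_sVecVec h.symm.self_of_nhds h.det_ne_zero
  ne_zero := h.ne_zero

theorem differentiableAt_metric (h : IsLocalPair a b x) (i j : Fin n) :
    DifferentiableAt ℝ (fun x' => a x' i j) x :=
  (h.contDiffAt_metric i j).differentiableAt (by norm_num)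

theorem differentiableAt_form (h : IsLocalPair a b x) (i : Fin n) :
    DifferentiableAt ℝ (fun x' => b x' i) x :=
  (h.contDiffAt_form i).differentiableAt (by norm_num)

theorem fderiv_matForm_symm (h : IsLocalPair a b x) (u v w : Euc n) :
    fderiv ℝ (fun x' => matForm (a x')) x u v w = fderiv ℝ (fun x' => matForm (a x')) x u w v := by
  rw [fderiv_matForm h.differentiableAt_metric, fderiv_matForm h.differentiableAt_metric,
    Finset.sum_comm]
  refine Finset.sum_congr rfl fun i _ => Finset.sum_congr rfl fun j _ => ?_
  have : (fun x' => a x' j i) =ᶠ[𝓝 x] fun x' => a x' i j := by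
    filter_upwards [h.symm] with x' hx'
    exact hx'.apply _ _
  rw [this.fderiv_eq]
  ring

/-- Replacing z by w = z + Γ(y, y) absorbs all derivatives of the metric: β differentiated along the
jet leaves r₀₀ + b(w), and its Euler-Lagrange covector is 2s(v, y). -/
theorem alphaBetaJet (h : IsLocalPair a b x) (y z : Euc n) :
    AlphaBetaJet (metricEnergy fun x' => matForm (a x')) (formEval fun x' => covForm (b x')) (x, y)
      z (matForm (a x)) (covForm (b x)) ((sForm a b x).flip y) (rForm a b x y y)
      (z + christoffelForm a x y y) := by
  have hs := h.symm.self_of_nhds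
  have hm : ContDiffAt ℝ 2 (fun x' => matForm (a x')) (x, y).1 :=
    contDiffAt_matForm h.contDiffAt_metric
  have hη : ContDiffAt ℝ 2 (fun x' => covForm (b x')) (x, y).1 :=
    contDiffAt_covForm h.contDiffAt_form
  have hΓ := matForm_christoffelForm h.differentiableAt_metric h.symm h.det_ne_zero y
  constructor
  · exact contDiffAt_metricEnergy hm
  · exact contDiffAt_formEval hη
  · exact matForm_comm hs
  · rfl
  · rfl
  · intro v
    rw [eulerLagrange_metricEnergy hm, map_add, add_apply, hΓ, h.fderiv_matForm_symm y v y,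
      matForm_comm hs v z]
    ring
  · rw [fderiv_metricEnergy (hm.differentiableAt (by norm_num)), map_add,
      matForm_comm hs y (christoffelForm a x y y), hΓ, matForm_comm hs y z]
    ring
  · intro v
    rw [fderiv_metricEnergy (hm.differentiableAt (by norm_num)), matForm_comm hs v y]
    simp
    ring
  · intro v
    rw [eulerLagrange_formEval hη, ContinuousLinearMap.flip_apply, sForm,
      matForm_sLow h.symm h.differentiableAt_form]
    ring
  · rw [fderiv_formEval (hη.differentiableAt (by norm_num)), rForm_self,
      rZeroZero_eq h.differentiableAt_form, map_add]
    ring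
  · intro v
    rw [fderiv_formEval (hη.differentiableAt (by norm_num))]
    simp

section Kropina

variable (h : IsLocalPair a b x) {K : Euc n → Euc n → ℝ} {y : Euc n}
  (hK : (fun p : Euc n × Euc n => K p.1 p.2) =ᶠ[𝓝 (x, y)] fun p =>
    metricEnergy (fun x' => matForm (a x')) p / formEval (fun x' => covForm (b x')) p)
  (hy : covForm (b x) y ≠ 0)
include h hK hy

theorem contDiffAt_kropina : ContDiffAt ℝ 2 (fun p : Euc n × Euc n => K p.1 p.2) (x, y) :=
  ContDiffAt.congr_of_eventuallyEq
    ((h.alphaBetaJet y 0).contDiffAt_A.div (h.alphaBetaJet y 0).contDiffAt_B hy) hK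

theorem kropina_energy_ne_zero : matForm (a x) y y ≠ 0 :=
  (h.pos y fun h0 => hy (by simp [h0])).ne'

theorem kropina_ne_zero : K x y ≠ 0 := by
  have h1 : K x y = matForm (a x) y y / covForm (b x) y := hK.self_of_nhds
  rw [h1]
  exact div_ne_zero (h.kropina_energy_ne_zero hK hy) hy

theorem eulerLagrange_kropina (z v : Euc n) :
    eulerLagrange (fun p : Euc n × Euc n => K p.1 p.2) (x, y) z v
      * (matForm (a x) y y * covForm (b x) y ^ 3)
      = 2 * kropinaForm (matForm (a x)) (covForm (b x)) ((sForm a b x).flip y) (rForm a b x y y) y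
        (z + christoffelForm a x y y) v := by
  rw [hK.eulerLagrange_eq]
  exact (h.alphaBetaJet y z).eulerLagrange_kropina hy v

theorem homogeneousAt_kropina : HomogeneousAt (fun p : Euc n × Euc n => K p.1 p.2) (x, y) := by
  filter_upwards [hK.eventually_nhds] with p hp
  have h2 : Tendsto (fun c : ℝ => ((p.1, c • p.2) : Euc n × Euc n)) (𝓝 1) (𝓝 p) := by
    have : Continuous fun c : ℝ => ((p.1, c • p.2) : Euc n × Euc n) := by fun_prop
    simpa using this.tendsto 1
  filter_upwards [h2.eventually hp, eventually_ne_nhds (one_ne_zero' ℝ)] with c hc hc0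
  have h3 := hp.self_of_nhds
  simp only [metricEnergy, formEval, map_smul, smul_apply, smul_eq_mul] at hc h3
  rw [hc, h3]
  field_simp

/-- Nondegeneracy is automatic here. A vector in the kernel of Hess K², tested against y, is
annihilated by dK and hence lies in the kernel of Hess K, which is the line through y; since dK(y) =
K ≠ 0, it is zero. -/
theorem det_kropina_ne_zero : (fundamentalTensor K x y).det ≠ 0 := by
  have hC := h.contDiffAt_kropina hK hy
  have hhom := h.homogeneousAt_kropina hK hy
  have hK0 := h.kropina_ne_zero hK hy
  have hker : ∀ w : Euc n, (∀ v, fderiv ℝ (fderiv ℝ (fun p : Euc n × Euc n => K p.1 p.2)) (x, y)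
      (0, w) (0, v) = 0) → ∃ c : ℝ, w = c • y := by
    intro w hw
    -- Subtracting the covectors for the accelerations -Γ(y, y) and -Γ(y, y) + w isolates the part
    -- of `kropinaForm` that is linear in w.
    refine h.metricFormData.kropinaForm_kernel hy fun v => ?_
    have h1 := h.eulerLagrange_kropina hK hy (-christoffelForm a x y y) v
    have h2 := h.eulerLagrange_kropina hK hy (-christoffelForm a x y y + w) v
    rw [eulerLagrange_add, hw, add_zero, h1] at h2
    rw [neg_add_cancel, neg_add_cancel_comm] at h2
    simp only [kropinaForm, angularForm, map_zero, zero_apply] at h2 ⊢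
    linear_combination -(1 / 2) * h2
  rw [fundamentalTensor_det_ne_zero_iff (hC.pow 2)]
  intro w hw
  have e1 : fderiv ℝ (fun p : Euc n × Euc n => K p.1 p.2) (x, y) (0, y) = K x y :=
    (hhom.euler hC).self_of_nhds
  have h1 := hw y
  have e2 : fderiv ℝ (fderiv ℝ (fun p : Euc n × Euc n => K p.1 p.2)) (x, y) (0, w) (0, y) = 0 := by
    rw [hC.symm_fderiv_fderiv]
    exact hhom.fderiv_fderiv_vertical hC w
  rw [fderiv_fderiv_sq hC, e1, e2] at h1
  have h2 : fderiv ℝ (fun p : Euc n × Euc n => K p.1 p.2) (x, y) (0, w) = 0 := by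
    have : fderiv ℝ (fun p : Euc n × Euc n => K p.1 p.2) (x, y) (0, w) * K x y = 0 := by linarith
    exact (mul_eq_zero.1 this).resolve_right hK0
  obtain ⟨c, rfl⟩ := hker w fun v => by
    have h3 := hw v
    rw [fderiv_fderiv_sq hC, h2] at h3
    have : K x y * fderiv ℝ (fderiv ℝ (fun p : Euc n × Euc n => K p.1 p.2)) (x, y) (0, w) (0, v)
      = 0 := by linarith
    exact (mul_eq_zero.1 this).resolve_left hK0
  have h4 : ((0, c • y) : Euc n × Euc n) = c • (0, y) := by simp
  rw [h4, map_smul, e1, smul_eq_mul] at h2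
  rw [(mul_eq_zero.1 h2).resolve_right hK0, zero_smul]

/-- The spray of a Kropina metric. -/
theorem exists_sprayVec_kropina :
    ∃ c : ℝ, christoffelForm a x y y - (2 : ℝ) • sprayVec K x y
      = kropinaField (matForm (a x)) (covForm (b x)) (sForm a b x) (bUpVec a b x) (sEndo a b x)
        (rForm a b x) y + c • y := by
  -- Rapcsák's criterion applied to K and its own spray, with factor 0.
  have hgeo := (eulerLagrange_eq_zero_iff (h.contDiffAt_kropina hK hy) (h.homogeneousAt_kropina hK hy)
    (h.kropina_ne_zero hK hy) (h.det_kropina_ne_zero hK hy) (sprayVec K x y)).2 ⟨0, by simp⟩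
  refine (h.metricFormData.kropinaForm_eq_zero_iff (rForm a b x) hy _).1 fun v => ?_
  have h1 := h.eulerLagrange_kropina hK hy (-(2 : ℝ) • sprayVec K x y) v
  rw [hgeo, zero_mul] at h1
  have e : christoffelForm a x y y - (2 : ℝ) • sprayVec K x y
      = -(2 : ℝ) • sprayVec K x y + christoffelForm a x y y := by module
  rw [e]
  linarith

end Kropina

end IsLocalPair

/-- Around `(x, y)`, the function `F` is a nondegenerate Finsler function of the form
`β^q / (β - α)^(q - 1)`. -/
structure IsLocalQMetric (a : Euc n → Matrix (Fin n) (Fin n) ℝ) (b : Euc n → Fin n → ℝ) (q : ℝ)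
    (F : Euc n → Euc n → ℝ) (x y : Euc n) : Prop where
  eq : (fun p : Euc n × Euc n => F p.1 p.2) =ᶠ[𝓝 (x, y)] fun p =>
    formEval (fun x' => covForm (b x')) p ^ q / (formEval (fun x' => covForm (b x')) p
      - √(metricEnergy (fun x' => matForm (a x')) p)) ^ (q - 1)
  homogeneous : HomogeneousAt (fun p : Euc n × Euc n => F p.1 p.2) (x, y)
  det_ne_zero : (fundamentalTensor F x y).det ≠ 0
  ne_zero : F x y ≠ 0
  vec_ne_zero : y ≠ 0
  beta_ne_zero : covForm (b x) y ≠ 0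
  beta_sub_alpha_ne_zero : covForm (b x) y - √(matForm (a x) y y) ≠ 0
  rpow_ne_zero : ∀ᶠ p in 𝓝 (x, y), (formEval (fun x' => covForm (b x')) p
      - √(metricEnergy (fun x' => matForm (a x')) p)) ^ (q - 1) ≠ 0

namespace IsLocalQMetric

variable {q : ℝ} {F : Euc n → Euc n → ℝ} {y : Euc n}

theorem contDiffAt (hF : IsLocalQMetric a b q F x y) (h : IsLocalPair a b x) :
    ContDiffAt ℝ 2 (fun p : Euc n × Euc n => F p.1 p.2) (x, y) := by
  refine ContDiffAt.congr_of_eventuallyEq ?_ hF.eq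
  have hA := (h.alphaBetaJet y 0).contDiffAt_A
  have hB := (h.alphaBetaJet y 0).contDiffAt_B
  have hα := hA.sqrt (h.pos y hF.vec_ne_zero).ne'
  exact (hB.rpow_const_of_ne hF.beta_ne_zero).div
    ((hB.sub hα).rpow_const_of_ne hF.beta_sub_alpha_ne_zero) hF.rpow_ne_zero.self_of_nhds

theorem eulerLagrange_eq (hF : IsLocalQMetric a b q F x y) (h : IsLocalPair a b x) (z v : Euc n) :
    eulerLagrange (fun p : Euc n × Euc n => F p.1 p.2) (x, y) z v
      * (√(matForm (a x) y y) ^ 3 * covForm (b x) y ^ 2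
        * (covForm (b x) y - √(matForm (a x) y y)) ^ 2)
      = F x y * qForm (matForm (a x)) (covForm (b x)) ((sForm a b x).flip y) (rForm a b x y y) y
        (z + christoffelForm a x y y) v q := by
  rw [hF.eq.eulerLagrange_eq, (h.alphaBetaJet y z).eulerLagrange_q q (h.pos y hF.vec_ne_zero)
    hF.beta_ne_zero hF.beta_sub_alpha_ne_zero hF.rpow_ne_zero v]
  congr 1
  exact hF.eq.self_of_nhds.symm

theorem factor_ne_zero (hF : IsLocalQMetric a b q F x y) (h : IsLocalPair a b x) :
    √(matForm (a x) y y) ^ 3 * covForm (b x) y ^ 2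
      * (covForm (b x) y - √(matForm (a x) y y)) ^ 2 ≠ 0 :=
  mul_ne_zero (mul_ne_zero (pow_ne_zero 3 (Real.sqrt_pos.2 (h.pos y hF.vec_ne_zero)).ne')
    (pow_ne_zero 2 hF.beta_ne_zero)) (pow_ne_zero 2 hF.beta_sub_alpha_ne_zero)

theorem eulerLagrange_eq_zero_iff (hF : IsLocalQMetric a b q F x y) (h : IsLocalPair a b x)
    (z v : Euc n) : eulerLagrange (fun p : Euc n × Euc n => F p.1 p.2) (x, y) z v = 0 ↔
      qForm (matForm (a x)) (covForm (b x)) ((sForm a b x).flip y) (rForm a b x y y) y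
        (z + christoffelForm a x y y) v q = 0 := by
  have h1 := hF.eulerLagrange_eq h z v
  constructor
  · intro h0
    rw [h0, zero_mul] at h1
    exact (mul_eq_zero.1 h1.symm).resolve_left hF.ne_zero
  · intro h0
    rw [h0, mul_zero] at h1
    exact (mul_eq_zero.1 h1).resolve_right (hF.factor_ne_zero h)

/-- Nondegeneracy forces the denominator in the spray of `F` not to vanish, except possibly in the
direction of `b^i`. -/
theorem exists_smul_of_qDenominator (hF : IsLocalQMetric a b q F x y) (h : IsLocalPair a b x)
    (h0 : qDenominator (matForm (a x)) (covForm (b x)) (bUpVec a b x) q y = 0) :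
    ∃ c : ℝ, bUpVec a b x = c • y := by
  have hC := hF.contDiffAt h
  refine hF.homogeneous.exists_smul_of_fderiv_fderiv hC hF.ne_zero
    ((fundamentalTensor_det_ne_zero_iff (hC.pow 2)).1 hF.det_ne_zero) fun v => ?_
  -- The difference of the covectors for the accelerations 0 and b^i is the vertical Hessian of F on
  -- b^i. By `qForm_add_bv` it is proportional to the denominator, so b^i lies in the kernel of the
  -- Hessian.
  have h1 := hF.eulerLagrange_eq h 0 v
  have h2 := hF.eulerLagrange_eq h (0 + bUpVec a b x) v
  rw [eulerLagrange_add, add_right_comm,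
    h.metricFormData.qForm_add_bv _ _ _ _ _ _ hF.vec_ne_zero, h0] at h2
  have h3 : fderiv ℝ (fderiv ℝ (fun p : Euc n × Euc n => F p.1 p.2)) (x, y)
      (0, bUpVec a b x) (0, v) * (√(matForm (a x) y y) ^ 3 * covForm (b x) y ^ 2
        * (covForm (b x) y - √(matForm (a x) y y)) ^ 2) = 0 := by linear_combination h2 - h1
  exact (mul_eq_zero.1 h3).resolve_right (hF.factor_ne_zero h)

/-- Rapcsák's criterion for F with the Kropina spray, which is known modulo y; the covector of F
does not see multiples of y in the acceleration. -/
theorem exists_spray_eq_iff (hF : IsLocalQMetric a b q F x y) (h : IsLocalPair a b x)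
    (h' : IsLocalPair a' b' x) {K : Euc n → Euc n → ℝ}
    (hK : (fun p : Euc n × Euc n => K p.1 p.2) =ᶠ[𝓝 (x, y)] fun p =>
      metricEnergy (fun x' => matForm (a' x')) p / formEval (fun x' => covForm (b' x')) p)
    (hy : covForm (b' x) y ≠ 0) :
    (∃ c : ℝ, sprayVec F x y = sprayVec K x y + c • y) ↔
      ∀ v, qForm (matForm (a x)) (covForm (b x)) ((sForm a b x).flip y) (rForm a b x y y) y
        ((2 : ℝ) • ((1 / 2 : ℝ) • (christoffelForm a x - christoffelForm a' x)) y y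
          + kropinaField (matForm (a' x)) (covForm (b' x)) (sForm a' b' x) (bUpVec a' b' x)
            (sEndo a' b' x) (rForm a' b' x) y) v q = 0 := by
  rw [← _root_.eulerLagrange_eq_zero_iff (hF.contDiffAt h) hF.homogeneous hF.ne_zero
    hF.det_ne_zero]
  refine forall_congr' fun v => ?_
  obtain ⟨c, hc⟩ := h'.exists_sprayVec_kropina hK hy
  rw [← hF.homogeneous.eulerLagrange_add_smul (hF.contDiffAt h) _ _ (-c)]
  rw [hF.eulerLagrange_eq_zero_iff h]
  have e : -(2 : ℝ) • sprayVec K x y + -c • (x, y).2 + christoffelForm a x y y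
      = (2 : ℝ) • ((1 / 2 : ℝ) • (christoffelForm a x - christoffelForm a' x)) y y
          + kropinaField (matForm (a' x)) (covForm (b' x)) (sForm a' b' x) (bUpVec a' b' x)
            (sEndo a' b' x) (rForm a' b' x) y := by
    rw [eq_sub_of_add_eq hc.symm]
    simp only [smul_apply, sub_apply]
    module
  rw [e]

end IsLocalQMetric

end LocalTheory

/-! ### Changes of coordinates for Lagrangians. -/

section Transition

variable {E : Type*} [NormedAddCommGroup E] [NormedSpace ℝ E]

/-- The map `(x, y) ↦ (ψ x, Dψ_x y)` induced by `ψ` on tangent vectors. -/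
def tangentLift (ψ : E → E) (p : E × E) : E × E := (ψ p.1, fderiv ℝ ψ p.1 p.2)

/-- The acceleration induced by `ψ`. -/
def accelLift (ψ : E → E) (p : E × E) (z : E) : E :=
  fderiv ℝ (fderiv ℝ ψ) p.1 p.2 p.2 + fderiv ℝ ψ p.1 z

variable {ψ : E → E} {p : E × E}

theorem hasFDerivAt_tangentLift (hψ : ContDiffAt ℝ 2 ψ p.1) :
    HasFDerivAt (tangentLift ψ)
      (((fderiv ℝ ψ p.1).comp (ContinuousLinearMap.fst ℝ E E)).prod
        ((fderiv ℝ ψ p.1).comp (ContinuousLinearMap.snd ℝ E E)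
          + ((fderiv ℝ (fderiv ℝ ψ) p.1).comp (ContinuousLinearMap.fst ℝ E E)).flip p.2)) p := by
  have h1 : HasFDerivAt ψ (fderiv ℝ ψ p.1) p.1 :=
    (hψ.differentiableAt (by norm_num)).hasFDerivAt
  have h2 : HasFDerivAt (fderiv ℝ ψ) (fderiv ℝ (fderiv ℝ ψ) p.1) p.1 :=
    ((hψ.fderiv_right (m := 1) (by norm_num)).differentiableAt (by norm_num)).hasFDerivAt
  have h3 := HasFDerivAt.comp (f := Prod.fst) p h1 (hasFDerivAt_fst (𝕜 := ℝ) (E := E) (F := E))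
  have h4 := HasFDerivAt.comp (f := Prod.fst) p h2 (hasFDerivAt_fst (𝕜 := ℝ) (E := E) (F := E))
  exact h3.prodMk (h4.clm_apply hasFDerivAt_snd)

theorem fderiv_tangentLift (hψ : ContDiffAt ℝ 2 ψ p.1) (h k : E) :
    fderiv ℝ (tangentLift ψ) p (h, k)
      = (fderiv ℝ ψ p.1 h, fderiv ℝ (fderiv ℝ ψ) p.1 h p.2 + fderiv ℝ ψ p.1 k) := by
  rw [(hasFDerivAt_tangentLift hψ).fderiv]
  simp [add_comm]

theorem fderiv_comp_tangentLift {L L' : E × E → ℝ} (hψ : ContDiffAt ℝ 2 ψ p.1)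
    (hL' : DifferentiableAt ℝ L' (tangentLift ψ p)) (hL : L =ᶠ[𝓝 p] L' ∘ tangentLift ψ) (h k : E) :
    fderiv ℝ L p (h, k) = fderiv ℝ L' (tangentLift ψ p)
      (fderiv ℝ ψ p.1 h, fderiv ℝ (fderiv ℝ ψ) p.1 h p.2 + fderiv ℝ ψ p.1 k) := by
  rw [hL.fderiv_eq, fderiv_comp p hL' (hasFDerivAt_tangentLift hψ).differentiableAt,
    ContinuousLinearMap.comp_apply, fderiv_tangentLift hψ]

/-- Invariance of the Euler-Lagrange covector under changes of coordinates. -/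
theorem eulerLagrange_tangentLift {L L' : E × E → ℝ} (hψ : ContDiffAt ℝ 2 ψ p.1)
    (hL' : ContDiffAt ℝ 2 L' (tangentLift ψ p)) (hC : ContDiffAt ℝ 2 L p)
    (hL : L =ᶠ[𝓝 p] L' ∘ tangentLift ψ) (z v : E) :
    eulerLagrange L p z v
      = eulerLagrange L' (tangentLift ψ p) (accelLift ψ p z) (fderiv ℝ ψ p.1 v) := by
  have hd : ∀ᶠ p' in 𝓝 p, ContDiffAt ℝ 2 ψ p'.1 :=
    continuous_fst.continuousAt.eventually (hψ.eventually (by norm_num))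
  have h1 : (fun p' => fderiv ℝ L p' (0, v)) =ᶠ[𝓝 p]
      fun p' => fderiv ℝ L' (tangentLift ψ p') (0, fderiv ℝ ψ p'.1 v) := by
    filter_upwards [hd, hL.eventually_nhds,
      (hasFDerivAt_tangentLift hψ).continuousAt.eventually hL'.eventually_differentiableAt]
      with p' h2 h3 h4
    rw [fderiv_comp_tangentLift h2 h4 h3]
    simp
  have h2 : HasFDerivAt (fderiv ℝ ψ) (fderiv ℝ (fderiv ℝ ψ) p.1) p.1 :=
    ((hψ.fderiv_right (m := 1) (by norm_num)).differentiableAt (by norm_num)).hasFDerivAt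
  have h4 := HasFDerivAt.comp (f := Prod.fst) p h2 (hasFDerivAt_fst (𝕜 := ℝ) (E := E) (F := E))
  have h5 := (hasFDerivAt_const (0 : E) p).prodMk (h4.clm_apply (hasFDerivAt_const v p))
  have h6 := (HasFDerivAt.comp p hL'.differentiableAt_fderiv.hasFDerivAt
    (hasFDerivAt_tangentLift hψ)).clm_apply h5
  have h7 := h6.congr_of_eventuallyEq h1
  rw [eulerLagrange, fderiv_fderiv_apply_eq hC.differentiableAt_fderiv h7,
    fderiv_comp_tangentLift hψ (hL'.differentiableAt (by norm_num)) hL, eulerLagrange]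
  -- Two terms carry D²ψ(y, v): the derivative of the transported test vector, and the vertical part
  -- of the lift of (v, 0). They cancel by symmetry.
  have hsymm : fderiv ℝ (fderiv ℝ ψ) p.1 p.2 v = fderiv ℝ (fderiv ℝ ψ) p.1 v p.2 :=
    hψ.isSymmSndFDerivAt (by simp) p.2 v
  have e : ((fderiv ℝ ψ p.1 v, fderiv ℝ (fderiv ℝ ψ) p.1 v p.2) : E × E)
      = (fderiv ℝ ψ p.1 v, 0) + (0, fderiv ℝ (fderiv ℝ ψ) p.1 v p.2) := by simp
  simp only [map_zero, add_zero]
  rw [e, map_add]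
  simp [hsymm, tangentLift, accelLift, add_comm]
  ring

end Transition

/-! ### Tensoriality of s, r, b^i and s^i under changes of coordinates. -/

section LocalTransition

attribute [local instance] bilinNormedAddCommGroup bilinNormedSpace

variable {n : ℕ}

/-- Transformation law of the spray coefficients. -/
theorem sprayVec_tangentLift {L L' : Euc n → Euc n → ℝ} {ψ : Euc n → Euc n} {x y : Euc n}
    (hψ : ContDiffAt ℝ 2 ψ x) (hsurj : Function.Surjective (fderiv ℝ ψ x))
    (hC : ContDiffAt ℝ 2 (fun p : Euc n × Euc n => L p.1 p.2 ^ 2) (x, y))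
    (hC' : ContDiffAt ℝ 2 (fun p : Euc n × Euc n => L' p.1 p.2 ^ 2) (ψ x, fderiv ℝ ψ x y))
    (hdet : (fundamentalTensor L x y).det ≠ 0)
    (hdet' : (fundamentalTensor L' (ψ x) (fderiv ℝ ψ x y)).det ≠ 0)
    (hL : ∀ᶠ p in 𝓝 (x, y), L p.1 p.2 = L' (ψ p.1) (fderiv ℝ ψ p.1 p.2)) :
    sprayVec L' (ψ x) (fderiv ℝ ψ x y)
      = fderiv ℝ ψ x (sprayVec L x y) - (1 / 2 : ℝ) • fderiv ℝ (fderiv ℝ ψ) x y y := by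
  symm
  refine eq_sprayVec hC' hdet' fun v' => ?_
  obtain ⟨v, rfl⟩ := hsurj v'
  have hL2 : (fun p : Euc n × Euc n => L p.1 p.2 ^ 2) =ᶠ[𝓝 (x, y)]
      (fun p : Euc n × Euc n => L' p.1 p.2 ^ 2) ∘ tangentLift ψ := by
    filter_upwards [hL] with p hp
    simp [tangentLift, hp]
  have h1 := eulerLagrange_sprayVec hC hdet v
  rw [eulerLagrange_tangentLift (p := (x, y)) hψ hC' hC hL2] at h1
  rw [← h1]
  congr 1
  simp only [accelLift, map_smul]
  module

variable {a a' : Euc n → Matrix (Fin n) (Fin n) ℝ} {b b' : Euc n → Fin n → ℝ} {ψ : Euc n → Euc n}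
  {x : Euc n}

/-- The components `a', b'` in the coordinates `ψ x` are those of the metric and the form with
components `a, b` in the coordinates `x`. -/
structure IsLocalTransition (ψ : Euc n → Euc n) (a : Euc n → Matrix (Fin n) (Fin n) ℝ)
    (b : Euc n → Fin n → ℝ) (a' : Euc n → Matrix (Fin n) (Fin n) ℝ) (b' : Euc n → Fin n → ℝ)
    (x : Euc n) : Prop where
  contDiffAt : ContDiffAt ℝ 2 ψ x
  surjective : Function.Surjective (fderiv ℝ ψ x)
  metric : ∀ᶠ x' in 𝓝 x, ∀ y, matForm (a x') y y
    = matForm (a' (ψ x')) (fderiv ℝ ψ x' y) (fderiv ℝ ψ x' y)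
  form : ∀ᶠ x' in 𝓝 x, ∀ y, covForm (b x') y = covForm (b' (ψ x')) (fderiv ℝ ψ x' y)

namespace IsLocalTransition

variable (T : IsLocalTransition ψ a b a' b' x) (h : IsLocalPair a b x)
  (h' : IsLocalPair a' b' (ψ x))
include T

theorem covForm_eq (y : Euc n) : covForm (b' (ψ x)) (fderiv ℝ ψ x y) = covForm (b x) y :=
  (T.form.self_of_nhds y).symm

include h h'

theorem matForm_eq (v w : Euc n) :
    matForm (a' (ψ x)) (fderiv ℝ ψ x v) (fderiv ℝ ψ x w) = matForm (a x) v w := by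
  have h1 := T.metric.self_of_nhds
  have h2 := h1 (v + w)
  simp only [map_add, add_apply] at h2
  rw [matForm_comm h.symm.self_of_nhds w v,
    matForm_comm h'.symm.self_of_nhds (fderiv ℝ ψ x w)] at h2
  linarith [h1 v, h1 w]

theorem eq_of_matForm {u : Euc n} {u' : Euc n}
    (hu : ∀ v, matForm (a x) u v = matForm (a' (ψ x)) u' (fderiv ℝ ψ x v)) :
    fderiv ℝ ψ x u = u' := by
  rw [← sub_eq_zero]
  refine h'.metricFormData.eq_zero fun w => ?_
  obtain ⟨v, rfl⟩ := T.surjective w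
  rw [map_sub, sub_apply, T.matForm_eq h h', hu, sub_self]

/-- The Euler-Lagrange covector of β is 2s(·, y), so its invariance is that of s. -/
theorem sForm_eq (v y : Euc n) :
    sForm a' b' (ψ x) (fderiv ℝ ψ x v) (fderiv ℝ ψ x y) = sForm a b x v y := by
  have h1 := (h.alphaBetaJet y 0).eulerLagrange_B v
  have h2 := (h'.alphaBetaJet (fderiv ℝ ψ x y) (accelLift ψ (x, y) 0)).eulerLagrange_B
    (fderiv ℝ ψ x v)
  rw [eulerLagrange_tangentLift (ψ := ψ) (L' := formEval fun x' => covForm (b' x')) (p := (x, y))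
    T.contDiffAt (h'.alphaBetaJet (fderiv ℝ ψ x y) 0).contDiffAt_B
    (h.alphaBetaJet y 0).contDiffAt_B ?_] at h1
  · simp only [ContinuousLinearMap.flip_apply] at h1 h2
    have h3 := h2.symm.trans h1
    linarith
  · filter_upwards [continuous_fst.continuousAt.eventually T.form] with p hp
    exact hp p.2

/-- The acceleration -Γ(y, y) is the one for which the Euler-Lagrange covector of α² vanishes, a
condition invariant under coordinate changes. -/
theorem christoffelForm_eq (y : Euc n) :
    accelLift ψ (x, y) (-christoffelForm a x y y)
      = -christoffelForm a' (ψ x) (fderiv ℝ ψ x y) (fderiv ℝ ψ x y) := by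
  rw [← add_eq_zero_iff_eq_neg]
  refine h'.metricFormData.eq_zero fun w => ?_
  obtain ⟨v, rfl⟩ := T.surjective w
  have h1 := (h.alphaBetaJet y (-christoffelForm a x y y)).eulerLagrange_A v
  have h2 := (h'.alphaBetaJet (fderiv ℝ ψ x y)
    (accelLift ψ (x, y) (-christoffelForm a x y y))).eulerLagrange_A (fderiv ℝ ψ x v)
  rw [eulerLagrange_tangentLift (ψ := ψ) (L' := metricEnergy fun x' => matForm (a' x'))
    (p := (x, y)) T.contDiffAt (h'.alphaBetaJet (fderiv ℝ ψ x y) 0).contDiffAt_A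
    (h.alphaBetaJet y 0).contDiffAt_A ?_, neg_add_cancel] at h1
  · have h3 := h2.symm.trans h1
    simp only [map_zero, zero_apply, mul_zero] at h3
    linarith
  · filter_upwards [continuous_fst.continuousAt.eventually T.metric] with p hp
    exact hp p.2

/-- At the acceleration -Γ(y, y) of a geodesic of α, the derivative of β along the jet is r₀₀, and
this derivative does not depend on coordinates. -/
theorem rForm_eq (y : Euc n) :
    rForm a' b' (ψ x) (fderiv ℝ ψ x y) (fderiv ℝ ψ x y) = rForm a b x y y := by
  have h1 := (h.alphaBetaJet y (-christoffelForm a x y y)).fderiv_B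
  have h2 := (h'.alphaBetaJet (fderiv ℝ ψ x y)
    (-christoffelForm a' (ψ x) (fderiv ℝ ψ x y) (fderiv ℝ ψ x y))).fderiv_B
  rw [fderiv_comp_tangentLift (ψ := ψ) (L' := formEval fun x' => covForm (b' x')) (p := (x, y))
    T.contDiffAt ((h'.alphaBetaJet (fderiv ℝ ψ x y) 0).contDiffAt_B.differentiableAt (by norm_num))
    ?_, neg_add_cancel, map_zero, add_zero] at h1
  · rw [neg_add_cancel, map_zero, add_zero, ← T.christoffelForm_eq h h'] at h2
    exact h2.symm.trans h1
  · filter_upwards [continuous_fst.continuousAt.eventually T.form] with p hp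
    exact hp p.2

theorem bUpVec_eq : fderiv ℝ ψ x (bUpVec a b x) = bUpVec a' b' (ψ x) :=
  T.eq_of_matForm h h' fun v => by
    rw [h.metricFormData.bv_eq, h'.metricFormData.bv_eq, T.covForm_eq]

theorem bSq_eq : bSq a' b' (ψ x) = bSq a b x := by
  rw [← covForm_bUpVec, ← covForm_bUpVec, ← T.bUpVec_eq h h', T.covForm_eq]

theorem sVecVec_eq : fderiv ℝ ψ x (sVecVec a b x) = sVecVec a' b' (ψ x) :=
  T.eq_of_matForm h h' fun v => by
    rw [h.metricFormData.sv_eq, h'.metricFormData.sv_eq, ← T.bUpVec_eq h h', T.sForm_eq h h']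

end IsLocalTransition

end LocalTransition

/-! ### Metrics and forms on the manifold, read in charts. -/

section ChartLayer

variable {n : ℕ} {M : Type*} [TopologicalSpace M] [ChartedSpace (Euc n) M]
  [IsManifold (𝓡 n) ∞ M] {e e' : OpenPartialHomeomorph M (Euc n)} {u : Euc n}

theorem IsSmoothChart.contMDiffOn_symm (he : IsSmoothChart e) :
    ContMDiffOn (𝓡 n) (𝓡 n) ∞ e.symm e.target :=
  contMDiffOn_symm_of_mem_maximalAtlas he

theorem IsSmoothChart.mdifferentiableAt_symm (he : IsSmoothChart e) (hu : u ∈ e.target) :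
    MDifferentiableAt (𝓡 n) (𝓡 n) e.symm u :=
  (he.contMDiffOn_symm.contMDiffAt (e.open_target.mem_nhds hu)).mdifferentiableAt (by simp)

theorem IsSmoothChart.mDifferentiable (he : IsSmoothChart e) : e.MDifferentiable (𝓡 n) (𝓡 n) :=
  ⟨(contMDiffOn_of_mem_maximalAtlas he).mdifferentiableOn (by simp),
    he.contMDiffOn_symm.mdifferentiableOn (by simp)⟩

theorem contMDiffOn_tangentMap_symm (he : IsSmoothChart e) :
    ContMDiffOn (𝓡 n).tangent (𝓡 n).tangent ∞ (tangentMap (𝓡 n) (𝓡 n) e.symm)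
      (Bundle.TotalSpace.proj ⁻¹' e.target) := by
  refine ContMDiffOn.congr (he.contMDiffOn_symm.contMDiffOn_tangentMapWithin (m := ∞) (by simp)
    e.open_target.uniqueMDiffOn) fun p hp => ?_
  rw [tangentMapWithin_eq_tangentMap (e.open_target.uniqueMDiffWithinAt hp)
    (he.mdifferentiableAt_symm hp)]

theorem contMDiffAt_tangentPoint (he : IsSmoothChart e) (hu : u ∈ e.target) (y : Euc n) :
    ContMDiffAt (𝓡 n) (𝓡 n).tangent ∞ (fun u' => tangentPoint e u' y) u := by
  have h1 : ContMDiffAt (𝓡 n) (𝓡 n).tangent ∞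
      (fun u' : Euc n => (⟨u', y⟩ : TangentBundle (𝓡 n) (Euc n))) u :=
    contMDiffAt_vectorSpace_iff_contDiffAt.2 (contDiffAt_const (c := y))
  have h2 : ContMDiffAt (𝓡 n).tangent (𝓡 n).tangent ∞ (tangentMap (𝓡 n) (𝓡 n) e.symm)
      (⟨u, y⟩ : TangentBundle (𝓡 n) (Euc n)) :=
    (contMDiffOn_tangentMap_symm he).contMDiffAt
      ((e.open_target.preimage (FiberBundle.continuous_proj _ _)).mem_nhds hu)
  exact ContMDiffAt.comp (g := tangentMap (𝓡 n) (𝓡 n) e.symm) u h2 h1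

theorem continuousAt_tangentPoint (he : IsSmoothChart e) (hu : u ∈ e.target) (y : Euc n) :
    ContinuousAt (fun p : Euc n × Euc n => tangentPoint e p.1 p.2) (u, y) := by
  have h1 : Continuous fun p : Euc n × Euc n => (⟨p.1, p.2⟩ : TangentBundle (𝓡 n) (Euc n)) :=
    (tangentBundleModelSpaceHomeomorph (𝓡 n)).symm.continuous
  have h2 : ContinuousAt (tangentMap (𝓡 n) (𝓡 n) e.symm)
      (⟨u, y⟩ : TangentBundle (𝓡 n) (Euc n)) :=
    (contMDiffOn_tangentMap_symm he).continuousOn.continuousAt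
      ((e.open_target.preimage (FiberBundle.continuous_proj _ _)).mem_nhds hu)
  exact ContinuousAt.comp (g := tangentMap (𝓡 n) (𝓡 n) e.symm) (x := (u, y)) h2 h1.continuousAt

theorem tangentVec_bijective (he : IsSmoothChart e) (hu : u ∈ e.target) :
    Function.Bijective (tangentVec e u) :=
  he.mDifferentiable.symm.mfderiv_bijective hu

/-- The coordinate expression of the tangent vectors at a point of a chart. -/
def tangentCLM (e : OpenPartialHomeomorph M (Euc n)) (u : Euc n) :
    Euc n →L[ℝ] TangentSpace (𝓡 n) (e.symm u) :=
  mfderiv (𝓡 n) (𝓡 n) e.symm u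

theorem tangentCLM_apply (y : Euc n) : tangentCLM e u y = tangentVec e u y := rfl

theorem tangentVec_eq_sum (y : Euc n) :
    tangentVec e u y = ∑ i, y i • tangentVec e u (EuclideanSpace.single i 1) := by
  conv_lhs => rw [← tangentCLM_apply, ← sum_smul_single y, map_sum]
  simp_rw [map_smul]
  rfl

theorem contDiffAt_oneForm_coeff (β : OneForm n M) (he : IsSmoothChart e) (hu : u ∈ e.target)
    (y : Euc n) : ContDiffAt ℝ ∞ (fun u' => OneForm.eval β (tangentPoint e u' y)) u := by
  rw [← contMDiffAt_iff_contDiffAt]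
  have h1 := ContMDiffAt.comp (g := fun x => Bundle.TotalSpace.mk' (Euc n →L[ℝ] ℝ)
    (E := fun x : M => TangentSpace (𝓡 n) x →L[ℝ] Bundle.Trivial M ℝ x) x (β x)) u
    (β.contMDiff (e.symm u)) (he.contMDiffOn_symm.contMDiffAt (e.open_target.mem_nhds hu))
  have h2 := ContMDiffAt.clm_bundle_apply (F₂ := ℝ) (E₂ := Bundle.Trivial M ℝ)
    (v := fun u' => tangentVec e u' y) h1 (contMDiffAt_tangentPoint he hu y)
  exact ((Bundle.contMDiffAt_totalSpace).1 h2).2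

theorem contDiffAt_metric_coeff (g : RiemMetric n M) (he : IsSmoothChart e) (hu : u ∈ e.target)
    (y z : Euc n) :
    ContDiffAt ℝ ∞ (fun u' => g.inner (e.symm u') (tangentVec e u' y) (tangentVec e u' z)) u := by
  rw [← contMDiffAt_iff_contDiffAt]
  have h1 := ContMDiffAt.comp (g := fun x => Bundle.TotalSpace.mk' (Euc n →L[ℝ] Euc n →L[ℝ] ℝ)
    (E := fun x : M => TangentSpace (𝓡 n) x →L[ℝ] TangentSpace (𝓡 n) x →L[ℝ] ℝ) x (g.inner x)) u
    (g.contMDiff (e.symm u)) (he.contMDiffOn_symm.contMDiffAt (e.open_target.mem_nhds hu))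
  have h2 := ContMDiffAt.clm_bundle_apply₂ (F₃ := ℝ) (E₃ := Bundle.Trivial M ℝ)
    (v := fun u' => tangentVec e u' y) (w := fun u' => tangentVec e u' z)
    h1 (contMDiffAt_tangentPoint he hu y) (contMDiffAt_tangentPoint he hu z)
  exact ((Bundle.contMDiffAt_totalSpace).1 h2).2

theorem metric_tangentVec (g : RiemMetric n M) (y z : Euc n) :
    g.inner (e.symm u) (tangentVec e u y) (tangentVec e u z) = matForm (g.coeff e u) y z := by
  rw [tangentVec_eq_sum y, tangentVec_eq_sum z, matForm_apply]
  simp only [map_sum, map_smul, ContinuousLinearMap.sum_apply, ContinuousLinearMap.smul_apply,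
    smul_eq_mul, Finset.mul_sum]
  rw [Finset.sum_comm]
  refine Finset.sum_congr rfl fun i _ => Finset.sum_congr rfl fun j _ => ?_
  simp [RiemMetric.coeff]
  ring

theorem oneForm_tangentVec (β : OneForm n M) (y : Euc n) :
    OneForm.eval β (tangentPoint e u y) = covForm (β.coeff e u) y := by
  change β (e.symm u) (tangentVec e u y) = _
  rw [tangentVec_eq_sum y, covForm_apply, map_sum]
  refine Finset.sum_congr rfl fun i _ => ?_
  rw [map_smul, smul_eq_mul, mul_comm]
  rfl

theorem isLocalPair_coeff (g : RiemMetric n M) (β : OneForm n M) (hβ : ∀ x : M, β x ≠ 0)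
    (he : IsSmoothChart e) (hu : u ∈ e.target) : IsLocalPair (g.coeff e) (β.coeff e) u where
  contDiffAt_metric i j := (contDiffAt_metric_coeff g he hu _ _).of_le ENat.LEInfty.out
  contDiffAt_form i := (contDiffAt_oneForm_coeff β he hu _).of_le ENat.LEInfty.out
  symm := Eventually.of_forall fun u' => by
    ext i j
    simp only [Matrix.transpose_apply, RiemMetric.coeff, Matrix.of_apply]
    exact g.symm _ _ _
  pos v hv := by
    rw [← metric_tangentVec]
    refine g.pos _ _ fun h0 => hv ((tangentVec_bijective he hu).1 ?_)
    rw [h0]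
    exact (map_zero (tangentCLM e u)).symm
  ne_zero h0 := hβ (e.symm u) <| by
    refine ContinuousLinearMap.ext fun v => ?_
    obtain ⟨y, rfl⟩ := (tangentVec_bijective he hu).2 v
    have h1 := oneForm_tangentVec (e := e) (u := u) β y
    rw [h0] at h1
    exact h1

theorem metric_tangentPoint (g : RiemMetric n M) (y : Euc n) :
    g.inner (tangentPoint e u y).1 (tangentPoint e u y).2 (tangentPoint e u y).2
      = matForm (g.coeff e u) y y :=
  metric_tangentVec g y y

theorem alpha_tangentPoint (g : RiemMetric n M) (y : Euc n) :
    RiemMetric.alpha g (tangentPoint e u y) = √(matForm (g.coeff e u) y y) := by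
  rw [RiemMetric.alpha, metric_tangentPoint]

theorem alpha_tangentPoint_sq (g : RiemMetric n M) (y : Euc n) :
    RiemMetric.alpha g (tangentPoint e u y) ^ 2 = matForm (g.coeff e u) y y := by
  rw [alpha_tangentPoint, Real.sq_sqrt]
  rw [← metric_tangentPoint]
  by_cases h0 : (tangentPoint e u y).2 = 0
  · rw [h0, map_zero]
  · exact (g.pos _ _ h0).le

theorem localExpr_qMetric (g : RiemMetric n M) (β : OneForm n M) (q : ℝ) (y : Euc n) :
    localExpr (qMetric g β q) e u y = covForm (β.coeff e u) y ^ q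
      / (covForm (β.coeff e u) y - √(matForm (g.coeff e u) y y)) ^ (q - 1) := by
  rw [localExpr, qMetric, oneForm_tangentVec, alpha_tangentPoint]

theorem localExpr_kropina (g : RiemMetric n M) (β : OneForm n M) (y : Euc n) :
    localExpr (kropina g β) e u y = matForm (g.coeff e u) y y / covForm (β.coeff e u) y := by
  rw [localExpr, kropina, oneForm_tangentVec, alpha_tangentPoint_sq]

theorem sprayVec_alpha (g : RiemMetric n M) (β : OneForm n M) (hβ : ∀ x : M, β x ≠ 0)
    (he : IsSmoothChart e) (hu : u ∈ e.target) (y : Euc n) :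
    sprayVec (localExpr (RiemMetric.alpha g) e) u y
      = (1 / 2 : ℝ) • christoffelForm (g.coeff e) u y y := by
  have h := isLocalPair_coeff g β hβ he hu
  exact sprayVec_riemannian h.contDiffAt_metric h.symm h.pos
    (Eventually.of_forall fun u' y' => alpha_tangentPoint_sq g y') y

/-- For α < β both bases are positive; for integer q the real powers are integer powers of nonzero
numbers, whatever the signs. -/
theorem ne_zero_of_mem_qDomain {g : RiemMetric n M} {β : OneForm n M} {q : ℝ}
    {p : TangentBundle (𝓡 n) M} (hp : p ∈ qDomain g β q) :
    OneForm.eval β p ≠ 0 ∧ OneForm.eval β p - RiemMetric.alpha g p ≠ 0 ∧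
      OneForm.eval β p ^ q ≠ 0 ∧ (OneForm.eval β p - RiemMetric.alpha g p) ^ (q - 1) ≠ 0 := by
  rcases hp with h | ⟨⟨m, rfl⟩, h1, h2⟩
  · have h0 : 0 < OneForm.eval β p := (Real.sqrt_nonneg _).trans_lt h
    have h1 := sub_pos.2 h
    exact ⟨h0.ne', h1.ne', (Real.rpow_pos_of_pos h0 _).ne', (Real.rpow_pos_of_pos h1 _).ne'⟩
  · have h3 := sub_ne_zero.2 h2
    refine ⟨h1, h3, ?_, ?_⟩
    · rw [Real.rpow_intCast]
      exact zpow_ne_zero _ h1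
    · rw [← Int.cast_one, ← Int.cast_sub, Real.rpow_intCast]
      exact zpow_ne_zero _ h3

theorem tangentPoint_smul (c : ℝ) (y : Euc n) : tangentPoint e u (c • y)
    = ⟨(tangentPoint e u y).1, c • (tangentPoint e u y).2⟩ := by
  have : tangentVec e u (c • y) = c • tangentVec e u y := map_smul (tangentCLM e u) c y
  rw [tangentPoint, this]
  rfl

theorem eventually_tangentPoint_mem {D : Set (TangentBundle (𝓡 n) M)} (hD : IsOpen D)
    (he : IsSmoothChart e) (hu : u ∈ e.target) {y : Euc n} (hy : tangentPoint e u y ∈ D) :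
    ∀ᶠ p : Euc n × Euc n in 𝓝 (u, y), tangentPoint e p.1 p.2 ∈ D :=
  (continuousAt_tangentPoint he hu y).eventually (hD.mem_nhds hy)

theorem isLocalQMetric_localExpr {g : RiemMetric n M} {β : OneForm n M} {q : ℝ}
    {D : Set (TangentBundle (𝓡 n) M)} (hD : D ⊆ qDomain g β q)
    (hF : IsConicFinsler (qMetric g β q) D) (he : IsSmoothChart e) (hu : u ∈ e.target) {y : Euc n}
    (hy : tangentPoint e u y ∈ D) :
    IsLocalQMetric (g.coeff e) (β.coeff e) q (localExpr (qMetric g β q) e) u y where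
  eq := Eventually.of_forall fun p => localExpr_qMetric g β q p.2
  homogeneous := by
    filter_upwards [eventually_tangentPoint_mem hF.isOpen he hu hy] with p hp
    filter_upwards [lt_mem_nhds one_pos] with c hc
    simp only [localExpr, tangentPoint_smul]
    exact hF.homogeneous _ hp c hc
  det_ne_zero := hF.nondegenerate e he u hu y hy
  ne_zero := by
    obtain ⟨-, -, h1, h2⟩ := ne_zero_of_mem_qDomain (hD hy)
    exact div_ne_zero h1 h2
  vec_ne_zero h0 := hF.ne_zero _ hy <| by
    rw [h0]
    exact map_zero (tangentCLM e u)
  beta_ne_zero := by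
    rw [← oneForm_tangentVec]
    exact (ne_zero_of_mem_qDomain (hD hy)).1
  beta_sub_alpha_ne_zero := by
    rw [← oneForm_tangentVec, ← alpha_tangentPoint]
    exact (ne_zero_of_mem_qDomain (hD hy)).2.1
  rpow_ne_zero := by
    filter_upwards [eventually_tangentPoint_mem hF.isOpen he hu hy] with p hp
    simp only [formEval, metricEnergy]
    rw [← oneForm_tangentVec, ← alpha_tangentPoint]
    exact (ne_zero_of_mem_qDomain (hD hp)).2.2.2

theorem tangentMap_symm_comp_self (he' : IsSmoothChart e') {p : TangentBundle (𝓡 n) M}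
    (hp : p.1 ∈ e'.source) :
    tangentMap (𝓡 n) (𝓡 n) e'.symm (tangentMap (𝓡 n) (𝓡 n) e' p) = p := by
  have h1 := he'.mDifferentiable.symm_comp_deriv hp
  refine Bundle.TotalSpace.ext (e'.left_inv hp) ?_
  exact heq_of_eq (congrArg (fun A : Euc n →L[ℝ] Euc n => A p.2) h1)

theorem tangentPoint_transition (he : IsSmoothChart e) (he' : IsSmoothChart e')
    (hu : u ∈ e.target) (hu' : e.symm u ∈ e'.source) (y : Euc n) :
    tangentPoint e' ((e' ∘ e.symm) u) (fderiv ℝ (e' ∘ e.symm) u y) = tangentPoint e u y := by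
  have h1 := tangentMap_comp_at (I := 𝓡 n) (I' := 𝓡 n) (I'' := 𝓡 n) (f := e.symm) (g := e')
    (⟨u, y⟩ : TangentBundle (𝓡 n) (Euc n)) (he'.mDifferentiable.mdifferentiableAt hu')
    (he.mdifferentiableAt_symm hu)
  have h2 : tangentMap (𝓡 n) (𝓡 n) (e' ∘ e.symm) (⟨u, y⟩ : TangentBundle (𝓡 n) (Euc n))
      = ⟨(e' ∘ e.symm) u, fderiv ℝ (e' ∘ e.symm) u y⟩ := by
    rw [tangentMap, mfderiv_eq_fderiv]
    rfl
  rw [← tangentMap_symm_comp_self he' (p := tangentPoint e u y) hu']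
  change tangentMap (𝓡 n) (𝓡 n) e'.symm ⟨(e' ∘ e.symm) u, fderiv ℝ (e' ∘ e.symm) u y⟩ = _
  rw [← h2, h1]
  rfl

theorem contDiffAt_transition (he : IsSmoothChart e) (he' : IsSmoothChart e')
    (hu : u ∈ e.target) (hu' : e.symm u ∈ e'.source) : ContDiffAt ℝ ∞ (e' ∘ e.symm) u := by
  rw [← contMDiffAt_iff_contDiffAt]
  exact ContMDiffAt.comp u
    ((contMDiffOn_of_mem_maximalAtlas he').contMDiffAt (e'.open_source.mem_nhds hu'))
    (he.contMDiffOn_symm.contMDiffAt (e.open_target.mem_nhds hu))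

theorem eventually_mem_source (hu : u ∈ e.target) (hu' : e.symm u ∈ e'.source) :
    ∀ᶠ u' in 𝓝 u, u' ∈ e.target ∧ e.symm u' ∈ e'.source :=
  (e.open_target.mem_nhds hu |> Filter.eventually_of_mem <| fun _ h => h).and
    ((e.continuousAt_symm hu).eventually (e'.open_source.mem_nhds hu'))

/-- Injectivity follows since coordinate vectors with equal image represent the same tangent vector;
in finite dimension this suffices. -/
theorem surjective_fderiv_transition (he : IsSmoothChart e) (he' : IsSmoothChart e')
    (hu : u ∈ e.target) (hu' : e.symm u ∈ e'.source) :
    Function.Surjective (fderiv ℝ (e' ∘ e.symm) u) := by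
  refine (LinearMap.injective_iff_surjective
    (f := (fderiv ℝ (e' ∘ e.symm) u : Euc n →ₗ[ℝ] Euc n))).1 fun y z hyz => ?_
  refine (tangentVec_bijective he hu).1 ?_
  have h1 := tangentPoint_transition he he' hu hu' y
  have h2 : fderiv ℝ (e' ∘ e.symm) u y = fderiv ℝ (e' ∘ e.symm) u z := hyz
  rw [h2, tangentPoint_transition he he' hu hu' z] at h1
  exact (Bundle.TotalSpace.mk_inj.1 h1).symm

theorem isLocalTransition_coeff (g : RiemMetric n M) (β : OneForm n M) (he : IsSmoothChart e)
    (he' : IsSmoothChart e') (hu : u ∈ e.target) (hu' : e.symm u ∈ e'.source) :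
    IsLocalTransition (e' ∘ e.symm) (g.coeff e) (β.coeff e) (g.coeff e') (β.coeff e') u where
  contDiffAt := (contDiffAt_transition he he' hu hu').of_le ENat.LEInfty.out
  surjective := surjective_fderiv_transition he he' hu hu'
  metric := by
    filter_upwards [eventually_mem_source hu hu'] with u' h' y
    rw [← metric_tangentPoint, ← metric_tangentPoint, tangentPoint_transition he he' h'.1 h'.2]
  form := by
    filter_upwards [eventually_mem_source hu hu'] with u' h' y
    rw [← oneForm_tangentVec, ← oneForm_tangentVec, tangentPoint_transition he he' h'.1 h'.2]

end ChartLayer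

/-! ### Gluing local components to a global 1-form. -/

section GluingForms

variable {n : ℕ} {M : Type*} [TopologicalSpace M] [ChartedSpace (Euc n) M]
  [IsManifold (𝓡 n) ∞ M]

theorem isSmoothChart_chartAt (x : M) : IsSmoothChart (chartAt (Euc n) x) :=
  IsManifold.chart_mem_maximalAtlas x

/-- The covector at `x` with components `c e (e x)` in the preferred chart `e` at `x`. -/
def gluedCovector (c : OpenPartialHomeomorph M (Euc n) → Euc n → Fin n → ℝ) (x : M) :
    TangentSpace (𝓡 n) x →L[ℝ] Bundle.Trivial M ℝ x :=
  (covForm (c (chartAt (Euc n) x) (chartAt (Euc n) x x))).comp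
    (mfderiv (𝓡 n) (𝓡 n) (chartAt (Euc n) x) x)

/-- Local families of components obeying the transformation law of covectors. -/
def IsCovectorFamily (c : OpenPartialHomeomorph M (Euc n) → Euc n → Fin n → ℝ) : Prop :=
  ∀ e e' : OpenPartialHomeomorph M (Euc n), IsSmoothChart e → IsSmoothChart e' →
    ∀ u ∈ e.target, e.symm u ∈ e'.source → ∀ y,
      covForm (c e' ((e' ∘ e.symm) u)) (fderiv ℝ (e' ∘ e.symm) u y) = covForm (c e u) y

variable {c : OpenPartialHomeomorph M (Euc n) → Euc n → Fin n → ℝ}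

theorem IsCovectorFamily.gluedCovector_tangentVec (hc : IsCovectorFamily c)
    {e : OpenPartialHomeomorph M (Euc n)} (he : IsSmoothChart e) {u : Euc n} (hu : u ∈ e.target)
    (y : Euc n) : gluedCovector c (e.symm u) (tangentVec e u y) = covForm (c e u) y := by
  have h1 := isSmoothChart_chartAt (n := n) (e.symm u)
  rw [← hc e _ he h1 u hu (mem_chart_source _ _) y]
  have h2 := mfderiv_comp (I := 𝓡 n) (I' := 𝓡 n) (I'' := 𝓡 n) u
    (h1.mDifferentiable.mdifferentiableAt (mem_chart_source _ (e.symm u)))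
    (he.mdifferentiableAt_symm hu)
  rw [mfderiv_eq_fderiv] at h2
  rw [h2]
  rfl

theorem IsCovectorFamily.contMDiff_gluedCovector (hc : IsCovectorFamily c)
    (hs : ∀ e : OpenPartialHomeomorph M (Euc n), IsSmoothChart e → ∀ u ∈ e.target, ∀ k,
      ContDiffAt ℝ ∞ (fun u' => c e u' k) u) :
    ContMDiff (𝓡 n) ((𝓡 n).prod 𝓘(ℝ, Euc n →L[ℝ] ℝ)) ∞
      (fun x => Bundle.TotalSpace.mk' (Euc n →L[ℝ] ℝ)
        (E := fun x : M => TangentSpace (𝓡 n) x →L[ℝ] Bundle.Trivial M ℝ x) x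
        (gluedCovector c x)) := by
  intro x₀
  rw [contMDiffAt_hom_bundle]
  refine ⟨contMDiffAt_id, ?_⟩
  have he := isSmoothChart_chartAt (n := n) x₀
  set e := chartAt (Euc n) x₀ with he_def
  have hx₀ : x₀ ∈ e.source := mem_chart_source _ x₀
  have h1 : ContMDiffAt (𝓡 n) 𝓘(ℝ, Euc n →L[ℝ] ℝ) ∞ (fun x => covForm (c e (e x))) x₀ :=
    ContMDiffAt.comp (g := fun u => covForm (c e u)) x₀
      (contDiffAt_covForm fun k => hs e he (e x₀) (e.map_source hx₀) k).contMDiffAt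
      ((contMDiffOn_of_mem_maximalAtlas he).contMDiffAt (e.open_source.mem_nhds hx₀))
  -- The glued covector uses a different preferred chart at each x, but by the transformation law
  -- its expression in the trivialization at x₀ is given by the components in the fixed chart `e`.
  refine h1.congr_of_eventuallyEq ?_
  filter_upwards [e.open_source.mem_nhds hx₀] with x hx
  refine ContinuousLinearMap.ext fun y => ?_
  have h2 := hc.gluedCovector_tangentVec he (e.map_source hx) y
  rw [← h2]
  have h3 : (trivializationAt (Euc n) (TangentSpace (𝓡 n)) x₀).symmL ℝ x
      = mfderivWithin (𝓡 n) (𝓡 n) (extChartAt (𝓡 n) x₀).symm (Set.range (𝓡 n))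
        (extChartAt (𝓡 n) x₀ x) := TangentBundle.symmL_trivializationAt hx
  have h4 : mfderivWithin (𝓡 n) (𝓡 n) (extChartAt (𝓡 n) x₀).symm (Set.range (𝓡 n))
        (extChartAt (𝓡 n) x₀ x) = mfderiv (𝓡 n) (𝓡 n) e.symm (e x) := by
    simp only [modelWithCornersSelf_coe, Set.range_id, mfderivWithin_univ]
    rfl
  have h5 : e.symm (e x) = x := e.left_inv hx
  have h6 : ContinuousLinearMap.inCoordinates (Euc n) (TangentSpace (𝓡 n)) ℝ (Bundle.Trivial M ℝ)
      x₀ x x₀ x (gluedCovector c x) y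
      = gluedCovector c x ((trivializationAt (Euc n) (TangentSpace (𝓡 n)) x₀).symmL ℝ x y) := by
    rw [ContinuousLinearMap.inCoordinates]
    have h8 : (trivializationAt ℝ (Bundle.Trivial M ℝ) x₀).continuousLinearMapAt ℝ x
      = ContinuousLinearMap.id ℝ ℝ := Bundle.Trivial.continuousLinearMapAt_trivialization ℝ M ℝ x
    rw [h8]
    rfl
  -- Needed because `e.symm (e x)` and `x` are only propositionally equal while the fibre depends on
  -- the point.
  have h7 : ∀ x' (hx' : x' = x) (w : Euc n),
      (gluedCovector c x' w : ℝ) = gluedCovector c x w := by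
    rintro _ rfl w
    rfl
  refine h6.trans ?_
  rw [h3, h4]
  exact (h7 _ h5 _).symm

/-- Smooth families of components obeying the transformation law of covectors define `1`-forms. -/
theorem IsCovectorFamily.exists_oneForm (hc : IsCovectorFamily c)
    (hs : ∀ e : OpenPartialHomeomorph M (Euc n), IsSmoothChart e → ∀ u ∈ e.target, ∀ k,
      ContDiffAt ℝ ∞ (fun u' => c e u' k) u) :
    ∃ θ : OneForm n M, ∀ e : OpenPartialHomeomorph M (Euc n), IsSmoothChart e →
      ∀ u ∈ e.target, ∀ y, OneForm.eval θ (tangentPoint e u y) = covForm (c e u) y :=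
  ⟨⟨gluedCovector c, hc.contMDiff_gluedCovector hs⟩,
    fun _ he _ hu y => hc.gluedCovector_tangentVec he hu y⟩

end GluingForms

/-! ### Smooth dependence of the coordinate tensors on the point. -/

section SmoothComponents

variable {n : ℕ} {x : Euc n}

theorem ContDiffAt.pd {f : Euc n → ℝ} (hf : ContDiffAt ℝ ∞ f x) (i : Fin n) :
    ContDiffAt ℝ ∞ (fun x' => pd i f x') x :=
  (hf.fderiv_right (m := ∞) (by simp)).clm_apply contDiffAt_const

theorem contDiffAt_det {k : WithTop ℕ∞} {N : Euc n → Matrix (Fin n) (Fin n) ℝ}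
    (hN : ∀ i j, ContDiffAt ℝ k (fun x' => N x' i j) x) :
    ContDiffAt ℝ k (fun x' => (N x').det) x := by
  simp only [Matrix.det_apply]
  refine ContDiffAt.sum fun σ _ => ?_
  refine ContDiffAt.const_smul _ ?_
  exact contDiffAt_prod fun i _ => hN _ _

theorem contDiffAt_inv_apply {k : WithTop ℕ∞} {N : Euc n → Matrix (Fin n) (Fin n) ℝ}
    (hN : ∀ i j, ContDiffAt ℝ k (fun x' => N x' i j) x) (h0 : (N x).det ≠ 0) (i j : Fin n) :
    ContDiffAt ℝ k (fun x' => (N x')⁻¹ i j) x := by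
  simp only [Matrix.inv_def, Matrix.smul_apply, Matrix.adjugate_apply, Ring.inverse_eq_inv',
    smul_eq_mul]
  refine ((contDiffAt_det hN).inv h0).mul (contDiffAt_det fun i' j' => ?_)
  by_cases h : i' = j
  · subst h
    simpa using contDiffAt_const
  · simpa [Matrix.updateRow_ne h] using hN i' j'

variable {a : Euc n → Matrix (Fin n) (Fin n) ℝ} {b : Euc n → Fin n → ℝ}
  (ha : ∀ i j, ContDiffAt ℝ ∞ (fun x' => a x' i j) x) (h0 : (a x).det ≠ 0)
  (hb : ∀ i, ContDiffAt ℝ ∞ (fun x' => b x' i) x)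
include ha h0

theorem contDiffAt_christoffel (k i j : Fin n) :
    ContDiffAt ℝ ∞ (fun x' => christoffel a x' k i j) x := by
  unfold christoffel
  exact contDiffAt_const.mul (ContDiffAt.sum fun l _ => (contDiffAt_inv_apply ha h0 k l).mul
    ((((ha l j).pd i).add ((ha l i).pd j)).sub ((ha i j).pd l)))

include hb

theorem contDiffAt_covDeriv (i j : Fin n) : ContDiffAt ℝ ∞ (fun x' => covDeriv a b x' i j) x := by
  unfold covDeriv
  exact ((hb i).pd j).sub (ContDiffAt.sum fun k _ => (contDiffAt_christoffel ha h0 k i j).mul (hb k))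

theorem contDiffAt_rZeroZero (y : Euc n) : ContDiffAt ℝ ∞ (fun x' => rZeroZero a b x' y) x := by
  unfold rZeroZero rLow
  exact ContDiffAt.sum fun i _ => ContDiffAt.sum fun j _ => ((contDiffAt_const.mul
    ((contDiffAt_covDeriv ha h0 hb i j).add (contDiffAt_covDeriv ha h0 hb j i))).mul
      contDiffAt_const).mul contDiffAt_const

theorem contDiffAt_sLow (i j : Fin n) : ContDiffAt ℝ ∞ (fun x' => sLow a b x' i j) x := by
  unfold sLow
  exact contDiffAt_const.mul
    ((contDiffAt_covDeriv ha h0 hb i j).sub (contDiffAt_covDeriv ha h0 hb j i))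

theorem contDiffAt_bUp (i : Fin n) : ContDiffAt ℝ ∞ (fun x' => bUp a b x' i) x := by
  unfold bUp
  exact ContDiffAt.sum fun j _ => (contDiffAt_inv_apply ha h0 i j).mul (hb j)

theorem contDiffAt_bSq : ContDiffAt ℝ ∞ (fun x' => bSq a b x') x := by
  unfold bSq
  exact ContDiffAt.sum fun i _ => (contDiffAt_bUp ha h0 hb i).mul (hb i)

theorem contDiffAt_sVec (i : Fin n) : ContDiffAt ℝ ∞ (fun x' => sVec a b x' i) x := by
  unfold sVec sCovec
  exact ContDiffAt.sum fun j _ => (contDiffAt_inv_apply ha h0 i j).mul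
    (ContDiffAt.sum fun l _ => (contDiffAt_bUp ha h0 hb l).mul (contDiffAt_sLow ha h0 hb l j))

end SmoothComponents

/-! ### The vector field that condition 1 compares with θ y. -/

section ProjectiveDifference

variable {E : Type*} [NormedAddCommGroup E] [NormedSpace ℝ E]
  {m : E →L[ℝ] E →L[ℝ] ℝ} {b : E →L[ℝ] ℝ} {s : E →L[ℝ] E →L[ℝ] ℝ} {bv : E} {S : E →L[ℝ] E}
  {sv : E}

/-- For decomposable s the endomorphism S is explicit, and the two terms in α²/β along b^i cancel,
so the Kropina field becomes quadratic in y. -/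
theorem MetricFormData.kropinaField_eq (d : MetricFormData m b s bv S sv)
    (hs : ∀ v w, s v w = (b bv)⁻¹ * (b v * s bv w - b w * s bv v)) (r : E →L[ℝ] E →L[ℝ] ℝ) {y : E}
    (hy : b y ≠ 0) :
    kropinaField m b s bv S r y = -((b bv)⁻¹ • (m y y • sv + r y y • bv)) := by
  have h1 : S y = (b bv)⁻¹ • (s bv y • bv - b y • sv) := by
    rw [← sub_eq_zero]
    refine d.eq_zero fun v => ?_
    rw [map_sub, sub_apply, d.S_eq, hs]
    simp only [map_smul, map_sub, smul_apply, sub_apply, d.bv_eq, d.sv_eq, smul_eq_mul]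
    ring
  rw [kropinaField, h1]
  match_scalars
  · field_simp
    ring
  · field_simp

variable {n : ℕ}

/-- The vector `G_α - G_ᾱ - (ᾱ² s̄ + r̄₀₀ b̄) / (2 b̄²)`, with `a'`, `b'` the components of the second
metric and form. -/
def projDiff (a a' : Euc n → Matrix (Fin n) (Fin n) ℝ) (b' : Euc n → Fin n → ℝ) (x y : Euc n) :
    Euc n :=
  ((1 / 2 : ℝ) • (christoffelForm a x - christoffelForm a' x)) y y
    - (2 * covForm (b' x) (bUpVec a' b' x))⁻¹ •
      (matForm (a' x) y y • sVecVec a' b' x + rForm a' b' x y y • bUpVec a' b' x)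

theorem projDiff_apply (a a' : Euc n → Matrix (Fin n) (Fin n) ℝ) (b' : Euc n → Fin n → ℝ)
    (x y : Euc n) (i : Fin n) :
    projDiff a a' b' x y i = (1 / 2) * (∑ j, ∑ k, christoffel a x i j k * y j * y k
        - ∑ j, ∑ k, christoffel a' x i j k * y j * y k)
      - (2 * bSq a' b' x)⁻¹ * (matForm (a' x) y y * sVec a' b' x i
        + rZeroZero a' b' x y * bUp a' b' x i) := by
  rw [projDiff, covForm_bUpVec, rForm_self, ← christoffelForm_apply, ← christoffelForm_apply]
  rfl

/-- The difference of two connections is a tensor: both Christoffel terms acquire the same second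
derivative of ψ. The other ingredients are tensors already. -/
theorem IsLocalTransition.projDiff_eq {a a' c c' : Euc n → Matrix (Fin n) (Fin n) ℝ}
    {b d : Euc n → Fin n → ℝ} {b' d' : Euc n → Fin n → ℝ} {ψ : Euc n → Euc n} {x : Euc n}
    (T : IsLocalTransition ψ a b c d x) (h₁ : IsLocalPair a b x) (h₂ : IsLocalPair c d (ψ x))
    (T' : IsLocalTransition ψ a' b' c' d' x) (h₁' : IsLocalPair a' b' x)
    (h₂' : IsLocalPair c' d' (ψ x)) (y : Euc n) :
    fderiv ℝ ψ x (projDiff a a' b' x y) = projDiff c c' d' (ψ x) (fderiv ℝ ψ x y) := by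
  have e1 := T.christoffelForm_eq h₁ h₂ y
  have e2 := T'.christoffelForm_eq h₁' h₂' y
  simp only [accelLift, map_neg] at e1 e2
  rw [add_neg_eq_iff_eq_add, neg_add_eq_sub, eq_sub_iff_add_eq'] at e1 e2
  simp only [projDiff, map_sub, map_smul, map_add, smul_apply, sub_apply]
  rw [T'.matForm_eq h₁' h₂', T'.rForm_eq h₁' h₂', T'.sVecVec_eq h₁' h₂', T'.bUpVec_eq h₁' h₂',
    covForm_bUpVec, covForm_bUpVec, T'.bSq_eq h₁' h₂', ← e1, ← e2]
  congr 2
  abel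

end ProjectiveDifference

/-! ### Independence of the chart for θ and for the projective factor. -/

section Main

variable {n : ℕ} {M : Type*} [TopologicalSpace M] [ChartedSpace (Euc n) M]
  [IsManifold (𝓡 n) ∞ M] {q : ℝ} {g g' : RiemMetric n M} {β β' : OneForm n M}
  {D : Set (TangentBundle (𝓡 n) M)} {e e' : OpenPartialHomeomorph M (Euc n)} {u u' : Euc n}

theorem tangentPoint_injective (he : IsSmoothChart e) (hu : u ∈ e.target) (hu' : u' ∈ e.target)
    {y y' : Euc n} (h : tangentPoint e u y = tangentPoint e u' y') : u = u' ∧ y = y' := by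
  have h1 : u = u' := e.symm.injOn hu hu' (congrArg Bundle.TotalSpace.proj h)
  subst h1
  exact ⟨rfl, (tangentVec_bijective he hu).1 (Bundle.TotalSpace.mk_inj.1 h)⟩

theorem contDiffAt_projDiff (hβ : ∀ x : M, β x ≠ 0) (hβ' : ∀ x : M, β' x ≠ 0)
    (he : IsSmoothChart e) (hu : u ∈ e.target) (y : Euc n) (i : Fin n) :
    ContDiffAt ℝ ∞ (fun u' => projDiff (g.coeff e) (g'.coeff e) (β'.coeff e) u' y i) u := by
  have h := (isLocalPair_coeff g β hβ he hu).det_ne_zero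
  have h' := isLocalPair_coeff g' β' hβ' he hu
  have hd' := h'.det_ne_zero
  have hB : bSq (g'.coeff e) (β'.coeff e) u ≠ 0 := by
    rw [← covForm_bUpVec]
    exact h'.metricFormData.bSq_pos.ne'
  have ha : ∀ i j, ContDiffAt ℝ ∞ (fun u' => g.coeff e u' i j) u :=
    fun i j => contDiffAt_metric_coeff g he hu _ _
  have ha' : ∀ i j, ContDiffAt ℝ ∞ (fun u' => g'.coeff e u' i j) u :=
    fun i j => contDiffAt_metric_coeff g' he hu _ _
  have hb' : ∀ i, ContDiffAt ℝ ∞ (fun u' => β'.coeff e u' i) u :=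
    fun i => contDiffAt_oneForm_coeff β' he hu _
  simp only [projDiff_apply, ← metric_tangentVec]
  refine (contDiffAt_const.mul (ContDiffAt.sub ?_ ?_)).sub
    (((contDiffAt_const.mul (contDiffAt_bSq ha' hd' hb')).inv (mul_ne_zero two_ne_zero hB)).mul
      (((contDiffAt_metric_coeff g' he hu y y).mul (contDiffAt_sVec ha' hd' hb' i)).add
        ((contDiffAt_rZeroZero ha' hd' hb' y).mul (contDiffAt_bUp ha' hd' hb' i))))
  · exact ContDiffAt.sum fun j _ => ContDiffAt.sum fun k _ =>
      ((contDiffAt_christoffel ha h i j k).mul contDiffAt_const).mul contDiffAt_const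
  · exact ContDiffAt.sum fun j _ => ContDiffAt.sum fun k _ =>
      ((contDiffAt_christoffel ha' hd' i j k).mul contDiffAt_const).mul contDiffAt_const

/-- Transporting the vector θ(y)y between charts gives two multiples of Dψ(y), which is nonzero for
y ≠ 0, so the multipliers agree. -/
theorem isCovectorFamily_projDiff (hβ : ∀ x : M, β x ≠ 0) (hβ' : ∀ x : M, β' x ≠ 0)
    {c : OpenPartialHomeomorph M (Euc n) → Euc n → Fin n → ℝ}
    (hc : ∀ e, IsSmoothChart e → ∀ u ∈ e.target, ∀ y,
      projDiff (g.coeff e) (g'.coeff e) (β'.coeff e) u y = covForm (c e u) y • y) :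
    IsCovectorFamily c := by
  intro e e' he he' u hu hu' y
  by_cases hy : y = 0
  · simp [hy]
  have hu2 : (e' ∘ e.symm) u ∈ e'.target := e'.map_source hu'
  have T := isLocalTransition_coeff g β he he' hu hu'
  have h1 := T.projDiff_eq (isLocalPair_coeff g β hβ he hu) (isLocalPair_coeff g β hβ he' hu2)
    (isLocalTransition_coeff g' β' he he' hu hu') (isLocalPair_coeff g' β' hβ' he hu)
    (isLocalPair_coeff g' β' hβ' he' hu2) y
  rw [hc e he u hu, hc e' he' _ hu2, map_smul] at h1
  refine (smul_left_injective ℝ (fun h0 => hy ?_) h1).symm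
  exact (LinearMap.injective_iff_surjective
    (f := (fderiv ℝ (e' ∘ e.symm) u : Euc n →ₗ[ℝ] Euc n))).2 T.surjective
    (h0.trans (map_zero (fderiv ℝ (e' ∘ e.symm) u)).symm)

/-- Both sprays have the same inhomogeneous term ½D²ψ(y, y) in their transformation law, so their
difference transforms as a vector and keeps its factor. -/
theorem spray_shift_transition {F F' : TangentBundle (𝓡 n) M → ℝ} (he : IsSmoothChart e)
    (he' : IsSmoothChart e') (hu : u ∈ e.target) (hu' : u' ∈ e'.target) {y y' : Euc n}
    (hp : tangentPoint e u y = tangentPoint e' u' y')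
    (hF : ∀ e, IsSmoothChart e → ∀ u ∈ e.target, ∀ z, tangentPoint e u z = tangentPoint e' u' y' →
      ContDiffAt ℝ 2 (fun p : Euc n × Euc n => localExpr F e p.1 p.2) (u, z) ∧
        (fundamentalTensor (localExpr F e) u z).det ≠ 0)
    (hF' : ∀ e, IsSmoothChart e → ∀ u ∈ e.target, ∀ z, tangentPoint e u z = tangentPoint e' u' y' →
      ContDiffAt ℝ 2 (fun p : Euc n × Euc n => localExpr F' e p.1 p.2) (u, z) ∧
        (fundamentalTensor (localExpr F' e) u z).det ≠ 0)
    {c : ℝ}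
    (hc : sprayVec (localExpr F e) u y = sprayVec (localExpr F' e) u y + c • y) :
    sprayVec (localExpr F e') u' y' = sprayVec (localExpr F' e') u' y' + c • y' := by
  have hx : e.symm u = e'.symm u' := congrArg Bundle.TotalSpace.proj hp
  have hs : e.symm u ∈ e'.source := by
    rw [hx]
    exact e'.map_target hu'
  have h1 := (tangentPoint_transition he he' hu hs y).trans hp
  obtain ⟨h2, h3⟩ := tangentPoint_injective he' (e'.map_source hs) hu' h1
  have key : ∀ L : TangentBundle (𝓡 n) M → ℝ, (∀ e, IsSmoothChart e → ∀ u ∈ e.target, ∀ z,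
      tangentPoint e u z = tangentPoint e' u' y' →
      ContDiffAt ℝ 2 (fun p : Euc n × Euc n => localExpr L e p.1 p.2) (u, z) ∧
        (fundamentalTensor (localExpr L e) u z).det ≠ 0) →
      sprayVec (localExpr L e') u' y' = fderiv ℝ (e' ∘ e.symm) u (sprayVec (localExpr L e) u y)
        - (1 / 2 : ℝ) • fderiv ℝ (fderiv ℝ (e' ∘ e.symm)) u y y := by
    intro L hL
    have h4 := hL e he u hu y hp
    have h5 := hL e' he' u' hu' y' rfl
    have h2' : (e' ∘ e.symm) u = u' := h2
    rw [← h2', ← h3] at h5 ⊢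
    refine sprayVec_tangentLift ((contDiffAt_transition he he' hu hs).of_le ENat.LEInfty.out)
      (surjective_fderiv_transition he he' hu hs) (h4.1.pow 2) (h5.1.pow 2) h4.2 h5.2
      ?_
    filter_upwards [continuous_fst.continuousAt.eventually (eventually_mem_source hu hs)] with p hp
    rw [localExpr, localExpr, tangentPoint_transition he he' hp.1 hp.2]
  rw [key F hF, key F' hF', hc, map_add, map_smul, h3]
  abel

end Main

/-! ### The characterization in charts and on the manifold. -/

section Characterization

variable {n : ℕ} {M : Type*} [TopologicalSpace M] [ChartedSpace (Euc n) M]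
  [IsManifold (𝓡 n) ∞ M] {q : ℝ} {g g' : RiemMetric n M} {β β' : OneForm n M}
  {D : Set (TangentBundle (𝓡 n) M)} {e : OpenPartialHomeomorph M (Euc n)} {u : Euc n}

theorem eval_ne_zero_iff (hβ : ∀ x : M, β x ≠ 0) (hcol : ∃ μ : M → ℝ, ∀ x : M, β x = μ x • β' x)
    (p : TangentBundle (𝓡 n) M) : OneForm.eval β p ≠ 0 ↔ OneForm.eval β' p ≠ 0 := by
  obtain ⟨μ, hμ⟩ := hcol
  have h0 : μ p.1 ≠ 0 := fun h => hβ p.1 (by rw [hμ, h, zero_smul])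
  have h1 : OneForm.eval β p = μ p.1 * OneForm.eval β' p := by
    rw [OneForm.eval, hμ]
    rfl
  rw [h1, mul_ne_zero_iff]
  exact ⟨fun h => h.2, fun h => ⟨h0, h⟩⟩

theorem exists_shift_iff (hβ : ∀ x : M, β x ≠ 0) (hβ' : ∀ x : M, β' x ≠ 0)
    (hD : D ⊆ qDomain g β q) (hF : IsConicFinsler (qMetric g β q) D) (he : IsSmoothChart e)
    (hu : u ∈ e.target) {y : Euc n} (hy : tangentPoint e u y ∈ D ∩ kropinaDomain β') :
    (∃ c : ℝ, sprayVec (localExpr (qMetric g β q) e) u y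
        = sprayVec (localExpr (kropina g' β') e) u y + c • y) ↔
      ∀ v, qForm (matForm (g.coeff e u)) (covForm (β.coeff e u))
        ((sForm (g.coeff e) (β.coeff e) u).flip y) (rForm (g.coeff e) (β.coeff e) u y y) y
        ((2 : ℝ) • ((1 / 2 : ℝ) • (christoffelForm (g.coeff e) u
          - christoffelForm (g'.coeff e) u)) y y
          + kropinaField (matForm (g'.coeff e u)) (covForm (β'.coeff e u))
            (sForm (g'.coeff e) (β'.coeff e) u) (bUpVec (g'.coeff e) (β'.coeff e) u)
            (sEndo (g'.coeff e) (β'.coeff e) u) (rForm (g'.coeff e) (β'.coeff e) u) y) v q = 0 :=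
  (isLocalQMetric_localExpr hD hF he hu hy.1).exists_spray_eq_iff (isLocalPair_coeff g β hβ he hu)
    (isLocalPair_coeff g' β' hβ' he hu)
    (Eventually.of_forall fun p => localExpr_kropina g' β' p.2) (by
      rw [← oneForm_tangentVec]
      exact hy.2)

/-- Projective relatedness, pointwise in each chart. -/
theorem chart_necessity (hn : 3 ≤ n) (hq : q ≠ 1) (hβ : ∀ x : M, β x ≠ 0)
    (hβ' : ∀ x : M, β' x ≠ 0) (hcol : ∃ μ : M → ℝ, ∀ x : M, β x = μ x • β' x)
    (hD : D ⊆ qDomain g β q) (hF : IsConicFinsler (qMetric g β q) D)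
    (hP : ProjectivelyRelatedOn (D ∩ kropinaDomain β') (qMetric g β q) (kropina g' β'))
    (he : IsSmoothChart e) (hu : u ∈ e.target) :
    sForm (g.coeff e) (β.coeff e) u = 0 ∧ (∀ y, q * rForm (g.coeff e) (β.coeff e) u y y = 0) ∧
      (∀ v w, sForm (g'.coeff e) (β'.coeff e) u v w
        = (covForm (β'.coeff e u) (bUpVec (g'.coeff e) (β'.coeff e) u))⁻¹
          * (covForm (β'.coeff e u) v
              * sForm (g'.coeff e) (β'.coeff e) u (bUpVec (g'.coeff e) (β'.coeff e) u) w
            - covForm (β'.coeff e u) w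
              * sForm (g'.coeff e) (β'.coeff e) u (bUpVec (g'.coeff e) (β'.coeff e) u) v)) ∧
      ∃ θ : Euc n →ₗ[ℝ] ℝ, ∀ y,
        projDiff (g.coeff e) (g'.coeff e) (β'.coeff e) u y = θ y • y := by
  have hiff := eval_ne_zero_iff hβ hcol
  refine pointwise_necessity (O := {y | tangentPoint e u y ∈ D}) (by simpa using hn)
    (isLocalPair_coeff g β hβ he hu).metricFormData
    (isLocalPair_coeff g' β' hβ' he hu).metricFormData (fun y => ?_) _ _
    ((1 / 2 : ℝ) • (christoffelForm (g.coeff e) u - christoffelForm (g'.coeff e) u)) hq ?_ ?_ ?_ ?_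
  · rw [← oneForm_tangentVec, ← oneForm_tangentVec]
    exact hiff _
  · have h1 : Continuous fun y : Euc n => tangentPoint e u y :=
      continuous_iff_continuousAt.2 fun y =>
        ContinuousAt.comp (g := fun p : Euc n × Euc n => tangentPoint e p.1 p.2) (x := y)
          (continuousAt_tangentPoint he hu y) (Continuous.prodMk_right u).continuousAt
    exact hF.isOpen.preimage h1
  · obtain ⟨v, hv⟩ := hF.fiber_nonempty (e.symm u)
    obtain ⟨y, rfl⟩ := (tangentVec_bijective he hu).2 v
    exact ⟨y, hv⟩
  · intro y hy
    rw [← oneForm_tangentVec]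
    exact (hiff _).1 (ne_zero_of_mem_qDomain (hD hy)).1
  · intro y hy
    -- By collinearity β and β̄ have the same zeros, so D already lies in the Kropina domain.
    have hy' : tangentPoint e u y ∈ D ∩ kropinaDomain β' :=
      ⟨hy, (hiff _).1 (ne_zero_of_mem_qDomain (hD hy)).1⟩
    obtain ⟨P, hP⟩ := hP
    refine (exists_shift_iff hβ hβ' hD hF he hu hy').1 ⟨P (tangentPoint e u y), ?_⟩
    ext i
    exact hP e he u hu y hy' i

theorem localSpray_alpha_sub (hβ : ∀ x : M, β x ≠ 0) (he : IsSmoothChart e) (hu : u ∈ e.target)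
    (y : Euc n) (i : Fin n) :
    localSpray (RiemMetric.alpha g) e u y i - localSpray (RiemMetric.alpha g') e u y i
      = 1 / (2 * bSq (g'.coeff e) (β'.coeff e) u)
          * (RiemMetric.alpha g' (tangentPoint e u y) ^ 2 * sVec (g'.coeff e) (β'.coeff e) u i
            + rZeroZero (g'.coeff e) (β'.coeff e) u y * bUp (g'.coeff e) (β'.coeff e) u i)
        + projDiff (g.coeff e) (g'.coeff e) (β'.coeff e) u y i := by
  rw [localSpray, localSpray, ← sprayVec_apply, ← sprayVec_apply, sprayVec_alpha g β hβ he hu,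
    sprayVec_alpha g' β hβ he hu, projDiff_apply, alpha_tangentPoint_sq]
  simp only [PiLp.smul_apply, christoffelForm_apply, smul_eq_mul]
  ring

/-- If the sprays differ by a multiple of `y` in each chart, then the factor does not depend on the
chart. -/
theorem projectivelyRelatedOn_of_exists_shift {F F' : TangentBundle (𝓡 n) M → ℝ}
    (hF : ∀ e, IsSmoothChart e → ∀ u ∈ e.target, ∀ y, tangentPoint e u y ∈ D →
      ContDiffAt ℝ 2 (fun p : Euc n × Euc n => localExpr F e p.1 p.2) (u, y) ∧
        (fundamentalTensor (localExpr F e) u y).det ≠ 0)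
    (hF' : ∀ e, IsSmoothChart e → ∀ u ∈ e.target, ∀ y, tangentPoint e u y ∈ D →
      ContDiffAt ℝ 2 (fun p : Euc n × Euc n => localExpr F' e p.1 p.2) (u, y) ∧
        (fundamentalTensor (localExpr F' e) u y).det ≠ 0)
    (h : ∀ e : OpenPartialHomeomorph M (Euc n), IsSmoothChart e → ∀ u ∈ e.target, ∀ y,
      tangentPoint e u y ∈ D → ∃ c : ℝ,
        sprayVec (localExpr F e) u y = sprayVec (localExpr F' e) u y + c • y) :
    ProjectivelyRelatedOn D F F' := by
  -- The factor is read off in the preferred chart at the base point and carried to every other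
  -- chart; outside D it is set to zero.
  have h1 : ∀ p : TangentBundle (𝓡 n) M, ∃ c : ℝ,
      p ∈ D → ∀ e : OpenPartialHomeomorph M (Euc n), IsSmoothChart e → ∀ u ∈ e.target, ∀ y,
        tangentPoint e u y = p →
        sprayVec (localExpr F e) u y = sprayVec (localExpr F' e) u y + c • y := by
    intro p
    by_cases hp : p ∈ D
    swap
    · exact ⟨0, fun h => absurd h hp⟩
    have he := isSmoothChart_chartAt (n := n) p.1
    set e := chartAt (Euc n) p.1
    have hu : e p.1 ∈ e.target := e.map_source (mem_chart_source _ p.1)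
    have hx : e.symm (e p.1) = p.1 := e.left_inv (mem_chart_source _ p.1)
    obtain ⟨y, hy⟩ : ∃ y, tangentPoint e (e p.1) y = p := by
      obtain ⟨x, v⟩ := p
      obtain ⟨y, hy⟩ := (tangentVec_bijective he hu).2 (v : Euc n)
      exact ⟨y, Bundle.TotalSpace.ext hx (heq_of_eq hy)⟩
    obtain ⟨c, hc⟩ := h e he _ hu y (by rwa [hy])
    refine ⟨c, fun _ e' he' u' hu' y' hy' => ?_⟩
    refine spray_shift_transition he he' hu hu' (hy.trans hy'.symm) (fun e he u hu z hz => ?_)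
      (fun e he u hu z hz => ?_) hc
    · exact hF e he u hu z (by rwa [hz, hy'])
    · exact hF' e he u hu z (by rwa [hz, hy'])
  choose P hP using h1
  refine ⟨P, fun e he u hu y hy i => ?_⟩
  exact congrArg (fun v : Euc n => v i) (hP _ hy e he u hu y rfl)

/-- In one chart, the three conditions give the projective factor. -/
theorem chart_sufficiency (hβ : ∀ x : M, β x ≠ 0) (hβ' : ∀ x : M, β' x ≠ 0)
    (hD : D ⊆ qDomain g β q) (hF : IsConicFinsler (qMetric g β q) D) (he : IsSmoothChart e)
    (hu : u ∈ e.target) {y : Euc n} (hy : tangentPoint e u y ∈ D ∩ kropinaDomain β') {θ : ℝ}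
    (hθ : projDiff (g.coeff e) (g'.coeff e) (β'.coeff e) u y = θ • y
      - (1 / 2 : ℝ) • (q * √(matForm (g.coeff e u) y y) ^ 3 * rForm (g.coeff e) (β.coeff e) u y y
        / qDenominator (matForm (g.coeff e u)) (covForm (β.coeff e u))
          (bUpVec (g.coeff e) (β.coeff e) u) q y) • bUpVec (g.coeff e) (β.coeff e) u)
    (hs : sForm (g.coeff e) (β.coeff e) u = 0)
    (hs' : ∀ v w, sForm (g'.coeff e) (β'.coeff e) u v w
      = (covForm (β'.coeff e u) (bUpVec (g'.coeff e) (β'.coeff e) u))⁻¹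
        * (covForm (β'.coeff e u) v
            * sForm (g'.coeff e) (β'.coeff e) u (bUpVec (g'.coeff e) (β'.coeff e) u) w
          - covForm (β'.coeff e u) w
            * sForm (g'.coeff e) (β'.coeff e) u (bUpVec (g'.coeff e) (β'.coeff e) u) v)) :
    ∃ c : ℝ, sprayVec (localExpr (qMetric g β q) e) u y
      = sprayVec (localExpr (kropina g' β') e) u y + c • y := by
  rw [exists_shift_iff hβ hβ' hD hF he hu hy]
  intro v
  have h := isLocalPair_coeff g β hβ he hu
  have h' := isLocalPair_coeff g' β' hβ' he hu
  have hQ := isLocalQMetric_localExpr hD hF he hu hy.1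
  have hy' : covForm (β'.coeff e u) y ≠ 0 := by
    rw [← oneForm_tangentVec]
    exact hy.2
  -- The factor is 2θ because the form is evaluated at twice the difference of the sprays.
  have key := h.metricFormData.qForm_eq_zero hs hQ.vec_ne_zero q
    (rForm (g.coeff e) (β.coeff e) u y y) (2 * θ) (hQ.exists_smul_of_qDenominator h) v
  convert key using 2
  rw [h'.metricFormData.kropinaField_eq hs' _ hy']
  rw [projDiff, mul_inv, sub_eq_iff_eq_add] at hθ
  rw [hθ]
  module

end Characterization

theorem mainTheorem5 {n : ℕ} (hn : 3 ≤ n) {M : Type*} [TopologicalSpace M]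
    [ChartedSpace (EuclideanSpace ℝ (Fin n)) M] [IsManifold (𝓡 n) ∞ M]
    (q : ℝ) (hq : q ≠ 1) (hq' : q ≠ -1)
    (g g' : RiemMetric n M) (β β' : OneForm n M)
    (hβ : ∀ x : M, β x ≠ 0) (hβ' : ∀ x : M, β' x ≠ 0)
    (hcol : ∃ μ : M → ℝ, ∀ x : M, β x = μ x • β' x)
    (D : Set (TangentBundle (𝓡 n) M)) (hD : D ⊆ qDomain g β q)
    (hF : IsConicFinsler (qMetric g β q) D) :
    ProjectivelyRelatedOn (D ∩ kropinaDomain β') (qMetric g β q) (kropina g' β') ↔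
      (∃ θ : OneForm n M,
        ∀ e : OpenPartialHomeomorph M (EuclideanSpace ℝ (Fin n)), IsSmoothChart e →
          ∀ u ∈ e.target, ∀ y, tangentPoint e u y ∈ D ∩ kropinaDomain β' → ∀ i : Fin n,
            let A := RiemMetric.alpha g (tangentPoint e u y)
            let B := OneForm.eval β (tangentPoint e u y)
            let A' := RiemMetric.alpha g' (tangentPoint e u y)
            let a := RiemMetric.coeff g e
            let b := OneForm.coeff β e
            let a' := RiemMetric.coeff g' e
            let b' := OneForm.coeff β' e
            localSpray (RiemMetric.alpha g) e u y i - localSpray (RiemMetric.alpha g') e u y i =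
              1 / (2 * bSq a' b' u) *
                  (A' ^ 2 * sVec a' b' u i + rZeroZero a' b' u y * bUp a' b' u i)
                + OneForm.eval θ (tangentPoint e u y) * y i
                - (1 / 2) * (q * A ^ 3 * rZeroZero a b u y /
                    (B ^ 2 * (B - A) + q * (bSq a b u * A ^ 2 - B ^ 2) * A)) * bUp a b u i) ∧
      (∀ e : OpenPartialHomeomorph M (EuclideanSpace ℝ (Fin n)), IsSmoothChart e →
        ∀ u ∈ e.target, ∀ i j : Fin n,
          sLow (RiemMetric.coeff g e) (OneForm.coeff β e) u i j = 0) ∧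
      (∀ e : OpenPartialHomeomorph M (EuclideanSpace ℝ (Fin n)), IsSmoothChart e →
        ∀ u ∈ e.target, ∀ i j : Fin n,
          let a' := RiemMetric.coeff g' e
          let b' := OneForm.coeff β' e
          sLow a' b' u i j =
            1 / bSq a' b' u * (b' u i * sCovec a' b' u j - b' u j * sCovec a' b' u i)) := by
  constructor
  · intro hP
    have hnec := fun (e : OpenPartialHomeomorph M (Euc n)) (he : IsSmoothChart e) (u : Euc n)
      (hu : u ∈ e.target) => chart_necessity hn hq hβ hβ' hcol hD hF hP he hu
    refine ⟨?_, ?_, ?_⟩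
    -- As the field is θ(y)y, its k-th component at the k-th basis vector is the component θ_k; this
    -- formula is manifestly smooth in the point.
    · let c : OpenPartialHomeomorph M (Euc n) → Euc n → Fin n → ℝ := fun e u k =>
        projDiff (g.coeff e) (g'.coeff e) (β'.coeff e) u (EuclideanSpace.single k 1) k
      have hc : ∀ e, IsSmoothChart e → ∀ u ∈ e.target, ∀ y,
          projDiff (g.coeff e) (g'.coeff e) (β'.coeff e) u y = covForm (c e u) y • y := by
        intro e he u hu y
        obtain ⟨θ, hθ⟩ := (hnec e he u hu).2.2.2
        have h1 : ∀ k, c e u k = θ (EuclideanSpace.single k 1) := fun k => by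
          simp only [c]
          rw [hθ]
          simp
        rw [hθ, covForm_apply]
        congr 1
        conv_lhs => rw [← sum_smul_single y, map_sum]
        refine Finset.sum_congr rfl fun k _ => ?_
        rw [map_smul, h1, smul_eq_mul, mul_comm]
      obtain ⟨θ, hθ⟩ := (isCovectorFamily_projDiff hβ hβ' hc).exists_oneForm
        fun e he u hu k => contDiffAt_projDiff hβ hβ' he hu _ k
      refine ⟨θ, fun e he u hu y _ i => ?_⟩
      intro A B A' a b a' b'
      have h1 : q * rZeroZero a b u y = 0 := by
        rw [← rForm_self]
        exact (hnec e he u hu).2.1 y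
      -- The numerator of the last term in condition 1 is zero, so nothing has to be known about its
      -- denominator.
      have h2 : q * A ^ 3 * rZeroZero a b u y = 0 := by linear_combination A ^ 3 * h1
      rw [localSpray_alpha_sub (β' := β') hβ he hu, hc e he u hu, hθ e he u hu, h2]
      simp [a', b', A']
    · intro e he u hu i j
      have h1 := (hnec e he u hu).1
      have h2 := matForm_single (Matrix.of (sLow (g.coeff e) (β.coeff e) u)) i j
      change sForm (g.coeff e) (β.coeff e) u _ _ = _ at h2
      rw [h1] at h2
      exact h2.symm
    · intro e he u hu i j
      have h1 := (hnec e he u hu).2.2.1 (EuclideanSpace.single i 1) (EuclideanSpace.single j 1)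
      simpa only [sForm, matForm_single, covForm_bUpVec, covForm_single, matForm_sLow_bUpVec,
        Matrix.of_apply, one_div] using h1
  · rintro ⟨⟨θ, hθ⟩, hs, hs'⟩
    have hshift : ∀ e : OpenPartialHomeomorph M (Euc n), IsSmoothChart e → ∀ u ∈ e.target, ∀ y,
        tangentPoint e u y ∈ D ∩ kropinaDomain β' → ∃ c : ℝ,
          sprayVec (localExpr (qMetric g β q) e) u y
            = sprayVec (localExpr (kropina g' β') e) u y + c • y := by
      intro e he u hu y hy
      refine chart_sufficiency hβ hβ' hD hF he hu hy
        (θ := OneForm.eval θ (tangentPoint e u y)) ?_ ?_ ?_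
      · ext i
        have h1 := hθ e he u hu y hy i
        simp only at h1
        rw [localSpray_alpha_sub (β' := β') hβ he hu, add_sub_assoc, add_right_inj] at h1
        rw [h1, rForm_self, qDenominator, covForm_bUpVec, ← oneForm_tangentVec,
          ← alpha_tangentPoint]
        simp only [PiLp.sub_apply, PiLp.smul_apply, smul_eq_mul, bUpVec]
        ring
      · refine ContinuousLinearMap.ext fun v => ContinuousLinearMap.ext fun w => ?_
        simp [sForm, matForm_apply, hs e he u hu]
      · intro v w
        rw [sForm, matForm_sLow_bUpVec, matForm_sLow_bUpVec, covForm_bUpVec]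
        simp only [matForm_apply, covForm_apply, Matrix.of_apply, hs' e he u hu, one_div]
        rw [Finset.sum_mul_sum, Finset.sum_mul_sum,
          Finset.sum_comm (f := fun i j => β'.coeff e u i * w i * _), ← Finset.sum_sub_distrib,
          Finset.mul_sum]
        refine Finset.sum_congr rfl fun i _ => ?_
        rw [← Finset.sum_sub_distrib, Finset.mul_sum]
        exact Finset.sum_congr rfl fun j _ => by ring
    exact projectivelyRelatedOn_of_exists_shift (fun e he u hu y hy =>
      ⟨(isLocalQMetric_localExpr hD hF he hu hy.1).contDiffAt (isLocalPair_coeff g β hβ he hu),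
        hF.nondegenerate e he u hu y hy.1⟩) (fun e he u hu y hy => by
      have h' := isLocalPair_coeff g' β' hβ' he hu
      have hK : (fun p : Euc n × Euc n => localExpr (kropina g' β') e p.1 p.2) =ᶠ[𝓝 (u, y)]
          fun p => metricEnergy (fun x' => matForm (g'.coeff e x')) p
            / formEval (fun x' => covForm (β'.coeff e x')) p :=
        Eventually.of_forall fun p => localExpr_kropina g' β' p.2
      have hy' : covForm (β'.coeff e u) y ≠ 0 := by
        rw [← oneForm_tangentVec]
        exact hy.2
      exact ⟨h'.contDiffAt_kropina hK hy', h'.det_kropina_ne_zero hK hy'⟩) hshift
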